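/- A pseudo-Kähler Lie algebra is a triple $(\mathfrak g,g,J)$ where $\mathfrak g$ is a real finite-dimensional Lie algebra, $g$ a non-degenerate scalar product, $J$ an endomorphism with $J^2=-\mathrm{id}$, $g(J\cdot,J\cdot)=g$, vanishing Nijenhuis tensor, and $\omega=g(J\cdot,\cdot)$ closed. For an endomorphism $f$ of $\mathfrak g$ write $f^s=\frac12(f+f^*)$, $f^a=\frac12(f-f^*)$, with $f^*$ the $g$-adjoint. A pseudo-Kähler extension of $(\mathfrak g,g,J_g)$ by $(\mathfrak h,h,J_h)$ is given by a representation $\varphi\colon\mathfrak h\to\mathrm{Der}(\mathfrak g)$ with $J_g\circ\varphi(A)^s=\varphi(J_hA)^s$ and $J_g\circ\varphi(A)^a=\varphi(A)^a\circ J_g$ for all $A\in\mathfrak h$ (equivalently, $\mathfrak g\rtimes_\varphi\mathfrak h$ with $g+h$ and $J_g+J_h$ is pseudo-Kähler). Extensions $\mathfrak g\rtimes_\varphi\mathfrak h$ and $\mathfrak g'\rtimes_{\varphi'}\mathfrak h'$ are AW-related if there are Lie algebra isomorphisms $f_g\colon\mathfrak g\to\mathfrak g'$, $f_h\colon\mathfrak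 h\to\mathfrak h'$ preserving metrics and complex structures with $(f_g\varphi(A)f_g^{-1}-\varphi'(f_h(A)))^s=0$ and $[f_g\varphi(A)f_g^{-1},\varphi'(A')]=0$ for all $A\in\mathfrak h$, $A'\in\mathfrak h'$. An extension is trivial if it is AW-related to one with $\varphi'=0$. Let $\mathbb R^2=\langle a_1,a_2\rangle$ be abelian with $h=a^1\otimes a^1+a^2\otimes a^2$, $J_ha_1=a_2$. **Theorem.** Every non-trivial pseudo-Kähler extension of a $4$-dimensional pseudo-Kähler Lie algebra by a $2$-dimensional abelian Lie algebra with a (positive definite) Kähler structure is AW-related to one of the following extensions by $\mathbb R^2$ (matrices act on columns in a basis $e_1,\dots,e_4$): 1. $\mathfrak g=\mathbb R^4$ abelian, $g=e^1\otimes e^1-e^2\otimes e^2+e^3\otimes e^3-e^4\otimes e^4$, $Je_1=e_3$, $Je_2=e_4$, with $$\varphi(a_1)=a\begin{pmatrix}1&2&-1&0\\0&1&0&1\\1&0&-1&0\\0&-1&2&-1\end{pmatrix},\quad \varphi(a_2)=a\begin{pmatrix}0&1&2&1\\1&0&-1&0\\0&1&0&1\\-1&2&1&0\end{pmatrix},\quad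 a>0;$$ 2. the same $(\mathfrak g,g,J)$, with $$\varphi(a_1)=\begin{pmatrix}a&-a+c&-b&b\\a+c&-a&-b&b\\b&-b&-a&a+c\\b&-b&-a+c&a\end{pmatrix},\quad \varphi(a_2)=\begin{pmatrix}0&0&a-c&-a\\0&0&a&-a-c\\a+c&-a&0&0\\a&-a+c&0&0\end{pmatrix},$$ where $a>0$ and either $b=c=0$ or $b,c\in\mathbb R$ with $c\neq0$; 3. $\mathfrak g=\mathfrak{rh}_3$, with non-zero bracket $[e_1,e_2]=e_3$, $Je_1=e_2$, $Je_3=e_4$, $g=e^1\odot e^3+e^2\odot e^4$ (where $e^i\odot e^j=e^i\otimes e^j+e^j\otimes e^i$), with $$\varphi(a_1)=\begin{pmatrix}0&0&0&0\\0&0&0&0\\a&0&0&0\\0&-a&0&0\end{pmatrix},\quad \varphi(a_2)=\begin{pmatrix}0&0&0&0\\0&0&0&0\\0&a&0&0\\a&0&0&0\end{pmatrix},\quad a>0;$$ 4. $\mathfrak g=\mathfrak r'_2$, with non-zero brackets $[e_1,e_3]=e_3$, $[e_1,e_4]=e_4$, $[e_2,e_3]=e_4$, $[e_2,e_4]=-e_3$,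 and, for parameters $p,q,r\in\mathbb R$ with $q^2+r^2\neq0$, $$J=\begin{pmatrix}0&1&0&0\\-1&0&0&0\\0&0&0&-1\\0&0&1&0\end{pmatrix},\quad g=\begin{pmatrix}p&0&-r&q\\0&p&q&r\\-r&q&0&0\\q&r&0&0\end{pmatrix},$$ $$\varphi(a_1)=\begin{pmatrix}0&0&0&0\\0&0&0&0\\a&0&0&0\\0&a&0&0\end{pmatrix},\quad \varphi(a_2)=\begin{pmatrix}0&0&0&0\\0&0&0&0\\0&-a&0&0\\a&0&0&0\end{pmatrix},\quad a>0.$$ Moreover all these are non-trivial pseudo-Kähler extensions; consequently a $4$-dimensional pseudo-Kähler Lie algebra admits a non-trivial extension by $\mathbb R^2$ if and only if it is isomorphic, as a pseudo-Kähler Lie algebra, to $\mathbb R^4$, to $\mathfrak{rh}_3$, or to $\mathfrak r'_2$ with one of the pseudo-Kähler structures above. -/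

import Mathlib

noncomputable section

namespace PK

/-! ## Pseudo-Hermitian and pseudo-Kähler Lie algebras -/

/-- A `U(p,q)`-structure `(g, J)` on a real Lie algebra: a non-degenerate scalar product and an
almost complex structure such that `g(J·,J·) = g`. -/
structure PseudoHermitian (L : Type*) [LieRing L] [LieAlgebra ℝ L] where
  metric : LinearMap.BilinForm ℝ L
  symm : metric.IsSymm
  nondeg : metric.Nondegenerate
  J : L →ₗ[ℝ] L
  J_sq : ∀ x, J (J x) = -x
  compat : ∀ x y, metric (J x) (J y) = metric x y

/-- The Nijenhuis tensor of `J` vanishes. -/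
def PseudoHermitian.Integrable {L : Type*} [LieRing L] [LieAlgebra ℝ L]
    (P : PseudoHermitian L) : Prop :=
  ∀ x y, ⁅P.J x, P.J y⁆ - ⁅x, y⁆ - P.J (⁅P.J x, y⁆ + ⁅x, P.J y⁆) = 0

/-- The 2-form `ω = g(J·,·)`. -/
def PseudoHermitian.omega {L : Type*} [LieRing L] [LieAlgebra ℝ L]
    (P : PseudoHermitian L) (x y : L) : ℝ := P.metric (P.J x) y

/-- The 2-form `ω` is closed in the Chevalley–Eilenberg complex. -/
def PseudoHermitian.OmegaClosed {L : Type*} [LieRing L] [LieAlgebra ℝ L]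
    (P : PseudoHermitian L) : Prop :=
  ∀ x y z, P.omega ⁅x, y⁆ z + P.omega ⁅y, z⁆ x + P.omega ⁅z, x⁆ y = 0

/-- A pseudo-Kähler structure on a real Lie algebra. -/
structure PseudoKahler (L : Type*) [LieRing L] [LieAlgebra ℝ L] extends PseudoHermitian L where
  integrable : toPseudoHermitian.Integrable
  closed : toPseudoHermitian.OmegaClosed

/-- Isomorphisms of Lie algebras respecting the pseudo-Kähler structures. -/
structure PseudoKahlerEquiv {L L' : Type*} [LieRing L] [LieAlgebra ℝ L] [LieRing L']
    [LieAlgebra ℝ L'] (P : PseudoKahler L) (P' : PseudoKahler L') extends L ≃ₗ⁅ℝ⁆ L' where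
  map_metric : ∀ x y, P'.metric (toLieEquiv x) (toLieEquiv y) = P.metric x y
  map_J : ∀ x, toLieEquiv (P.J x) = P'.J (toLieEquiv x)

/-! ## Symmetric and antisymmetric parts -/

namespace PseudoHermitian

theorem ext_metric {L : Type*} [LieRing L] [LieAlgebra ℝ L] (P : PseudoHermitian L) {x x' : L}
    (h : ∀ y, P.metric x y = P.metric x' y) : x = x' := by
  rw [← sub_eq_zero]
  exact P.nondeg.1 _ fun y => by rw [map_sub, LinearMap.sub_apply, h y, sub_self]

theorem metric_J_left {L : Type*} [LieRing L] [LieAlgebra ℝ L] (P : PseudoHermitian L) (x y : L) :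
    P.metric (P.J x) y = -P.metric x (P.J y) := by
  have h := P.compat x (P.J y)
  rw [P.J_sq, map_neg] at h
  linarith

section

variable {L : Type*} [LieRing L] [LieAlgebra ℝ L] [FiniteDimensional ℝ L] (P : PseudoHermitian L)

/-- The metric adjoint `f^*` of an endomorphism. -/
def adjoint (f : L →ₗ[ℝ] L) : L →ₗ[ℝ] L := P.metric.leftAdjointOfNondegenerate P.nondeg f

/-- The `g`-symmetric part `f^s = (f + f^*) / 2`. -/
def symPart (f : L →ₗ[ℝ] L) : L →ₗ[ℝ] L := (1 / 2 : ℝ) • (f + P.adjoint f)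

/-- The `g`-antisymmetric part `f^a = (f - f^*) / 2`. -/
def antiPart (f : L →ₗ[ℝ] L) : L →ₗ[ℝ] L := (1 / 2 : ℝ) • (f - P.adjoint f)

theorem metric_adjoint (f : L →ₗ[ℝ] L) (x y : L) :
    P.metric (P.adjoint f x) y = P.metric x (f y) :=
  LinearMap.BilinForm.isAdjointPairLeftAdjointOfNondegenerate P.metric P.nondeg f x y

theorem metric_symPart (f : L →ₗ[ℝ] L) (x y : L) :
    P.metric (P.symPart f x) y = (1 / 2) * (P.metric (f x) y + P.metric x (f y)) := by
  simp only [symPart, LinearMap.smul_apply, LinearMap.add_apply, map_smul, map_add,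
    metric_adjoint, smul_eq_mul]

theorem metric_antiPart (f : L →ₗ[ℝ] L) (x y : L) :
    P.metric (P.antiPart f x) y = (1 / 2) * (P.metric (f x) y - P.metric x (f y)) := by
  simp only [antiPart, LinearMap.smul_apply, LinearMap.sub_apply, map_smul, map_sub,
    metric_adjoint, smul_eq_mul]

theorem J_symPart_iff (f f' : L →ₗ[ℝ] L) : P.J ∘ₗ P.symPart f = P.symPart f' ↔
    ∀ x y, P.metric (f x) (P.J y) + P.metric x (f (P.J y)) +
      P.metric (f' x) y + P.metric x (f' y) = 0 := by
  constructor
  · intro h x y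
    have h1 := congrArg (fun z => P.metric z y) (LinearMap.congr_fun h x)
    simp only [LinearMap.comp_apply, metric_J_left, metric_symPart] at h1
    linarith
  · intro h
    refine LinearMap.ext fun x => P.ext_metric fun y => ?_
    simp only [LinearMap.comp_apply, metric_J_left, metric_symPart]
    linarith [h x y]

theorem J_antiPart_iff (f : L →ₗ[ℝ] L) : P.J ∘ₗ P.antiPart f = P.antiPart f ∘ₗ P.J ↔
    ∀ x y, P.metric (f (P.J x)) y - P.metric (P.J x) (f y) +
      P.metric (f x) (P.J y) - P.metric x (f (P.J y)) = 0 := by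
  constructor
  · intro h x y
    have h1 := congrArg (fun z => P.metric z y) (LinearMap.congr_fun h x)
    simp only [LinearMap.comp_apply, metric_J_left, metric_antiPart] at h1 ⊢
    linarith
  · intro h
    refine LinearMap.ext fun x => P.ext_metric fun y => ?_
    have h1 := h x y
    simp only [LinearMap.comp_apply, metric_J_left, metric_antiPart] at h1 ⊢
    linarith

end

/-! ## The semidirect product -/

section

variable {G H : Type*} [LieRing G] [LieAlgebra ℝ G] [LieRing H] [LieAlgebra ℝ H]

open LieAlgebra

/-- The metric `g + h` on the semidirect product of `G` and `H`. -/
def sdMetric (P : PseudoHermitian G) (Q : PseudoHermitian H)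
    (φ : H →ₗ⁅ℝ⁆ LieDerivation ℝ G G) : LinearMap.BilinForm ℝ (G ⋊⁅φ⁆ H) :=
  LinearMap.mk₂ ℝ (fun x y => P.metric x.left y.left + Q.metric x.right y.right)
    (by intros; simp; ring) (by intros; simp; ring) (by intros; simp; ring)
    (by intros; simp; ring)

/-- The almost complex structure `J_g + J_h` on the semidirect product of `G` and `H`. -/
def sdJ (P : PseudoHermitian G) (Q : PseudoHermitian H)
    (φ : H →ₗ⁅ℝ⁆ LieDerivation ℝ G G) : (G ⋊⁅φ⁆ H) →ₗ[ℝ] (G ⋊⁅φ⁆ H) where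
  toFun x := ⟨P.J x.left, Q.J x.right⟩
  map_add' := by intros; simp
  map_smul' := by intros; simp

theorem sdMetric_apply (P : PseudoHermitian G) (Q : PseudoHermitian H)
    (φ : H →ₗ⁅ℝ⁆ LieDerivation ℝ G G) (x y : G ⋊⁅φ⁆ H) :
    sdMetric P Q φ x y = P.metric x.left y.left + Q.metric x.right y.right := rfl

theorem sdJ_apply (P : PseudoHermitian G) (Q : PseudoHermitian H)
    (φ : H →ₗ⁅ℝ⁆ LieDerivation ℝ G G) (x : G ⋊⁅φ⁆ H) :
    sdJ P Q φ x = ⟨P.J x.left, Q.J x.right⟩ := rfl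

/-- The `U(p,q)`-structure on the semidirect product of `G` and `H`. -/
def semidirect (P : PseudoHermitian G) (Q : PseudoHermitian H)
    (φ : H →ₗ⁅ℝ⁆ LieDerivation ℝ G G) : PseudoHermitian (G ⋊⁅φ⁆ H) where
  metric := sdMetric P Q φ
  symm := ⟨fun x y => by
    simp [sdMetric_apply, P.symm.eq x.left y.left, Q.symm.eq x.right y.right]⟩
  nondeg := by
    refine ⟨fun x hx => ?_, fun x hx => ?_⟩
    · ext
      · exact P.nondeg.1 _ fun y => by simpa [sdMetric_apply] using hx ⟨y, 0⟩
      · exact Q.nondeg.1 _ fun y => by simpa [sdMetric_apply] using hx ⟨0, y⟩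
    · ext
      · exact P.nondeg.2 _ fun y => by simpa [sdMetric_apply] using hx ⟨y, 0⟩
      · exact Q.nondeg.2 _ fun y => by simpa [sdMetric_apply] using hx ⟨0, y⟩
  J := sdJ P Q φ
  J_sq := fun x => by simp [sdJ_apply, P.J_sq, Q.J_sq]
  compat := fun x y => by simp [sdJ_apply, sdMetric_apply, P.compat, Q.compat]

end

end PseudoHermitian

/-! ## Pseudo-Kähler extensions -/

section

variable {G H : Type*} [LieRing G] [LieAlgebra ℝ G] [LieRing H] [LieAlgebra ℝ H]

/-- The conditions on a representation `φ` of `H` on `G` by derivations that define pseudo-Kähler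
extensions. -/
def IsExtension [FiniteDimensional ℝ G] (P : PseudoKahler G) (Q : PseudoKahler H)
    (φ : H →ₗ⁅ℝ⁆ LieDerivation ℝ G G) : Prop :=
  (∀ A, P.J ∘ₗ P.symPart (φ A).toLinearMap = P.symPart (φ (Q.J A)).toLinearMap) ∧
  (∀ A, P.J ∘ₗ P.antiPart (φ A).toLinearMap = P.antiPart (φ A).toLinearMap ∘ₗ P.J)

theorem semidirect_integrable_iff (P : PseudoKahler G) (Q : PseudoKahler H)
    (φ : H →ₗ⁅ℝ⁆ LieDerivation ℝ G G) :
    (P.semidirect Q.toPseudoHermitian φ).Integrable ↔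
    ∀ A x, -φ (Q.J A) (P.J x) + φ A x + P.J (φ A (P.J x)) + P.J (φ (Q.J A) x) = 0 := by
  constructor
  · intro h A x
    have h1 := congrArg LieAlgebra.SemiDirectSum.left (h ⟨x, 0⟩ ⟨0, A⟩)
    simp [PseudoHermitian.semidirect, PseudoHermitian.sdJ_apply] at h1
    linear_combination (norm := module) h1
  · intro h x y
    have h1 := P.integrable x.left y.left
    have h2 := Q.integrable x.right y.right
    have h3 := h x.right y.left
    have h4 := h y.right x.left
    ext
    · simp [PseudoHermitian.semidirect, PseudoHermitian.sdJ_apply] at h1 ⊢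
      linear_combination (norm := module) h1 - h3 + h4
    · simpa [PseudoHermitian.semidirect, PseudoHermitian.sdJ_apply] using h2

theorem semidirect_omegaClosed_iff (P : PseudoKahler G) (Q : PseudoKahler H)
    (φ : H →ₗ⁅ℝ⁆ LieDerivation ℝ G G) :
    (P.semidirect Q.toPseudoHermitian φ).OmegaClosed ↔
    ∀ A x y, P.metric (P.J (φ A x)) y + P.metric (P.J x) (φ A y) = 0 := by
  constructor
  · intro h A x y
    have h1 := h ⟨x, 0⟩ ⟨y, 0⟩ ⟨0, A⟩
    simp [PseudoHermitian.semidirect, PseudoHermitian.sdJ_apply,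
      PseudoHermitian.sdMetric_apply, PseudoHermitian.omega] at h1
    have h2 := P.metric_J_left (φ A y) x
    rw [P.symm.eq (φ A y) (P.J x)] at h2
    linarith
  · intro h x y z
    have h1 := P.closed x.left y.left z.left
    have h2 := Q.closed x.right y.right z.right
    have e1 := h x.right y.left z.left
    have e2 := h y.right z.left x.left
    have e3 := h z.right x.left y.left
    have s1 := P.metric_J_left (φ x.right z.left) y.left
    have s2 := P.metric_J_left (φ y.right x.left) z.left
    have s3 := P.metric_J_left (φ z.right y.left) x.left
    rw [P.symm.eq _ (P.J _)] at s1 s2 s3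
    simp [PseudoHermitian.semidirect, PseudoHermitian.sdJ_apply,
      PseudoHermitian.sdMetric_apply, PseudoHermitian.omega] at h1 h2 ⊢
    linarith

theorem nijenhuis_of_parts (P : PseudoHermitian G) (f f' : G →ₗ[ℝ] G)
    (hs : ∀ x y, P.metric (f x) (P.J y) + P.metric x (f (P.J y)) +
      P.metric (f' x) y + P.metric x (f' y) = 0)
    (ha : ∀ x y, P.metric (f (P.J x)) y - P.metric (P.J x) (f y) +
      P.metric (f x) (P.J y) - P.metric x (f (P.J y)) = 0)
    (ha' : ∀ x y, P.metric (f' (P.J x)) y - P.metric (P.J x) (f' y) +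
      P.metric (f' x) (P.J y) - P.metric x (f' (P.J y)) = 0) (x : G) :
    -f' (P.J x) + f x + P.J (f (P.J x)) + P.J (f' x) = 0 := by
  refine P.ext_metric fun y => ?_
  have e1 := hs (P.J x) y
  have e2 := hs x (P.J y)
  have e3 := ha x (P.J y)
  have e4 := ha' x y
  simp only [P.J_sq, map_neg, LinearMap.neg_apply, map_add, LinearMap.add_apply, map_zero,
    LinearMap.zero_apply] at e1 e2 e3 e4 ⊢
  rw [P.metric_J_left (f (P.J x)) y, P.metric_J_left (f' x) y]
  linarith

theorem closed_of_parts (P : PseudoHermitian G) (f f' : G →ₗ[ℝ] G)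
    (hs : ∀ x y, P.metric (f x) (P.J y) + P.metric x (f (P.J y)) +
      P.metric (f' x) y + P.metric x (f' y) = 0)
    (ha : ∀ x y, P.metric (f (P.J x)) y - P.metric (P.J x) (f y) +
      P.metric (f x) (P.J y) - P.metric x (f (P.J y)) = 0) (x y : G) :
    P.metric (P.J (f x)) y + P.metric (P.J x) (f y) = 0 := by
  have e1 := hs x y
  have e2 := hs y x
  have e3 := ha x y
  rw [P.symm.eq _ (P.J x), P.symm.eq y, P.symm.eq _ x, P.symm.eq y] at e2
  rw [P.metric_J_left (f x) y]
  linarith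

theorem anti_of_closed (P : PseudoHermitian G) (f : G →ₗ[ℝ] G)
    (hc : ∀ x y, P.metric (P.J (f x)) y + P.metric (P.J x) (f y) = 0) (x y : G) :
    P.metric (f (P.J x)) y - P.metric (P.J x) (f y) +
      P.metric (f x) (P.J y) - P.metric x (f (P.J y)) = 0 := by
  have e1 := hc x y
  have e2 := hc (P.J x) (P.J y)
  rw [P.metric_J_left (f _)] at e1 e2
  simp only [P.J_sq, map_neg, LinearMap.neg_apply] at e1 e2 ⊢
  linarith

theorem sym_of_closed (P : PseudoHermitian G) (f f' : G →ₗ[ℝ] G)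
    (hn : ∀ x, -f' (P.J x) + f x + P.J (f (P.J x)) + P.J (f' x) = 0)
    (hc : ∀ x y, P.metric (P.J (f x)) y + P.metric (P.J x) (f y) = 0)
    (hc' : ∀ x y, P.metric (P.J (f' x)) y + P.metric (P.J x) (f' y) = 0) (x y : G) :
    P.metric (f x) (P.J y) + P.metric x (f (P.J y)) +
      P.metric (f' x) y + P.metric x (f' y) = 0 := by
  have e1 := congrArg (fun z => P.metric z (P.J y)) (hn x)
  have e2 := hc (P.J x) (P.J y)
  have e3 := hc' (P.J x) y
  rw [P.metric_J_left (f _)] at e2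
  rw [P.metric_J_left (f' _)] at e3
  simp only [map_add, LinearMap.add_apply, P.metric_J_left (f _), P.metric_J_left (f' _)] at e1
  simp only [P.J_sq, map_neg, LinearMap.neg_apply, map_zero, LinearMap.zero_apply] at e1 e2 e3 ⊢
  linarith

/-- The conditions `IsExtension` say precisely that the semidirect product, with the induced metric
and almost complex structure, is pseudo-Kähler. -/
theorem isExtension_iff [FiniteDimensional ℝ G] (P : PseudoKahler G) (Q : PseudoKahler H)
    (φ : H →ₗ⁅ℝ⁆ LieDerivation ℝ G G) :
    IsExtension P Q φ ↔
      (P.semidirect Q.toPseudoHermitian φ).Integrable ∧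
      (P.semidirect Q.toPseudoHermitian φ).OmegaClosed := by
  rw [semidirect_integrable_iff, semidirect_omegaClosed_iff]
  constructor
  · rintro ⟨hs, ha⟩
    have hs' := fun A => (P.J_symPart_iff _ _).1 (hs A)
    have ha' := fun A => (P.J_antiPart_iff _).1 (ha A)
    exact ⟨fun A x => nijenhuis_of_parts P.toPseudoHermitian (φ A).toLinearMap
        (φ (Q.J A)).toLinearMap (hs' A) (ha' A) (ha' (Q.J A)) x,
      fun A x y => closed_of_parts P.toPseudoHermitian (φ A).toLinearMap
        (φ (Q.J A)).toLinearMap (hs' A) (ha' A) x y⟩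
  · rintro ⟨hn, hc⟩
    exact ⟨fun A => (P.J_symPart_iff _ _).2 (sym_of_closed P.toPseudoHermitian
        (φ A).toLinearMap (φ (Q.J A)).toLinearMap (hn A) (hc A) (hc (Q.J A))),
      fun A => (P.J_antiPart_iff _).2
        (anti_of_closed P.toPseudoHermitian (φ A).toLinearMap (hc A))⟩

end

/-- A pseudo-Kähler extension of `(G, P)` by `(H, Q)`. -/
structure PKExtension {G H : Type*} [LieRing G] [LieAlgebra ℝ G] [FiniteDimensional ℝ G]
    [LieRing H] [LieAlgebra ℝ H] (P : PseudoKahler G) (Q : PseudoKahler H) where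
  φ : H →ₗ⁅ℝ⁆ LieDerivation ℝ G G
  isExtension : IsExtension P Q φ

/-- AW-relatedness of two pseudo-Kähler extensions. -/
def AWRelated {G H G' H' : Type*}
    [LieRing G] [LieAlgebra ℝ G] [FiniteDimensional ℝ G] [LieRing H] [LieAlgebra ℝ H]
    [LieRing G'] [LieAlgebra ℝ G'] [FiniteDimensional ℝ G'] [LieRing H'] [LieAlgebra ℝ H']
    {P : PseudoKahler G} {Q : PseudoKahler H} {P' : PseudoKahler G'} {Q' : PseudoKahler H'}
    (E : PKExtension P Q) (E' : PKExtension P' Q') : Prop :=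
  ∃ (f : PseudoKahlerEquiv P P') (k : PseudoKahlerEquiv Q Q'),
    (∀ A : H, P'.symPart (f.toLinearEquiv.conj (E.φ A).toLinearMap
      - (E'.φ (k.toLieEquiv A)).toLinearMap) = 0) ∧
    (∀ (A : H) (A' : H'), Commute (f.toLinearEquiv.conj (E.φ A).toLinearMap)
      ((E'.φ A').toLinearMap : Module.End ℝ G'))

/-- An extension is trivial if it is AW-related to one with `φ = 0`. -/
def PKExtension.IsTrivial.{u, v} {G : Type u} {H : Type v}
    [LieRing G] [LieAlgebra ℝ G] [FiniteDimensional ℝ G] [LieRing H] [LieAlgebra ℝ H]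
    {P : PseudoKahler G} {Q : PseudoKahler H} (E : PKExtension P Q) : Prop :=
  ∃ (G' : Type u) (_ : LieRing G') (_ : LieAlgebra ℝ G') (_ : FiniteDimensional ℝ G')
    (H' : Type v) (_ : LieRing H') (_ : LieAlgebra ℝ H')
    (P' : PseudoKahler G') (Q' : PseudoKahler H') (E' : PKExtension P' Q'),
    E'.φ = 0 ∧ AWRelated E E'

/-! ## Lie algebras and pseudo-Kähler structures in coordinates -/

/-- A Lie bracket on `ℝⁿ`. -/
structure LieModel (n : ℕ) where
  br : (Fin n → ℝ) → (Fin n → ℝ) → (Fin n → ℝ)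
  add_br : ∀ x y z, br (x + y) z = br x z + br y z
  br_add : ∀ x y z, br x (y + z) = br x y + br x z
  br_smul : ∀ (t : ℝ) x y, br x (t • y) = t • br x y
  br_self : ∀ x, br x x = 0
  jacobi : ∀ x y z, br x (br y z) = br (br x y) z + br y (br x z)

namespace LieModel

/-- The vector space `ℝⁿ` regarded as a Lie algebra with the given bracket. -/
def Alg {n : ℕ} (_ : LieModel n) : Type := Fin n → ℝ

section

variable {n : ℕ} (m : LieModel n)

instance : AddCommGroup m.Alg := inferInstanceAs (AddCommGroup (Fin n → ℝ))

instance : Module ℝ m.Alg := inferInstanceAs (Module ℝ (Fin n → ℝ))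

instance : FiniteDimensional ℝ m.Alg := inferInstanceAs (FiniteDimensional ℝ (Fin n → ℝ))

instance : LieRing m.Alg where
  bracket := m.br
  add_lie := m.add_br
  lie_add := m.br_add
  lie_self := m.br_self
  leibniz_lie := m.jacobi

instance : LieAlgebra ℝ m.Alg where
  lie_smul := m.br_smul

/-- The vector with the given coordinates. -/
def vec : (Fin n → ℝ) ≃ₗ[ℝ] m.Alg := LinearEquiv.refl ℝ (Fin n → ℝ)

/-- The endomorphism with the given matrix (acting on columns) in the standard basis. -/
def lin (M : Matrix (Fin n) (Fin n) ℝ) : m.Alg →ₗ[ℝ] m.Alg := m.vec.conj (Matrix.toLin' M)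

/-- The bilinear form with the given matrix in the standard basis. -/
def form (M : Matrix (Fin n) (Fin n) ℝ) : LinearMap.BilinForm ℝ m.Alg :=
  LinearMap.BilinForm.congr m.vec (Matrix.toBilin' M)

theorem lin_vec (M : Matrix (Fin n) (Fin n) ℝ) (x : Fin n → ℝ) :
    m.lin M (m.vec x) = m.vec (M.mulVec x) := rfl

theorem form_vec (M : Matrix (Fin n) (Fin n) ℝ) (x y : Fin n → ℝ) :
    m.form M (m.vec x) (m.vec y) = x ⬝ᵥ M.mulVec y :=
  Matrix.toBilin'_apply' M x y

theorem lie_vec (x y : Fin n → ℝ) : ⁅m.vec x, m.vec y⁆ = m.vec (m.br x y) := rfl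

/-- The pseudo-Kähler structure with the given matrices `g` and `J` in the standard basis; `g'` is
the inverse of `g`. -/
def pseudoKahler (g g' J : Matrix (Fin n) (Fin n) ℝ)
    (hsymm : ∀ x y, x ⬝ᵥ g.mulVec y = y ⬝ᵥ g.mulVec x)
    (hinv : ∀ x, g'.mulVec (g.mulVec x) = x)
    (hJ : ∀ x, J.mulVec (J.mulVec x) = -x)
    (hgJ : ∀ x y, J.mulVec x ⬝ᵥ g.mulVec (J.mulVec y) = x ⬝ᵥ g.mulVec y)
    (hN : ∀ x y, m.br (J.mulVec x) (J.mulVec y) - m.br x y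
      - J.mulVec (m.br (J.mulVec x) y + m.br x (J.mulVec y)) = 0)
    (hω : ∀ x y z, J.mulVec (m.br x y) ⬝ᵥ g.mulVec z + J.mulVec (m.br y z) ⬝ᵥ g.mulVec x
      + J.mulVec (m.br z x) ⬝ᵥ g.mulVec y = 0) : PseudoKahler m.Alg where
  metric := m.form g
  symm := ⟨fun x y => by
    obtain ⟨x, rfl⟩ := m.vec.surjective x
    obtain ⟨y, rfl⟩ := m.vec.surjective y
    rw [form_vec, form_vec, hsymm]⟩
  nondeg := by
    have key : ∀ y : m.Alg, (∀ x, m.form g x y = 0) → y = 0 := by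
      intro y hy
      obtain ⟨y, rfl⟩ := m.vec.surjective y
      have h0 : g.mulVec y = 0 := dotProduct_eq_zero _ fun x => by
        rw [dotProduct_comm, ← form_vec, hy]
      rw [← hinv y, h0, Matrix.mulVec_zero, map_zero]
    refine ⟨fun y hy => key y fun x => ?_, key⟩
    rw [← hy x]
    obtain ⟨x, rfl⟩ := m.vec.surjective x
    obtain ⟨y, rfl⟩ := m.vec.surjective y
    rw [form_vec, form_vec, hsymm]
  J := m.lin J
  J_sq x := by
    obtain ⟨x, rfl⟩ := m.vec.surjective x
    rw [lin_vec, lin_vec, hJ, map_neg]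
  compat x y := by
    obtain ⟨x, rfl⟩ := m.vec.surjective x
    obtain ⟨y, rfl⟩ := m.vec.surjective y
    rw [lin_vec, lin_vec, form_vec, form_vec, hgJ]
  integrable x y := by
    obtain ⟨x, rfl⟩ := m.vec.surjective x
    obtain ⟨y, rfl⟩ := m.vec.surjective y
    simp only [lin_vec, lie_vec, ← map_add, ← map_sub, hN, map_zero]
  closed x y z := by
    obtain ⟨x, rfl⟩ := m.vec.surjective x
    obtain ⟨y, rfl⟩ := m.vec.surjective y
    obtain ⟨z, rfl⟩ := m.vec.surjective z
    simpa only [PseudoHermitian.omega, lie_vec, lin_vec, form_vec] using hω x y z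

/-- The derivation with the given matrix in the standard basis. -/
def der (M : Matrix (Fin n) (Fin n) ℝ)
    (h : ∀ x y, M.mulVec (m.br x y) = m.br x (M.mulVec y) - m.br y (M.mulVec x)) :
    LieDerivation ℝ m.Alg m.Alg where
  toLinearMap := m.lin M
  leibniz' x y := by
    obtain ⟨x, rfl⟩ := m.vec.surjective x
    obtain ⟨y, rfl⟩ := m.vec.surjective y
    simp only [lin_vec, lie_vec, ← map_sub, h]

end

end LieModel

theorem mulVec_four (a₀ a₁ a₂ a₃ b₀ b₁ b₂ b₃ c₀ c₁ c₂ c₃ d₀ d₁ d₂ d₃ x₀ x₁ x₂ x₃ : ℝ) :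
    Matrix.mulVec !![a₀, a₁, a₂, a₃; b₀, b₁, b₂, b₃; c₀, c₁, c₂, c₃; d₀, d₁, d₂, d₃]
      ![x₀, x₁, x₂, x₃] =
    ![a₀ * x₀ + a₁ * x₁ + a₂ * x₂ + a₃ * x₃, b₀ * x₀ + b₁ * x₁ + b₂ * x₂ + b₃ * x₃,
      c₀ * x₀ + c₁ * x₁ + c₂ * x₂ + c₃ * x₃, d₀ * x₀ + d₁ * x₁ + d₂ * x₂ + d₃ * x₃] := by
  ext i; fin_cases i <;> simp [Matrix.mulVec, add_assoc]

theorem dotProduct_four (x₀ x₁ x₂ x₃ y₀ y₁ y₂ y₃ : ℝ) :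
    ![x₀, x₁, x₂, x₃] ⬝ᵥ ![y₀, y₁, y₂, y₃] = x₀ * y₀ + x₁ * y₁ + x₂ * y₂ + x₃ * y₃ := by
  simp [add_assoc]

theorem add_four (x₀ x₁ x₂ x₃ y₀ y₁ y₂ y₃ : ℝ) :
    ![x₀, x₁, x₂, x₃] + ![y₀, y₁, y₂, y₃] = ![x₀ + y₀, x₁ + y₁, x₂ + y₂, x₃ + y₃] := by
  simp

theorem sub_four (x₀ x₁ x₂ x₃ y₀ y₁ y₂ y₃ : ℝ) :
    ![x₀, x₁, x₂, x₃] - ![y₀, y₁, y₂, y₃] = ![x₀ - y₀, x₁ - y₁, x₂ - y₂, x₃ - y₃] := by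
  simp

theorem neg_four (x₀ x₁ x₂ x₃ : ℝ) : -![x₀, x₁, x₂, x₃] = ![-x₀, -x₁, -x₂, -x₃] := by
  simp

theorem smul_four (t x₀ x₁ x₂ x₃ : ℝ) :
    t • ![x₀, x₁, x₂, x₃] = ![t * x₀, t * x₁, t * x₂, t * x₃] := by
  simp

theorem ext_four {x₀ x₁ x₂ x₃ y₀ y₁ y₂ y₃ : ℝ} (h₀ : x₀ = y₀) (h₁ : x₁ = y₁) (h₂ : x₂ = y₂)
    (h₃ : x₃ = y₃) : ![x₀, x₁, x₂, x₃] = ![y₀, y₁, y₂, y₃] := by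
  rw [h₀, h₁, h₂, h₃]

theorem zero_four : (0 : Fin 4 → ℝ) = ![0, 0, 0, 0] := by
  ext i; fin_cases i <;> simp

theorem forall_four {p : (Fin 4 → ℝ) → Prop} (h : ∀ a b c d, p ![a, b, c, d]) (x : Fin 4 → ℝ) :
    p x := by
  have e : x = ![x 0, x 1, x 2, x 3] := by ext i; fin_cases i <;> simp
  rw [e]
  exact h _ _ _ _

/-! ## The Lie algebras in the classification -/

/-- The abelian Lie algebra `ℝⁿ`. -/
def abelian (n : ℕ) : LieModel n where
  br _ _ := 0
  add_br _ _ _ := (add_zero 0).symm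
  br_add _ _ _ := (add_zero 0).symm
  br_smul _ _ _ := (smul_zero _).symm
  br_self _ := rfl
  jacobi _ _ _ := (add_zero 0).symm

/-- The Lie algebra `rh₃`, with non-zero bracket `[e₁, e₂] = e₃`. -/
def rh3 : LieModel 4 where
  br x y := ![0, 0, x 0 * y 1 - x 1 * y 0, 0]
  add_br x y z := by ext i; fin_cases i <;> simp <;> ring
  br_add x y z := by ext i; fin_cases i <;> simp <;> ring
  br_smul t x y := by ext i; fin_cases i <;> simp <;> ring
  br_self x := by ext i; fin_cases i <;> simp <;> ring
  jacobi x y z := by ext i; fin_cases i <;> simp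

/-- The Lie algebra `r'₂`, with non-zero brackets
`[e₁, e₃] = e₃`, `[e₁, e₄] = e₄`, `[e₂, e₃] = e₄`, `[e₂, e₄] = -e₃`. -/
def rp2 : LieModel 4 where
  br x y := ![0, 0, (x 0 * y 2 - x 2 * y 0) - (x 1 * y 3 - x 3 * y 1),
    (x 0 * y 3 - x 3 * y 0) + (x 1 * y 2 - x 2 * y 1)]
  add_br x y z := by ext i; fin_cases i <;> simp <;> ring
  br_add x y z := by ext i; fin_cases i <;> simp <;> ring
  br_smul t x y := by ext i; fin_cases i <;> simp <;> ring
  br_self x := by ext i; fin_cases i <;> simp <;> ring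
  jacobi x y z := by ext i; fin_cases i <;> simp <;> ring

theorem rh3_br (x₀ x₁ x₂ x₃ y₀ y₁ y₂ y₃ : ℝ) : rh3.br ![x₀, x₁, x₂, x₃] ![y₀, y₁, y₂, y₃] =
    ![0, 0, x₀ * y₁ - x₁ * y₀, 0] := rfl

theorem rp2_br (x₀ x₁ x₂ x₃ y₀ y₁ y₂ y₃ : ℝ) : rp2.br ![x₀, x₁, x₂, x₃] ![y₀, y₁, y₂, y₃] =
    ![0, 0, (x₀ * y₂ - x₂ * y₀) - (x₁ * y₃ - x₃ * y₁),
      (x₀ * y₃ - x₃ * y₀) + (x₁ * y₂ - x₂ * y₁)] := rfl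

/-- The Kähler structure `J a₁ = a₂`, `h = a¹ ⊗ a¹ + a² ⊗ a²` on `ℝ²`. -/
def planeKahler : PseudoKahler (abelian 2).Alg :=
  (abelian 2).pseudoKahler 1 1 !![0, -1; 1, 0]
    (fun x y => by simp [dotProduct_comm x y]) (fun x => by simp)
    (fun x => by ext i; fin_cases i <;> simp [dotProduct])
    (fun x y => by simp [dotProduct]; ring)
    (fun _ _ => by simp [abelian]) (fun _ _ _ => by simp [abelian])

/-- The neutral structure `g = e¹ ⊗ e¹ - e² ⊗ e² + e³ ⊗ e³ - e⁴ ⊗ e⁴`, `J e₁ = e₃`, `J e₂ = e₄`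
on `ℝ⁴`. -/
def r4Kahler : PseudoKahler (abelian 4).Alg :=
  (abelian 4).pseudoKahler
    !![1, 0, 0, 0; 0, -1, 0, 0; 0, 0, 1, 0; 0, 0, 0, -1]
    !![1, 0, 0, 0; 0, -1, 0, 0; 0, 0, 1, 0; 0, 0, 0, -1]
    !![0, 0, -1, 0; 0, 0, 0, -1; 1, 0, 0, 0; 0, 1, 0, 0]
    (forall_four fun _ _ _ _ => forall_four fun _ _ _ _ => by
      simp only [mulVec_four, dotProduct_four]
      ring)
    (forall_four fun _ _ _ _ => by
      simp only [mulVec_four]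
      apply ext_four <;> ring)
    (forall_four fun _ _ _ _ => by
      simp only [mulVec_four, neg_four]
      apply ext_four <;> ring)
    (forall_four fun _ _ _ _ => forall_four fun _ _ _ _ => by
      simp only [mulVec_four, dotProduct_four]
      ring)
    (fun _ _ => by simp [abelian]) (fun _ _ _ => by simp [abelian])

/-- The structure `g = e¹ ⊙ e³ + e² ⊙ e⁴` (with `eⁱ ⊙ eʲ = eⁱ ⊗ eʲ + eʲ ⊗ eⁱ`), `J e₁ = e₂`,
`J e₃ = e₄` on `rh₃`. -/
def rh3Kahler : PseudoKahler rh3.Alg :=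
  rh3.pseudoKahler
    !![0, 0, 1, 0; 0, 0, 0, 1; 1, 0, 0, 0; 0, 1, 0, 0]
    !![0, 0, 1, 0; 0, 0, 0, 1; 1, 0, 0, 0; 0, 1, 0, 0]
    !![0, -1, 0, 0; 1, 0, 0, 0; 0, 0, 0, -1; 0, 0, 1, 0]
    (forall_four fun _ _ _ _ => forall_four fun _ _ _ _ => by
      simp only [mulVec_four, dotProduct_four]
      ring)
    (forall_four fun _ _ _ _ => by
      simp only [mulVec_four]
      apply ext_four <;> ring)
    (forall_four fun _ _ _ _ => by
      simp only [mulVec_four, neg_four]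
      apply ext_four <;> ring)
    (forall_four fun _ _ _ _ => forall_four fun _ _ _ _ => by
      simp only [mulVec_four, dotProduct_four]
      ring)
    (forall_four fun _ _ _ _ => forall_four fun _ _ _ _ => by
      simp only [mulVec_four, rh3_br, add_four, sub_four, zero_four]
      apply ext_four <;> ring)
    (forall_four fun _ _ _ _ => forall_four fun _ _ _ _ => forall_four fun _ _ _ _ => by
      simp only [mulVec_four, rh3_br, dotProduct_four]
      ring)

/-- The structures on `r'₂` depending on parameters `(p, q, r)` with `q² + r² ≠ 0`. -/
def rp2Kahler (p q r : ℝ) (h : q ^ 2 + r ^ 2 ≠ 0) : PseudoKahler rp2.Alg :=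
  rp2.pseudoKahler
    !![p, 0, -r, q; 0, p, q, r; -r, q, 0, 0; q, r, 0, 0]
    ((q ^ 2 + r ^ 2)⁻¹ • !![0, 0, -r, q; 0, 0, q, r; -r, q, -p, 0; q, r, 0, -p])
    !![0, 1, 0, 0; -1, 0, 0, 0; 0, 0, 0, -1; 0, 0, 1, 0]
    (forall_four fun _ _ _ _ => forall_four fun _ _ _ _ => by
      simp only [mulVec_four, dotProduct_four]
      ring)
    (forall_four fun _ _ _ _ => by
      rw [Matrix.smul_mulVec, inv_smul_eq_iff₀ h]
      simp only [mulVec_four, smul_four]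
      apply ext_four <;> ring)
    (forall_four fun _ _ _ _ => by
      simp only [mulVec_four, neg_four]
      apply ext_four <;> ring)
    (forall_four fun _ _ _ _ => forall_four fun _ _ _ _ => by
      simp only [mulVec_four, dotProduct_four]
      ring)
    (forall_four fun _ _ _ _ => forall_four fun _ _ _ _ => by
      simp only [mulVec_four, rp2_br, add_four, sub_four, zero_four]
      apply ext_four <;> ring)
    (forall_four fun _ _ _ _ => forall_four fun _ _ _ _ => forall_four fun _ _ _ _ => by
      simp only [mulVec_four, rp2_br, dotProduct_four]
      ring)

/-! ## The extensions in the classification -/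

section

variable {G : Type*} [LieRing G] [LieAlgebra ℝ G]

/-- The representation of `ℝ²` with `φ(a₁) = D₁`, `φ(a₂) = D₂`, for commuting derivations. -/
def pairHom (D₁ D₂ : LieDerivation ℝ G G) (hc : ⁅D₁, D₂⁆ = 0) :
    (abelian 2).Alg →ₗ⁅ℝ⁆ LieDerivation ℝ G G where
  toFun v := (abelian 2).vec.symm v 0 • D₁ + (abelian 2).vec.symm v 1 • D₂
  map_add' v w := by simp only [map_add, Pi.add_apply]; module
  map_smul' t v := by simp only [map_smul, Pi.smul_apply, smul_eq_mul, RingHom.id_apply]; module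
  map_lie' {v w} := by
    have h0 : ⁅v, w⁆ = 0 := rfl
    have hc' : ⁅D₂, D₁⁆ = 0 := by rw [← lie_skew, hc, neg_zero]
    simp [h0, hc, hc']

theorem pairHom_vec (D₁ D₂ : LieDerivation ℝ G G) (hc : ⁅D₁, D₂⁆ = 0) (v : Fin 2 → ℝ) :
    pairHom D₁ D₂ hc ((abelian 2).vec v) = v 0 • D₁ + v 1 • D₂ := rfl

/-- The pseudo-Kähler extension by the Kähler plane with `φ(a₁) = D₁`, `φ(a₂) = D₂`. -/
def pairExtension [FiniteDimensional ℝ G] (P : PseudoKahler G) (D₁ D₂ : LieDerivation ℝ G G)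
    (hc : ⁅D₁, D₂⁆ = 0)
    (hs : P.J ∘ₗ P.symPart D₁.toLinearMap = P.symPart D₂.toLinearMap)
    (h₁ : P.J ∘ₗ P.antiPart D₁.toLinearMap = P.antiPart D₁.toLinearMap ∘ₗ P.J)
    (h₂ : P.J ∘ₗ P.antiPart D₂.toLinearMap = P.antiPart D₂.toLinearMap ∘ₗ P.J) :
    PKExtension P planeKahler where
  φ := pairHom D₁ D₂ hc
  isExtension := by
    rw [PseudoHermitian.J_symPart_iff] at hs
    rw [PseudoHermitian.J_antiPart_iff] at h₁ h₂
    simp only [LieDerivation.coeFn_coe] at hs h₁ h₂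
    constructor
    · intro A
      obtain ⟨v, rfl⟩ := (abelian 2).vec.surjective A
      have hJ : planeKahler.J ((abelian 2).vec v) = (abelian 2).vec ![-v 1, v 0] := by
        change (abelian 2).lin !![0, -1; 1, 0] ((abelian 2).vec v) = _
        rw [LieModel.lin_vec]
        congr 1
        ext i
        fin_cases i <;> simp [Matrix.mulVec, dotProduct]
      rw [hJ, pairHom_vec, pairHom_vec, PseudoHermitian.J_symPart_iff]
      intro x y
      have e1 := hs x y
      have e2 := hs x (P.J y)
      simp only [P.J_sq, map_neg] at e2
      simp only [LieDerivation.coeFn_coe, LieDerivation.add_apply, LieDerivation.smul_apply,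
        map_add, map_smul, LinearMap.add_apply, LinearMap.smul_apply, smul_eq_mul,
        Matrix.cons_val_zero, Matrix.cons_val_one]
      linear_combination v 0 * e1 + v 1 * e2
    · intro A
      obtain ⟨v, rfl⟩ := (abelian 2).vec.surjective A
      rw [pairHom_vec, PseudoHermitian.J_antiPart_iff]
      intro x y
      simp only [LieDerivation.coeFn_coe, LieDerivation.add_apply, LieDerivation.smul_apply,
        map_add, map_smul, LinearMap.add_apply, LinearMap.smul_apply, smul_eq_mul]
      linear_combination v 0 * h₁ x y + v 1 * h₂ x y

end

/-- The pseudo-Kähler extension by the Kähler plane where `φ(a₁)`, `φ(a₂)` have matrices `M₁`,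
`M₂` in the standard basis; `g` and `J` are the matrices of the pseudo-Kähler structure. -/
def LieModel.extension {n : ℕ} (m : LieModel n) (P : PseudoKahler m.Alg)
    (g J M₁ M₂ : Matrix (Fin n) (Fin n) ℝ) (hg : P.metric = m.form g) (hJ : P.J = m.lin J)
    (hd₁ : ∀ x y, M₁.mulVec (m.br x y) = m.br x (M₁.mulVec y) - m.br y (M₁.mulVec x))
    (hd₂ : ∀ x y, M₂.mulVec (m.br x y) = m.br x (M₂.mulVec y) - m.br y (M₂.mulVec x))
    (hc : ∀ x, M₁.mulVec (M₂.mulVec x) = M₂.mulVec (M₁.mulVec x))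
    (hs : ∀ x y, M₁.mulVec x ⬝ᵥ g.mulVec (J.mulVec y) + x ⬝ᵥ g.mulVec (M₁.mulVec (J.mulVec y))
      + M₂.mulVec x ⬝ᵥ g.mulVec y + x ⬝ᵥ g.mulVec (M₂.mulVec y) = 0)
    (h₁ : ∀ x y, M₁.mulVec (J.mulVec x) ⬝ᵥ g.mulVec y - J.mulVec x ⬝ᵥ g.mulVec (M₁.mulVec y)
      + M₁.mulVec x ⬝ᵥ g.mulVec (J.mulVec y) - x ⬝ᵥ g.mulVec (M₁.mulVec (J.mulVec y)) = 0)
    (h₂ : ∀ x y, M₂.mulVec (J.mulVec x) ⬝ᵥ g.mulVec y - J.mulVec x ⬝ᵥ g.mulVec (M₂.mulVec y)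
      + M₂.mulVec x ⬝ᵥ g.mulVec (J.mulVec y) - x ⬝ᵥ g.mulVec (M₂.mulVec (J.mulVec y)) = 0) :
    PKExtension P planeKahler :=
  pairExtension P (m.der M₁ hd₁) (m.der M₂ hd₂)
    (by
      ext x
      rw [LieDerivation.lie_apply, LieDerivation.zero_apply]
      obtain ⟨x, rfl⟩ := m.vec.surjective x
      change m.lin M₁ (m.lin M₂ _) - m.lin M₂ (m.lin M₁ _) = 0
      simp only [lin_vec, hc x, sub_self])
    (by
      rw [PseudoHermitian.J_symPart_iff, hg, hJ]
      intro x y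
      obtain ⟨x, rfl⟩ := m.vec.surjective x
      obtain ⟨y, rfl⟩ := m.vec.surjective y
      change m.form g (m.lin M₁ _) _ + m.form g _ (m.lin M₁ _) + m.form g (m.lin M₂ _) _
        + m.form g _ (m.lin M₂ _) = 0
      simpa only [lin_vec, form_vec] using hs x y)
    (by
      rw [PseudoHermitian.J_antiPart_iff, hg, hJ]
      intro x y
      obtain ⟨x, rfl⟩ := m.vec.surjective x
      obtain ⟨y, rfl⟩ := m.vec.surjective y
      change m.form g (m.lin M₁ _) _ - m.form g _ (m.lin M₁ _) + m.form g (m.lin M₁ _) _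
        - m.form g _ (m.lin M₁ _) = 0
      simpa only [lin_vec, form_vec] using h₁ x y)
    (by
      rw [PseudoHermitian.J_antiPart_iff, hg, hJ]
      intro x y
      obtain ⟨x, rfl⟩ := m.vec.surjective x
      obtain ⟨y, rfl⟩ := m.vec.surjective y
      change m.form g (m.lin M₂ _) _ - m.form g _ (m.lin M₂ _) + m.form g (m.lin M₂ _) _
        - m.form g _ (m.lin M₂ _) = 0
      simpa only [lin_vec, form_vec] using h₂ x y)

/-- The first family of extensions of `ℝ⁴`. -/
def r4Semisimple (a : ℝ) : PKExtension r4Kahler planeKahler :=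
  (abelian 4).extension r4Kahler
    !![1, 0, 0, 0; 0, -1, 0, 0; 0, 0, 1, 0; 0, 0, 0, -1]
    !![0, 0, -1, 0; 0, 0, 0, -1; 1, 0, 0, 0; 0, 1, 0, 0]
    !![a, 2 * a, -a, 0; 0, a, 0, a; a, 0, -a, 0; 0, -a, 2 * a, -a]
    !![0, a, 2 * a, a; a, 0, -a, 0; 0, a, 0, a; -a, 2 * a, a, 0]
    rfl rfl (fun _ _ => by simp [abelian]) (fun _ _ => by simp [abelian])
    (forall_four fun _ _ _ _ => by
      simp only [mulVec_four]
      apply ext_four <;> ring)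
    (forall_four fun _ _ _ _ => forall_four fun _ _ _ _ => by
      simp only [mulVec_four, dotProduct_four]
      ring)
    (forall_four fun _ _ _ _ => forall_four fun _ _ _ _ => by
      simp only [mulVec_four, dotProduct_four]
      ring)
    (forall_four fun _ _ _ _ => forall_four fun _ _ _ _ => by
      simp only [mulVec_four, dotProduct_four]
      ring)

/-- The second family of extensions of `ℝ⁴`. -/
def r4NonSemisimple (a b c : ℝ) : PKExtension r4Kahler planeKahler :=
  (abelian 4).extension r4Kahler
    !![1, 0, 0, 0; 0, -1, 0, 0; 0, 0, 1, 0; 0, 0, 0, -1]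
    !![0, 0, -1, 0; 0, 0, 0, -1; 1, 0, 0, 0; 0, 1, 0, 0]
    !![a, -a + c, -b, b; a + c, -a, -b, b; b, -b, -a, a + c; b, -b, -a + c, a]
    !![0, 0, a - c, -a; 0, 0, a, -a - c; a + c, -a, 0, 0; a, -a + c, 0, 0]
    rfl rfl (fun _ _ => by simp [abelian]) (fun _ _ => by simp [abelian])
    (forall_four fun _ _ _ _ => by
      simp only [mulVec_four]
      apply ext_four <;> ring)
    (forall_four fun _ _ _ _ => forall_four fun _ _ _ _ => by
      simp only [mulVec_four, dotProduct_four]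
      ring)
    (forall_four fun _ _ _ _ => forall_four fun _ _ _ _ => by
      simp only [mulVec_four, dotProduct_four]
      ring)
    (forall_four fun _ _ _ _ => forall_four fun _ _ _ _ => by
      simp only [mulVec_four, dotProduct_four]
      ring)

/-- The family of extensions of `rh₃`. -/
def rh3Extension (a : ℝ) : PKExtension rh3Kahler planeKahler :=
  rh3.extension rh3Kahler
    !![0, 0, 1, 0; 0, 0, 0, 1; 1, 0, 0, 0; 0, 1, 0, 0]
    !![0, -1, 0, 0; 1, 0, 0, 0; 0, 0, 0, -1; 0, 0, 1, 0]
    !![0, 0, 0, 0; 0, 0, 0, 0; a, 0, 0, 0; 0, -a, 0, 0]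
    !![0, 0, 0, 0; 0, 0, 0, 0; 0, a, 0, 0; a, 0, 0, 0]
    rfl rfl
    (forall_four fun _ _ _ _ => forall_four fun _ _ _ _ => by
      simp only [mulVec_four, rh3_br, sub_four]
      apply ext_four <;> ring)
    (forall_four fun _ _ _ _ => forall_four fun _ _ _ _ => by
      simp only [mulVec_four, rh3_br, sub_four]
      apply ext_four <;> ring)
    (forall_four fun _ _ _ _ => by
      simp only [mulVec_four]
      apply ext_four <;> ring)
    (forall_four fun _ _ _ _ => forall_four fun _ _ _ _ => by
      simp only [mulVec_four, dotProduct_four]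
      ring)
    (forall_four fun _ _ _ _ => forall_four fun _ _ _ _ => by
      simp only [mulVec_four, dotProduct_four]
      ring)
    (forall_four fun _ _ _ _ => forall_four fun _ _ _ _ => by
      simp only [mulVec_four, dotProduct_four]
      ring)

/-- The family of extensions of `r'₂` with its structure of parameters `(p, q, r)`. -/
def rp2Extension (p q r : ℝ) (h : q ^ 2 + r ^ 2 ≠ 0) (a : ℝ) :
    PKExtension (rp2Kahler p q r h) planeKahler :=
  rp2.extension (rp2Kahler p q r h)
    !![p, 0, -r, q; 0, p, q, r; -r, q, 0, 0; q, r, 0, 0]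
    !![0, 1, 0, 0; -1, 0, 0, 0; 0, 0, 0, -1; 0, 0, 1, 0]
    !![0, 0, 0, 0; 0, 0, 0, 0; a, 0, 0, 0; 0, a, 0, 0]
    !![0, 0, 0, 0; 0, 0, 0, 0; 0, -a, 0, 0; a, 0, 0, 0]
    rfl rfl
    (forall_four fun _ _ _ _ => forall_four fun _ _ _ _ => by
      simp only [mulVec_four, rp2_br, sub_four]
      apply ext_four <;> ring)
    (forall_four fun _ _ _ _ => forall_four fun _ _ _ _ => by
      simp only [mulVec_four, rp2_br, sub_four]
      apply ext_four <;> ring)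
    (forall_four fun _ _ _ _ => by
      simp only [mulVec_four]
      apply ext_four <;> ring)
    (forall_four fun _ _ _ _ => forall_four fun _ _ _ _ => by
      simp only [mulVec_four, dotProduct_four]
      ring)
    (forall_four fun _ _ _ _ => forall_four fun _ _ _ _ => by
      simp only [mulVec_four, dotProduct_four]
      ring)
    (forall_four fun _ _ _ _ => forall_four fun _ _ _ _ => by
      simp only [mulVec_four, dotProduct_four]
      ring)

end PK

end

open PK

noncomputable section

namespace PK

/-! ## Antilinear maps on a complex plane -/

section ComplexPlane

variable {E : Type*} [AddCommGroup E] [Module ℂ E]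

open Complex

/-! For a unit vector a of 𝔥 write φ(a) = S + A and φ(Ja) = JS + B, with S symmetric and A, B skew
for g. The extension conditions make S anticommute with J and A, B commute with J, so the equation
[φ(a), φ(Ja)] = 0 splits into a J-linear and a J-antilinear half: [A, B] = 2JS² and [B, S] = J[A, S]
(`PKExtension.isExtensionTriple`).

Regard 𝔤 as a complex plane through J. Then S is antilinear and iS² = [A, B]/2 is traceless. For S ≠
0 this leaves one possibility: there is u with S²u = iκu, κ ≥ 0, such that u, Su is a complex basis
(`exists_antilinear_cyclic_vector`). Symmetry of S makes Su isotropic and u can be made so; a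
complex rescaling then yields a hyperbolic pair with Sw = v, Sv = κJw
(`IsExtensionTriple.exists_isNormalForm`). In this frame A and B depend only on α = α₁ + iα₂ and b =
β + iβ', where κα = 0, Im(αb) = 0 and κ|b|² = 2κ (`exists_isExtensionNormalForm`). Rotating a in 𝔥
multiplies α and b by opposite phases.

If κ ≠ 0, then α = 0, |b|² = 2, and φ of a suitable orthonormal basis gives derivations X, Y with X²
= Y², XY = YX = κ; this forces 𝔤 to be abelian. If κ = 0 and α ≠ 0, a rotation gives φ(a)² = |α|²,
and 𝔤 is again abelian. If κ = α = 0, all operators kill ⟨v, Jv⟩ and map into it. The derivation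
property, integrability, closedness of ω and the Jacobi identity then make ⟨v, Jv⟩ an abelian ideal
on which w acts as a complex number m, with [w, Jw] = ζv (`exists_lie_eq`). The case m ≠ 0 forces b
= 0 and is 𝔯'₂; m = 0, ζ ≠ 0 is 𝔯𝔥₃; m = ζ = 0 is ℝ⁴. When m = 0 the skew parts may be discarded up
to AW-relation, since their products with the symmetric parts vanish.

Triviality means that every φ(a) is skew (`PKExtension.isTrivial_iff`), so non-triviality is read
off from matrix entries. -/

theorem exists_sq_eq_smul_of_trace_eq_zero (hE : Module.finrank ℂ E = 2) (K : Module.End ℂ E)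
    (hK : LinearMap.trace ℂ E K = 0) : ∃ c : ℂ, ∀ x, K (K x) = c • x := by
  have : FiniteDimensional ℂ E := FiniteDimensional.of_finrank_pos (by omega)
  let b := Module.finBasisOfFinrankEq ℂ E hE
  set M := LinearMap.toMatrix b b K with hM
  have ht : M 0 0 + M 1 1 = 0 := by
    rw [LinearMap.trace_eq_matrix_trace ℂ b, Matrix.trace_fin_two] at hK
    exact hK
  have h2 : M * M = (M 0 0 * M 0 0 + M 0 1 * M 1 0) • (1 : Matrix (Fin 2) (Fin 2) ℂ) := by
    have h1 : M 1 1 = -M 0 0 := by linear_combination ht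
    ext i j
    fin_cases i <;> fin_cases j <;> simp [Matrix.mul_apply, Fin.sum_univ_two, h1] <;> ring
  refine ⟨M 0 0 * M 0 0 + M 0 1 * M 1 0, fun x => ?_⟩
  have h3 : K * K = (M 0 0 * M 0 0 + M 0 1 * M 1 0) • (1 : Module.End ℂ E) := by
    apply (LinearMap.toMatrix b b).injective
    rw [LinearMap.toMatrix_mul, map_smul, LinearMap.toMatrix_one, ← hM, h2]
  exact LinearMap.congr_fun h3 x

theorem trace_ne_zero_of_forall_eq_smul (hE : Module.finrank ℂ E = 2) (K : Module.End ℂ E) {c : ℂ}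
    (hc : c ≠ 0) (h : ∀ x, K x = c • x) : LinearMap.trace ℂ E K ≠ 0 := by
  have : FiniteDimensional ℂ E := FiniteDimensional.of_finrank_pos (by omega)
  have hK : K = c • (1 : Module.End ℂ E) := LinearMap.ext h
  rw [hK, map_smul, LinearMap.trace_one, hE]
  simpa using hc

theorem exists_eq_smul_add_smul (hE : Module.finrank ℂ E = 2) {u u' : E} (hu : u ≠ 0)
    (hu' : ∀ z : ℂ, u' ≠ z • u) (x : E) : ∃ z z' : ℂ, x = z • u + z' • u' := by
  have : FiniteDimensional ℂ E := FiniteDimensional.of_finrank_pos (by omega)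
  have hli : LinearIndependent ℂ ![u, u'] :=
    (LinearIndependent.pair_iff' hu).2 fun z h => hu' z h.symm
  have hs := hli.span_eq_top_of_card_eq_finrank' (by simp [hE])
  have hx : x ∈ Submodule.span ℂ (Set.range ![u, u']) := hs ▸ Submodule.mem_top
  simp only [Matrix.range_cons, Matrix.range_empty, Set.union_empty, Set.singleton_union] at hx
  obtain ⟨z, z', h⟩ := Submodule.mem_span_pair.1 hx
  exact ⟨z, z', h.symm⟩

variable (S : E →ₛₗ[starRingEnd ℂ] E)

/-- Antilinearity turns l·l into l̄·l, so such an eigenvalue of S² is real and non-negative. This is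
what excludes eigenvectors of S below. -/
theorem antilinear_sq_of_eigenvector {u : E} {l : ℂ} (h : S u = l • u) :
    S (S u) = ((normSq l : ℝ) : ℂ) • u := by
  rw [h, map_smulₛₗ, h, smul_smul, mul_comm, mul_conj]

/-- If the square of an antilinear map `S` of a complex plane is, up to the factor `2 i`, a
commutator of linear maps, then `S` is zero or has a cyclic vector `u` with
`S (S u) = i κ u`, `κ ≥ 0`. -/
theorem exists_antilinear_cyclic_vector (hE : Module.finrank ℂ E = 2) (A B : Module.End ℂ E)
    (hAB : ∀ x, A (B x) - B (A x) = (2 * I) • S (S x)) (hS : ∃ x, S x ≠ 0) :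
    ∃ (u : E) (κ : ℝ), 0 ≤ κ ∧ S u ≠ 0 ∧ S (S u) = (κ * I) • u ∧
      ∀ x, ∃ z z' : ℂ, x = z • u + z' • S u := by
  -- Cyclicity is automatic: Su = lu would give |l|² = iκ, hence l = 0 and Su = 0.
  suffices h : ∃ (u : E) (κ : ℝ), 0 ≤ κ ∧ S u ≠ 0 ∧ S (S u) = (κ * I) • u by
    obtain ⟨u, κ, hκ, h0, h1⟩ := h
    have hu : u ≠ 0 := fun h => h0 (by rw [h, map_zero])
    refine ⟨u, κ, hκ, h0, h1, exists_eq_smul_add_smul hE hu fun l hl => h0 ?_⟩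
    have h2 := antilinear_sq_of_eigenvector S hl
    rw [h1] at h2
    have h3 := congrArg re (smul_left_injective ℂ hu h2)
    simp only [mul_re, ofReal_re, I_re, mul_zero, ofReal_im, I_im, mul_one, sub_zero] at h3
    rw [hl, normSq_eq_zero.1 h3.symm, zero_smul]
  -- By hypothesis K = iS². As a commutator it is traceless, so K² is a scalar c by Cayley–Hamilton,
  -- and S⁴ = -c.
  set K : Module.End ℂ E := (1 / 2 : ℂ) • (A * B - B * A) with hK
  have hKx : ∀ x, K x = I • S (S x) := fun x => by
    have : K x = (1 / 2 : ℂ) • (A (B x) - B (A x)) := rfl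
    rw [this, hAB, smul_smul]
    congr 1
    ring
  have htr : LinearMap.trace ℂ E K = 0 := by
    rw [hK, map_smul, map_sub, LinearMap.trace_mul_comm, sub_self, smul_zero]
  have hne : ∀ c : ℂ, c ≠ 0 → ∃ x, K x - c • x ≠ 0 := fun c hc => by
    by_contra! h
    exact trace_ne_zero_of_forall_eq_smul hE K hc (fun x => sub_eq_zero.1 (h x)) htr
  obtain ⟨c, hc⟩ := exists_sq_eq_smul_of_trace_eq_zero hE K htr
  have h4 : ∀ x, S (S (S (S x))) = -(c • x) := fun x => by
    rw [← hc x, hKx, hKx, map_smulₛₗ, map_smulₛₗ, smul_smul]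
    simp
  obtain ⟨x, hx⟩ := hS
  -- S commutes with S⁴ = -c and is antilinear and non-zero, so c is real.
  have hcr : (starRingEnd ℂ) c = c := by
    have h := h4 (S x)
    rw [h4 x, map_neg, map_smulₛₗ, neg_inj] at h
    exact smul_left_injective ℂ hx h
  obtain ⟨c, rfl⟩ := conj_eq_iff_real.1 hcr
  rcases lt_trichotomy c 0 with h | rfl | h
  -- Here S⁴ = r² and y lies in the (-r)-eigenspace of S². If Sy is a multiple of y, then S²y is a
  -- non-negative multiple of y; otherwise y and Sy span E and S² = -r throughout, so K is a
  -- non-zero scalar, which is not traceless.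
  · exfalso
    set r := √(-c) with hr
    have hr0 : 0 < r := Real.sqrt_pos.2 (by linarith)
    have hrr : r * r = -c := Real.mul_self_sqrt (by linarith)
    have hrI : (r : ℂ) * I ≠ 0 := mul_ne_zero (ofReal_ne_zero.2 hr0.ne') I_ne_zero
    obtain ⟨x, hx⟩ := hne (r * I) hrI
    set y := S (S x) - (r : ℂ) • x with hy
    have hy0 : y ≠ 0 := fun h0 => hx <| by
      rw [hKx, sub_eq_zero.1 h0, smul_smul, mul_comm I, sub_self]
    have hSy : S (S y) = (-r : ℂ) • y := by
      rw [hy, map_sub, map_sub, map_smulₛₗ, map_smulₛₗ, h4]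
      have : (c : ℂ) = -(r * r) := by rw [← ofReal_mul, hrr]; simp
      simp only [this, RingHomCompTriple.comp_apply, RingHom.id_apply]
      module
    by_cases hl : ∃ l : ℂ, S y = l • y
    · obtain ⟨l, hl⟩ := hl
      have h2 := antilinear_sq_of_eigenvector S hl
      rw [hSy] at h2
      have h3 := congrArg re (smul_left_injective ℂ hy0 h2)
      simp only [neg_re, ofReal_re] at h3
      linarith [normSq_nonneg l]
    · push Not at hl
      obtain ⟨x, hx⟩ := hne (-(r * I)) (neg_ne_zero.2 hrI)
      obtain ⟨z, z', h⟩ := exists_eq_smul_add_smul hE hy0 hl x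
      apply hx
      rw [hKx, h]
      simp only [map_add, map_smulₛₗ, hSy, RingHomCompTriple.comp_apply, RingHom.id_apply, map_neg,
        conj_ofReal]
      module
  -- Now S⁴ = 0: take the last vector in the orbit of x that S does not kill.
  · simp only [ofReal_zero, zero_smul, neg_zero] at h4
    by_cases h2 : S (S x) = 0
    · exact ⟨x, 0, le_rfl, hx, by simpa using h2⟩
    by_cases h3 : S (S (S x)) = 0
    · exact ⟨S x, 0, le_rfl, h2, by simpa using h3⟩
    · exact ⟨S (S x), 0, le_rfl, h3, by simpa using h4 x⟩
  -- Now K has eigenvalues ±r. The eigenvalue -r is the one for which S² acts as +ir, which gives κ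
  -- = r ≥ 0.
  · set r := √c with hr
    have hr0 : 0 < r := Real.sqrt_pos.2 h
    have hrr : r * r = c := Real.mul_self_sqrt h.le
    obtain ⟨x, hx⟩ := hne r (ofReal_ne_zero.2 hr0.ne')
    set y := K x - (r : ℂ) • x with hy
    have hKy : K y = (-r : ℂ) • y := by
      rw [hy, map_sub, map_smul, hc]
      have : (c : ℂ) = r * r := by rw [← ofReal_mul, hrr]
      rw [this]
      module
    have hSy : S (S y) = (r * I) • y := by
      rw [hKx] at hKy
      have := congrArg (fun z => (-I) • z) hKy
      simp only [smul_smul, neg_mul, I_mul_I, neg_neg, one_smul] at this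
      rw [this]
      congr 1
      ring
    refine ⟨y, r, hr0.le, fun h0 => ?_, hSy⟩
    rw [h0, map_zero] at hSy
    exact smul_ne_zero (mul_ne_zero (ofReal_ne_zero.2 hr0.ne') I_ne_zero) hx hSy.symm

end ComplexPlane

/-! ## The operators attached to an extension -/

section

variable {G : Type*} [LieRing G] [LieAlgebra ℝ G] (P : PseudoHermitian G)

namespace PseudoHermitian

theorem metric_comm (x y : G) : P.metric x y = P.metric y x := P.symm.eq x y

theorem metric_J_self (x : G) : P.metric x (P.J x) = 0 := by
  have h := P.metric_J_left x x
  rw [P.metric_comm] at h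
  linarith

theorem metric_self_J (x : G) : P.metric (P.J x) x = 0 := by
  rw [P.metric_comm, metric_J_self]

variable [FiniteDimensional ℝ G]

theorem symPart_add_antiPart (f : G →ₗ[ℝ] G) (x : G) : P.symPart f x + P.antiPart f x = f x := by
  simp only [symPart, antiPart, LinearMap.smul_apply, LinearMap.add_apply, LinearMap.sub_apply]
  module

theorem symPart_add (f f' : G →ₗ[ℝ] G) : P.symPart (f + f') = P.symPart f + P.symPart f' := by
  refine LinearMap.ext fun x => P.ext_metric fun y => ?_
  simp only [LinearMap.add_apply, map_add, metric_symPart]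
  ring

theorem symPart_smul (c : ℝ) (f : G →ₗ[ℝ] G) : P.symPart (c • f) = c • P.symPart f := by
  refine LinearMap.ext fun x => P.ext_metric fun y => ?_
  simp only [LinearMap.smul_apply, map_smul, metric_symPart, smul_eq_mul]
  ring

theorem antiPart_add (f f' : G →ₗ[ℝ] G) : P.antiPart (f + f') = P.antiPart f + P.antiPart f' := by
  refine LinearMap.ext fun x => P.ext_metric fun y => ?_
  simp only [LinearMap.add_apply, map_add, metric_antiPart]
  ring

theorem antiPart_smul (c : ℝ) (f : G →ₗ[ℝ] G) : P.antiPart (c • f) = c • P.antiPart f := by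
  refine LinearMap.ext fun x => P.ext_metric fun y => ?_
  simp only [LinearMap.smul_apply, map_smul, metric_antiPart, smul_eq_mul]
  ring

theorem symPart_eq_zero_iff (f : G →ₗ[ℝ] G) :
    P.symPart f = 0 ↔ ∀ x y, P.metric (f x) y + P.metric x (f y) = 0 := by
  constructor
  · intro h x y
    have h1 := P.metric_symPart f x y
    rw [h, LinearMap.zero_apply, map_zero, LinearMap.zero_apply] at h1
    linarith
  · intro h
    refine LinearMap.ext fun x => P.ext_metric fun y => ?_
    rw [metric_symPart, h x y]
    simp

end PseudoHermitian

/-- The symmetric part `S` of `φ(A)` and the antisymmetric parts `A`, `B` of `φ(A)`, `φ(J A)`, for a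
pseudo-Kähler extension `φ` by an abelian Lie algebra. -/
structure IsExtensionTriple (S A B : G →ₗ[ℝ] G) : Prop where
  S_symm : ∀ x y, P.metric (S x) y = P.metric x (S y)
  S_J : ∀ x, S (P.J x) = -P.J (S x)
  A_skew : ∀ x y, P.metric (A x) y = -P.metric x (A y)
  A_J : ∀ x, A (P.J x) = P.J (A x)
  B_skew : ∀ x y, P.metric (B x) y = -P.metric x (B y)
  B_J : ∀ x, B (P.J x) = P.J (B x)
  lie_A_B : ∀ x, A (B x) - B (A x) = (2 : ℝ) • P.J (S (S x))
  lie_B_S : ∀ x, B (S x) - S (B x) = P.J (A (S x) - S (A x))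

end

section

variable {G H : Type*} [LieRing G] [LieAlgebra ℝ G] [FiniteDimensional ℝ G] [LieRing H]
  [LieAlgebra ℝ H] {P : PseudoKahler G} {Q : PseudoKahler H} (E : PKExtension P Q)

namespace PKExtension

/-- The symmetric part of `φ(a)`. -/
def sym (a : H) : G →ₗ[ℝ] G := P.symPart (E.φ a).toLinearMap

/-- The antisymmetric part of `φ(a)`. -/
def anti (a : H) : G →ₗ[ℝ] G := P.antiPart (E.φ a).toLinearMap

theorem φ_apply (a : H) (x : G) : E.φ a x = E.sym a x + E.anti a x :=
  (P.symPart_add_antiPart _ x).symm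

theorem sym_J (a : H) (x : G) : E.sym (Q.J a) x = P.J (E.sym a x) :=
  (LinearMap.congr_fun (E.isExtension.1 a) x).symm

theorem φ_J_apply (a : H) (x : G) : E.φ (Q.J a) x = P.J (E.sym a x) + E.anti (Q.J a) x := by
  rw [φ_apply, sym_J]

theorem sym_add (a b : H) (x : G) : E.sym (a + b) x = E.sym a x + E.sym b x := by
  have : (E.φ (a + b)).toLinearMap = (E.φ a).toLinearMap + (E.φ b).toLinearMap := by
    rw [map_add]; rfl
  rw [sym, this, P.symPart_add]
  rfl

theorem sym_smul (c : ℝ) (a : H) (x : G) : E.sym (c • a) x = c • E.sym a x := by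
  have : (E.φ (c • a)).toLinearMap = c • (E.φ a).toLinearMap := by
    rw [map_smul]; rfl
  rw [sym, this, P.symPart_smul]
  rfl

theorem anti_add (a b : H) (x : G) : E.anti (a + b) x = E.anti a x + E.anti b x := by
  have : (E.φ (a + b)).toLinearMap = (E.φ a).toLinearMap + (E.φ b).toLinearMap := by
    rw [map_add]; rfl
  rw [anti, this, P.antiPart_add]
  rfl

theorem anti_smul (c : ℝ) (a : H) (x : G) : E.anti (c • a) x = c • E.anti a x := by
  have : (E.φ (c • a)).toLinearMap = c • (E.φ a).toLinearMap := by
    rw [map_smul]; rfl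
  rw [anti, this, P.antiPart_smul]
  rfl

theorem sym_symm (a : H) (x y : G) : P.metric (E.sym a x) y = P.metric x (E.sym a y) := by
  rw [P.metric_comm x, sym, P.metric_symPart, P.metric_symPart, P.metric_comm x, P.metric_comm y,
    add_comm]

theorem anti_skew (a : H) (x y : G) : P.metric (E.anti a x) y = -P.metric x (E.anti a y) := by
  rw [P.metric_comm x, anti, P.metric_antiPart, P.metric_antiPart, P.metric_comm x,
    P.metric_comm y]
  ring

theorem anti_J (a : H) (x : G) : E.anti a (P.J x) = P.J (E.anti a x) :=
  (LinearMap.congr_fun (E.isExtension.2 a) x).symm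

/-- The product JS is itself a symmetric part, that of φ(Ja). Since J is skew, symmetry of both S
and JS forces SJ = -JS. -/
theorem sym_J_right (a : H) (x : G) : E.sym a (P.J x) = -P.J (E.sym a x) := by
  refine P.ext_metric fun y => ?_
  have h := E.sym_symm (Q.J a) x y
  rw [sym_J, sym_J] at h
  rw [map_neg, LinearMap.neg_apply, h, sym_symm, P.metric_J_left]

theorem φ_commute [IsLieAbelian H] (a b : H) (x : G) : E.φ a (E.φ b x) = E.φ b (E.φ a x) := by
  have h := E.φ.map_lie a b
  rw [trivial_lie_zero, map_zero] at h
  have h1 := congrArg (fun D : LieDerivation ℝ G G => D x) h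
  simp only [LieDerivation.lie_apply, LieDerivation.zero_apply] at h1
  exact sub_eq_zero.1 h1.symm

/-- The two commutator relations are the J-linear and J-antilinear halves of the single equation
[φ(a), φ(Ja)] = 0. -/
theorem isExtensionTriple [IsLieAbelian H] (a : H) :
    IsExtensionTriple P.toPseudoHermitian (E.sym a) (E.anti a) (E.anti (Q.J a)) := by
  have key : ∀ x, E.anti a (E.anti (Q.J a) x) - E.anti (Q.J a) (E.anti a x)
        - (2 : ℝ) • P.J (E.sym a (E.sym a x))
      = (E.anti (Q.J a) (E.sym a x) - E.sym a (E.anti (Q.J a) x))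
        - P.J (E.anti a (E.sym a x) - E.sym a (E.anti a x)) := fun x => by
    have h := E.φ_commute a (Q.J a) x
    simp only [φ_apply, sym_J, map_add, anti_J, sym_J_right] at h
    simp only [map_sub]
    linear_combination (norm := module) h
  -- The left side of `key` commutes with J and the right side anticommutes with it, so both vanish.
  have key' : ∀ x, E.anti a (E.anti (Q.J a) x) - E.anti (Q.J a) (E.anti a x)
      - (2 : ℝ) • P.J (E.sym a (E.sym a x)) = 0 := fun x => by
    have h1 := congrArg P.J (key x)
    have h2 := key (P.J x)
    simp only [map_sub, map_smul, anti_J, sym_J_right, map_neg, P.J_sq] at h1 h2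
    have h3 : P.J (E.anti a (E.anti (Q.J a) x) - E.anti (Q.J a) (E.anti a x)
      - (2 : ℝ) • P.J (E.sym a (E.sym a x))) = 0 := by
      simp only [map_sub, map_smul, P.J_sq]
      linear_combination (norm := module) (1 / 2 : ℝ) • h1 + (1 / 2 : ℝ) • h2
    have h4 := congrArg P.J h3
    rwa [P.J_sq, map_zero, neg_eq_zero] at h4
  exact
    { S_symm := E.sym_symm a
      S_J := E.sym_J_right a
      A_skew := E.anti_skew a
      A_J := E.anti_J a
      B_skew := E.anti_skew _
      B_J := E.anti_J _
      lie_A_B := fun x => sub_eq_zero.1 (key' x)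
      lie_B_S := fun x => sub_eq_zero.1 ((key x).symm.trans (key' x)) }

/-- With φ' = 0 the commutation condition is void and the other one says that φ is skew. Conversely,
a skew φ is AW-related by identity maps to the zero extension. -/
theorem isTrivial_iff : E.IsTrivial ↔ ∀ a, P.symPart (E.φ a).toLinearMap = 0 := by
  constructor
  · rintro ⟨G', _, _, _, H', _, _, P', Q', E', h0, f, k, hs, -⟩ a
    have h1 := hs a
    rw [h0] at h1
    rw [PseudoHermitian.symPart_eq_zero_iff] at h1 ⊢
    intro x y
    have h2 := h1 (f.toLieEquiv x) (f.toLieEquiv y)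
    have hc : ∀ z : G, (f.toLinearEquiv.conj (E.φ a).toLinearMap
        - ((0 : H' →ₗ⁅ℝ⁆ LieDerivation ℝ G' G') (k.toLieEquiv a)).toLinearMap) (f.toLieEquiv z)
        = f.toLieEquiv (E.φ a z) := fun z => by
      have e1 : f.toLinearEquiv.conj (E.φ a).toLinearMap (f.toLieEquiv z)
          = f.toLieEquiv (E.φ a (f.toLinearEquiv.symm (f.toLinearEquiv z))) := rfl
      rw [LinearMap.sub_apply, e1, LinearEquiv.symm_apply_apply]
      exact sub_zero _
    rw [hc, hc, f.map_metric, f.map_metric] at h2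
    exact h2
  · intro h
    refine ⟨G, _, _, _, H, _, _, P, Q, ⟨0, ?_⟩, rfl, ⟨LieEquiv.refl, fun _ _ => rfl, fun _ => rfl⟩,
      ⟨LieEquiv.refl, fun _ _ => rfl, fun _ => rfl⟩, fun a => ?_, fun a a' => ?_⟩
    · rw [isExtension_iff, semidirect_integrable_iff, semidirect_omegaClosed_iff]
      simp
    · rw [← h a]
      congr 1
      exact LinearMap.ext fun x => sub_zero _
    · exact Commute.zero_right _

end PKExtension

end

/-! ### Cyclic vectors, hyperbolic pairs and the normal form of the symmetric part. -/

section

variable {G : Type*} [LieRing G] [LieAlgebra ℝ G] {P : PseudoHermitian G} {S A B : G →ₗ[ℝ] G}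

theorem exists_complex_sqrt (p q : ℝ) : ∃ x y : ℝ, x ^ 2 - y ^ 2 = p ∧ 2 * x * y = q := by
  obtain ⟨z, hz⟩ := IsAlgClosed.exists_pow_nat_eq (⟨p, q⟩ : ℂ) (n := 2) (by norm_num)
  refine ⟨z.re, z.im, ?_, ?_⟩
  · have h := congrArg Complex.re hz
    simp only [pow_two, Complex.mul_re] at h
    linear_combination h
  · have h := congrArg Complex.im hz
    simp only [pow_two, Complex.mul_im] at h
    linear_combination h

/-- With J as multiplication by i, the relation [A, B] = 2JS² is the hypothesis of
`exists_antilinear_cyclic_vector`. -/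
theorem IsExtensionTriple.exists_cyclic_vector (hT : IsExtensionTriple P S A B)
    (hG : Module.finrank ℝ G = 4) (hS : ∃ x, S x ≠ 0) :
    ∃ (u : G) (κ : ℝ), 0 ≤ κ ∧ S u ≠ 0 ∧ S (S u) = κ • P.J u ∧
      ∀ x, ∃ p q r s : ℝ, x = p • u + q • P.J u + r • S u + s • P.J (S u) := by
  have hJ : (P.J : Module.End ℝ G) * P.J = -1 := LinearMap.ext P.J_sq
  let _ : Module ℂ G := Module.compHom G (Complex.liftAux (P.J : Module.End ℝ G) hJ).toRingHom
  have hsmul : ∀ (z : ℂ) (x : G), z • x = z.re • x + z.im • P.J x := fun z x => by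
    change (Complex.liftAux (P.J : Module.End ℝ G) hJ) z x = _
    rw [Complex.liftAux_apply]
    rfl
  have : IsScalarTower ℝ ℂ G := ⟨fun t z x => by
    rw [hsmul, hsmul]
    simp only [Complex.smul_re, Complex.smul_im, smul_eq_mul]
    module⟩
  have hE : Module.finrank ℂ G = 2 := by
    have h := Module.finrank_mul_finrank ℝ ℂ G
    rw [Complex.finrank_real_complex, hG] at h
    omega
  let S' : G →ₛₗ[starRingEnd ℂ] G :=
    { toFun := S
      map_add' := map_add S
      map_smul' := fun z x => by
        rw [hsmul, hsmul, map_add, map_smul, map_smul, hT.S_J, Complex.conj_re, Complex.conj_im]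
        module }
  let A' : Module.End ℂ G :=
    { toFun := A
      map_add' := map_add A
      map_smul' := fun z x => by
        rw [RingHom.id_apply, hsmul, hsmul, map_add, map_smul, map_smul, hT.A_J] }
  let B' : Module.End ℂ G :=
    { toFun := B
      map_add' := map_add B
      map_smul' := fun z x => by
        rw [RingHom.id_apply, hsmul, hsmul, map_add, map_smul, map_smul, hT.B_J] }
  obtain ⟨u, κ, hκ, h0, h1, h2⟩ := exists_antilinear_cyclic_vector S' hE A' B'
    (fun x => (hT.lie_A_B x).trans (by rw [hsmul]; simp [S'])) hS
  refine ⟨u, κ, hκ, h0, h1.trans (by rw [hsmul]; simp), fun x => ?_⟩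
  obtain ⟨z, z', h⟩ := h2 x
  refine ⟨z.re, z.im, z'.re, z'.im, h.trans ?_⟩
  rw [hsmul, hsmul]
  change _ + (_ • S u + _ • P.J (S u)) = _
  module

/-- Two vectors spanning complementary isotropic complex lines, dual to each other. -/
structure IsHyperbolicPair (P : PseudoHermitian G) (v w : G) : Prop where
  vv : P.metric v v = 0
  ww : P.metric w w = 0
  vw : P.metric v w = 1
  v_Jw : P.metric v (P.J w) = 0

namespace IsHyperbolicPair

variable {v w : G}

theorem wv (h : IsHyperbolicPair P v w) : P.metric w v = 1 := by rw [P.metric_comm, h.vw]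

theorem Jv_w (h : IsHyperbolicPair P v w) : P.metric (P.J v) w = 0 := by
  rw [P.metric_J_left, h.v_Jw, neg_zero]

theorem Jw_v (h : IsHyperbolicPair P v w) : P.metric (P.J w) v = 0 := by
  rw [P.metric_comm, h.v_Jw]

theorem w_Jv (h : IsHyperbolicPair P v w) : P.metric w (P.J v) = 0 := by
  rw [P.metric_comm, h.Jv_w]

theorem metric_comb (h : IsHyperbolicPair P v w) (p q r s : ℝ) :
    P.metric (p • v + q • P.J v + r • w + s • P.J w) w = p ∧
    P.metric (p • v + q • P.J v + r • w + s • P.J w) (P.J w) = q ∧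
    P.metric (p • v + q • P.J v + r • w + s • P.J w) v = r ∧
    P.metric (p • v + q • P.J v + r • w + s • P.J w) (P.J v) = s := by
  simp [P.compat, P.metric_J_self, P.metric_self_J, h.vv, h.ww, h.vw, h.v_Jw, h.wv, h.Jv_w,
    h.Jw_v, h.w_Jv]

theorem eq_comb_iff (h : IsHyperbolicPair P v w) {p q r s p' q' r' s' : ℝ} :
    p • v + q • P.J v + r • w + s • P.J w = p' • v + q' • P.J v + r' • w + s' • P.J w ↔
      p = p' ∧ q = q' ∧ r = r' ∧ s = s' := by
  constructor
  · intro e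
    have h1 := h.metric_comb p q r s
    rw [e] at h1
    have h2 := h.metric_comb p' q' r' s'
    exact ⟨h1.1.symm.trans h2.1, h1.2.1.symm.trans h2.2.1, h1.2.2.1.symm.trans h2.2.2.1,
      h1.2.2.2.symm.trans h2.2.2.2⟩
  · rintro ⟨rfl, rfl, rfl, rfl⟩
    rfl

theorem comb_eq_zero (h : IsHyperbolicPair P v w) {p q r s : ℝ}
    (e : p • v + q • P.J v + r • w + s • P.J w = 0) : p = 0 ∧ q = 0 ∧ r = 0 ∧ s = 0 :=
  h.eq_comb_iff.1 (e.trans (by simp))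

theorem exists_eq_comb (h : IsHyperbolicPair P v w) (hG : Module.finrank ℝ G = 4) (x : G) :
    ∃ p q r s : ℝ, x = p • v + q • P.J v + r • w + s • P.J w := by
  have : FiniteDimensional ℝ G := FiniteDimensional.of_finrank_pos (by omega)
  have hli : LinearIndependent ℝ ![v, P.J v, w, P.J w] := by
    rw [Fintype.linearIndependent_iff]
    intro c hc
    simp only [Fin.sum_univ_four, Matrix.cons_val] at hc
    obtain ⟨h0, h1, h2, h3⟩ := h.comb_eq_zero hc
    intro i
    fin_cases i <;> assumption
  have hs := hli.span_eq_top_of_card_eq_finrank' (by simp [hG])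
  have hx : x ∈ Submodule.span ℝ (Set.range ![v, P.J v, w, P.J w]) := hs ▸ Submodule.mem_top
  obtain ⟨c, hc⟩ := (Submodule.mem_span_range_iff_exists_fun ℝ).1 hx
  simp only [Fin.sum_univ_four, Matrix.cons_val] at hc
  exact ⟨_, _, _, _, hc.symm⟩

theorem eq_comb (h : IsHyperbolicPair P v w) (hG : Module.finrank ℝ G = 4) (x : G) :
    x = P.metric x w • v + P.metric x (P.J w) • P.J v + P.metric x v • w
      + P.metric x (P.J v) • P.J w := by
  obtain ⟨p, q, r, s, rfl⟩ := h.exists_eq_comb hG x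
  obtain ⟨h1, h2, h3, h4⟩ := h.metric_comb p q r s
  rw [h1, h2, h3, h4]

theorem rotate (h : IsHyperbolicPair P v w) {x y : ℝ} (hxy : x ^ 2 + y ^ 2 = 1) :
    IsHyperbolicPair P (x • v + y • P.J v) (x • w + y • P.J w) := by
  constructor <;> simp only [map_add, map_smul, LinearMap.add_apply, LinearMap.smul_apply,
    smul_eq_mul, P.compat, P.J_sq, map_neg, P.metric_J_self, P.metric_self_J, h.vv, h.ww, h.vw,
    h.v_Jw, h.Jv_w] <;> first | linear_combination hxy | ring

end IsHyperbolicPair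

/-- These are the four real parameters of 𝔲(1,1): skewness kills g(Av, v) and g(Aw, w), and ties the
w-part of Aw to the v-part of Av. -/
theorem IsHyperbolicPair.skew_eq {v w : G} (h : IsHyperbolicPair P v w)
    (hG : Module.finrank ℝ G = 4) (hA : ∀ x y, P.metric (A x) y = -P.metric x (A y)) (hJ : ∀ x, A (P.J x) = P.J (A x)) :
    ∃ α₁ α₂ β γ : ℝ, A v = α₁ • v + α₂ • P.J v + γ • P.J w ∧
      A w = β • P.J v - α₁ • w + α₂ • P.J w := by
  refine ⟨P.metric (A v) w, P.metric (A v) (P.J w), P.metric (A w) (P.J w),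
    P.metric (A v) (P.J v), ?_, ?_⟩
  · have h0 : P.metric (A v) v = 0 := by
      have := hA v v
      rw [P.metric_comm v] at this
      linarith
    conv_lhs => rw [h.eq_comb hG (A v)]
    rw [h0, zero_smul, add_zero]
  · have h0 : P.metric (A w) w = 0 := by
      have := hA w w
      rw [P.metric_comm w] at this
      linarith
    have h1 : P.metric (A w) v = -P.metric (A v) w := by
      rw [hA w v, P.metric_comm]
    have h2 : P.metric (A w) (P.J v) = P.metric (A v) (P.J w) := by
      rw [hA w, hJ, P.metric_comm, P.metric_J_left, neg_neg]
    conv_lhs => rw [h.eq_comb hG (A w)]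
    rw [h0, h1, h2]
    module

/-- The normal form `S w = v`, `S v = κ J w` of the symmetric part of `φ(a)`, in a hyperbolic
pair. -/
structure IsNormalForm (P : PseudoHermitian G) (S : G →ₗ[ℝ] G) (κ : ℝ) (v w : G) : Prop
    extends IsHyperbolicPair P v w where
  S_w : S w = v
  S_v : S v = κ • P.J w

/-- Symmetry gives g(Su, Su) = g(u, S²u) = κ g(u, Ju) = 0. Hence u must pair non-trivially with the
complex line of Su: otherwise Su would be orthogonal to a whole basis. -/
theorem IsExtensionTriple.exists_isotropic_cyclic_vector (hT : IsExtensionTriple P S A B)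
    (hG : Module.finrank ℝ G = 4) (hS : ∃ x, S x ≠ 0) :
    ∃ (u : G) (κ : ℝ), 0 ≤ κ ∧ S (S u) = κ • P.J u ∧ P.metric u u = 0 ∧
      P.metric (S u) (S u) = 0 ∧ P.metric u (S u) ^ 2 + P.metric u (P.J (S u)) ^ 2 ≠ 0 := by
  obtain ⟨u, κ, hκ, h0, h1, h2⟩ := hT.exists_cyclic_vector hG hS
  have h3 : P.metric (S u) (S u) = 0 := by
    rw [hT.S_symm, h1, map_smul, P.metric_J_self, smul_zero]
  have h4 : P.metric u (S u) ^ 2 + P.metric u (P.J (S u)) ^ 2 ≠ 0 := fun h => by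
    have h5 : P.metric u (S u) = 0 := by
      nlinarith [sq_nonneg (P.metric u (S u)), sq_nonneg (P.metric u (P.J (S u)))]
    have h6 : P.metric u (P.J (S u)) = 0 := by
      nlinarith [sq_nonneg (P.metric u (S u)), sq_nonneg (P.metric u (P.J (S u)))]
    refine h0 (P.nondeg.2 _ fun x => ?_)
    obtain ⟨p, q, r, s, rfl⟩ := h2 x
    simp only [map_add, map_smul, LinearMap.add_apply, LinearMap.smul_apply, P.metric_J_left u,
      P.metric_self_J, h3, h5, h6, smul_eq_mul]
    ring
  rcases hκ.eq_or_lt with rfl | hκ'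
  · rw [zero_smul] at h1
    set a := P.metric u (S u)
    set b := P.metric u (P.J (S u))
    set d := a ^ 2 + b ^ 2
    -- Since S²u = 0, moving u along the complex line of Su leaves Su unchanged; t solves g(u, u) +
    -- 2td = 0.
    set t := -P.metric u u / (2 * d)
    have hS' : S (u + t • a • S u + t • b • P.J (S u)) = S u := by
      simp only [map_add, map_smul, hT.S_J, h1, map_zero, smul_zero, neg_zero, add_zero]
    refine ⟨u + t • a • S u + t • b • P.J (S u), 0, le_rfl, ?_, ?_, ?_, ?_⟩
    · rw [hS', h1, zero_smul]
    · simp only [map_add, map_smul, LinearMap.add_apply, LinearMap.smul_apply, smul_eq_mul,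
        P.compat, P.metric_J_self, P.metric_self_J, h3, P.metric_comm (S u) u,
        P.metric_comm (P.J (S u)) u]
      have ht : t * (2 * d) = -P.metric u u := div_mul_cancel₀ _ (mul_ne_zero two_ne_zero h4)
      linear_combination ht
    · rw [hS', h3]
    · rw [hS']
      simpa only [map_add, map_smul, LinearMap.add_apply, LinearMap.smul_apply, smul_eq_mul,
        P.compat, P.metric_J_self, P.metric_self_J, h3, mul_zero, add_zero] using h4
  · refine ⟨u, κ, hκ, h1, ?_, h3, h4⟩
    -- For κ > 0 the vector u is already isotropic: κ g(Ju, Ju) = g(Su, SJu) = -g(Su, JSu) = 0.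
    have e1 := hT.S_symm (S u) (P.J u)
    rw [h1, hT.S_J, map_neg, P.metric_J_self, neg_zero, map_smul, LinearMap.smul_apply, P.compat,
      smul_eq_mul] at e1
    exact (mul_eq_zero.1 e1).resolve_left hκ'.ne'

/-- Put w = zu and v = Sw = z̄Su. Then Sv = κJw holds for every z, and z is fixed by normalising the
pairing of v with w. -/
theorem IsExtensionTriple.exists_isNormalForm (hT : IsExtensionTriple P S A B)
    (hG : Module.finrank ℝ G = 4) (hS : ∃ x, S x ≠ 0) :
    ∃ (κ : ℝ) (v w : G), 0 ≤ κ ∧ IsNormalForm P S κ v w := by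
  obtain ⟨u, κ, hκ, h1, h2, h3, h4⟩ := hT.exists_isotropic_cyclic_vector hG hS
  set p := P.metric u (S u)
  set q := P.metric u (P.J (S u))
  -- The scalar z = x + iy enters the pairing through z², so the requirement is z²(p + iq) = 1.
  obtain ⟨x, y, hx, hy⟩ := exists_complex_sqrt (p / (p ^ 2 + q ^ 2)) (-q / (p ^ 2 + q ^ 2))
  have e1 : (x ^ 2 - y ^ 2) * p - 2 * x * y * q = 1 := by
    rw [hx, hy]
    field_simp
    ring
  have e2 : (x ^ 2 - y ^ 2) * q + 2 * x * y * p = 0 := by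
    rw [hx, hy]
    field_simp
    ring
  have m1 : P.metric (S u) u = p := P.metric_comm _ _
  have m2 : P.metric (P.J (S u)) u = q := P.metric_comm _ _
  have m3 : P.metric (S u) (P.J u) = -q := by rw [P.metric_comm, P.metric_J_left]
  refine ⟨κ, x • S u - y • P.J (S u), x • u + y • P.J u, hκ, ⟨?_, ?_, ?_, ?_⟩, ?_, ?_⟩
  · simp only [map_sub, map_smul, LinearMap.sub_apply, LinearMap.smul_apply, smul_eq_mul, P.compat,
      P.metric_J_self, P.metric_self_J, h3]
    ring
  · simp only [map_add, map_smul, LinearMap.add_apply, LinearMap.smul_apply, smul_eq_mul, P.compat,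
      P.metric_J_self, P.metric_self_J, h2]
    ring
  · simp only [map_add, map_sub, map_smul, LinearMap.sub_apply, LinearMap.smul_apply, smul_eq_mul,
      P.compat, m1, m2, m3]
    linear_combination e1
  · simp only [map_add, map_sub, map_smul, LinearMap.sub_apply, LinearMap.smul_apply, smul_eq_mul,
      P.compat, P.J_sq, map_neg, m1, m2, m3]
    linear_combination -e2
  · simp only [map_add, map_smul, hT.S_J]
    module
  · simp only [map_add, map_sub, map_smul, hT.S_J, h1, P.J_sq]
    module

end

/-! ### Normal form of an extension, and rotations of the plane. -/

section

variable {G H : Type*} [LieRing G] [LieAlgebra ℝ G] [FiniteDimensional ℝ G] [LieRing H]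
  [LieAlgebra ℝ H] {P : PseudoKahler G} {Q : PseudoKahler H}

/-- The normal form of an extension `φ` of a four-dimensional pseudo-Kähler Lie algebra by a plane
with orthonormal basis `a, J a`. -/
structure IsExtensionNormalForm (E : PKExtension P Q) (a : H) (v w : G) (κ α₁ α₂ β β' : ℝ) : Prop
    extends IsNormalForm P.toPseudoHermitian (E.sym a) κ v w where
  unit : Q.metric a a = 1
  κ_nonneg : 0 ≤ κ
  A_v : E.anti a v = α₁ • v + α₂ • P.J v + (κ * β') • P.J w
  A_w : E.anti a w = β • P.J v - α₁ • w + α₂ • P.J w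
  B_v : E.anti (Q.J a) v = -α₂ • v + α₁ • P.J v - (κ * β) • P.J w
  B_w : E.anti (Q.J a) w = β' • P.J v + α₂ • w + α₁ • P.J w
  κ_α₁ : κ * α₁ = 0
  κ_α₂ : κ * α₂ = 0
  α_β : β' * α₁ + β * α₂ = 0
  κ_β : κ * (β ^ 2 + β' ^ 2) = 2 * κ

theorem exists_isExtensionNormalForm [IsLieAbelian H] (E : PKExtension P Q)
    (hG : Module.finrank ℝ G = 4) {a : H} (ha : Q.metric a a = 1) (hS : ∃ x, E.sym a x ≠ 0) :
    ∃ (v w : G) (κ α₁ α₂ β β' : ℝ), IsExtensionNormalForm E a v w κ α₁ α₂ β β' := by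
  have hT := E.isExtensionTriple a
  obtain ⟨κ, v, w, hκ, h⟩ := hT.exists_isNormalForm hG hS
  obtain ⟨α₁, α₂, β, γ, Av, Aw⟩ := h.toIsHyperbolicPair.skew_eq hG hT.A_skew hT.A_J
  obtain ⟨δ₁, δ₂, β', γ', Bv, Bw⟩ := h.toIsHyperbolicPair.skew_eq hG hT.B_skew hT.B_J
  -- The relation [B, S] = J[A, S] at w makes the diagonal part of B equal to i times that of A and
  -- fixes the lower coefficients; at v it then gives κα = 0. The relation [A, B] = 2JS² at w gives
  -- the remaining two constraints.
  have e1 := hT.lie_B_S w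
  have e2 := hT.lie_B_S v
  have e3 := hT.lie_A_B w
  simp only [h.S_v, h.S_w, Av, Aw, Bv, Bw, map_add, map_sub, map_smul, map_neg, hT.S_J, hT.A_J,
    hT.B_J, P.J_sq] at e1 e2 e3
  obtain ⟨f1, f2, f3, f4⟩ := h.comb_eq_zero (p := 2 * δ₁ + 2 * α₂) (q := 2 * δ₂ - 2 * α₁)
    (r := γ - κ * β') (s := γ' + κ * β)
    (by linear_combination (norm := module) e1)
  obtain ⟨-, -, g3, g4⟩ := h.comb_eq_zero (p := γ - κ * β') (q := γ' + κ * β)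
    (r := -(2 * κ * δ₂) - 2 * κ * α₁) (s := 2 * κ * α₂ - 2 * κ * δ₁)
    (by linear_combination (norm := module) e2)
  have hδ₁ : δ₁ = -α₂ := by linarith
  have hδ₂ : δ₂ = α₁ := by linarith
  have hγ : γ = κ * β' := by linarith
  have hγ' : γ' = -(κ * β) := by linarith
  subst hδ₁ hδ₂ hγ hγ'
  obtain ⟨-, k2, k3, -⟩ := h.comb_eq_zero (p := 0) (q := 2 * (β' * δ₂ + β * α₂))
    (r := 2 * κ - κ * (β ^ 2 + β' ^ 2)) (s := 0)
    (by linear_combination (norm := module) e3)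
  refine ⟨v, w, κ, δ₂, α₂, β, β', h, ha, hκ, Av, Aw, ?_, ?_, ?_, ?_, ?_, ?_⟩
  · rw [Bv]; module
  · rw [Bw]; module
  all_goals linarith

variable {E : PKExtension P Q} {a : H} {v w : G} {κ α₁ α₂ β β' : ℝ}

/-- In complex terms, with e = c + is: S becomes eS, α becomes eα and β + iβ' becomes ē(β + iβ'),
while the hyperbolic pair turns by half the angle. -/
theorem IsExtensionNormalForm.rotate (h : IsExtensionNormalForm E a v w κ α₁ α₂ β β') {c s : ℝ}
    (hcs : c ^ 2 + s ^ 2 = 1) : ∃ v' w' : G, IsExtensionNormalForm E (c • a + s • Q.J a) v' w' κ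
      (c * α₁ - s * α₂) (c * α₂ + s * α₁) (c * β + s * β') (c * β' - s * β) := by
  -- With z = x + iy, z² = e, antilinearity gives eS(zw) = z²z̄ v = zv; `e1` and `e2` are the two
  -- components of ez̄ = z.
  obtain ⟨x, y, hx, hy⟩ := exists_complex_sqrt c s
  have hxy : x ^ 2 + y ^ 2 = 1 := by
    rw [← hx, ← hy] at hcs
    nlinarith [sq_nonneg x, sq_nonneg y]
  have e1 : c * x + s * y = x := by
    rw [← hx, ← hy]; linear_combination x * hxy
  have e2 : s * x - c * y = y := by
    rw [← hx, ← hy]; linear_combination y * hxy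
  have hS : ∀ z, E.sym (c • a + s • Q.J a) z = c • E.sym a z + s • P.J (E.sym a z) := fun z => by
    rw [E.sym_add, E.sym_smul, E.sym_smul, E.sym_J]
  have hA : ∀ z, E.anti (c • a + s • Q.J a) z = c • E.anti a z + s • E.anti (Q.J a) z := fun z => by
    rw [E.anti_add, E.anti_smul, E.anti_smul]
  have hB : ∀ z, E.anti (Q.J (c • a + s • Q.J a)) z = c • E.anti (Q.J a) z - s • E.anti a z :=
    fun z => by
      have : Q.J (c • a + s • Q.J a) = c • Q.J a + (-s) • a := by
        rw [map_add, map_smul, map_smul, Q.J_sq]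
        module
      rw [this, E.anti_add, E.anti_smul, E.anti_smul]
      module
  refine ⟨x • v + y • P.J v, x • w + y • P.J w, ⟨h.toIsHyperbolicPair.rotate hxy, ?_, ?_⟩, ?_,
    h.κ_nonneg, ?_, ?_, ?_, ?_, ?_, ?_, ?_, ?_⟩
  · rw [hS]
    simp only [map_add, map_smul, E.sym_J_right, h.S_w, map_neg, P.J_sq]
    linear_combination (norm := module) e1 • v + e2 • P.J v
  · rw [hS]
    simp only [map_add, map_smul, E.sym_J_right, h.S_v, map_neg, P.J_sq]
    linear_combination (norm := module) (κ * e1) • P.J w - (κ * e2) • w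
  · simp only [map_add, map_smul, LinearMap.add_apply, LinearMap.smul_apply, smul_eq_mul, Q.compat,
      Q.metric_J_self, Q.metric_self_J, h.unit]
    linear_combination hcs
  · rw [hA]
    simp only [map_add, map_smul, E.anti_J, h.A_v, h.B_v, map_sub, P.J_sq]
    module
  · rw [hA]
    simp only [map_add, map_smul, E.anti_J, h.A_w, h.B_w, map_sub, P.J_sq]
    module
  · rw [hB]
    simp only [map_add, map_smul, E.anti_J, h.A_v, h.B_v, map_sub, P.J_sq]
    module
  · rw [hB]
    simp only [map_add, map_smul, E.anti_J, h.A_w, h.B_w, map_sub, P.J_sq]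
    module
  · linear_combination c * h.κ_α₁ - s * h.κ_α₂
  · linear_combination c * h.κ_α₂ + s * h.κ_α₁
  · linear_combination (c ^ 2 + s ^ 2) * h.α_β
  · linear_combination (c ^ 2 + s ^ 2) * h.κ_β + 2 * κ * hcs

end

/-! ## Constructing equivalences and AW-relations -/

section

variable {L L' : Type*} [LieRing L] [LieAlgebra ℝ L] [FiniteDimensional ℝ L] [LieRing L']
  [LieAlgebra ℝ L'] [FiniteDimensional ℝ L']

/-- A linear map between pseudo-Kähler Lie algebras of the same dimension that preserves all the
structure is the inverse of an equivalence. -/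
theorem PseudoKahlerEquiv.exists_of_linearMap (P : PseudoKahler L) (P' : PseudoKahler L')
    (ψ : L' →ₗ[ℝ] L) (hfin : Module.finrank ℝ L' = Module.finrank ℝ L)
    (hlie : ∀ x y, ψ ⁅x, y⁆ = ⁅ψ x, ψ y⁆)
    (hmet : ∀ x y, P.metric (ψ x) (ψ y) = P'.metric x y)
    (hJ : ∀ x, ψ (P'.J x) = P.J (ψ x)) :
    ∃ f : PseudoKahlerEquiv P P', ∀ x, f.toLieEquiv (ψ x) = x := by
  -- Preserving a non-degenerate form forces injectivity; equality of dimensions then gives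
  -- bijectivity.
  have hinj : Function.Injective ψ := by
    rw [← LinearMap.ker_eq_bot, LinearMap.ker_eq_bot']
    intro x hx
    refine P'.nondeg.1 x fun y => ?_
    rw [← hmet, hx, map_zero, LinearMap.zero_apply]
  let e := LinearMap.linearEquivOfInjective ψ hinj hfin
  let k : L' ≃ₗ⁅ℝ⁆ L := { e with map_lie' := fun {x y} => hlie x y }
  have hk : ∀ x, k x = ψ x := fun x => rfl
  refine ⟨⟨k.symm, fun x y => ?_, fun x => ?_⟩, fun x => ?_⟩
  · rw [← hmet, ← hk, ← hk, LieEquiv.apply_symm_apply, LieEquiv.apply_symm_apply]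
  · have hki : ∀ x y, k x = k y → x = y := fun x y h => k.injective h
    apply hki
    rw [LieEquiv.apply_symm_apply, hk, hJ, ← hk, LieEquiv.apply_symm_apply]
  · change k.symm (k x) = x
    rw [LieEquiv.symm_apply_apply]

end

section

variable {H : Type*} [LieRing H] [LieAlgebra ℝ H] [IsLieAbelian H]

/-- A unit vector in a Kähler plane gives an equivalence with the standard plane. -/
theorem exists_planeKahler_equiv (Q : PseudoKahler H) (hH : Module.finrank ℝ H = 2) {a : H}
    (ha : Q.metric a a = 1) : ∃ k : PseudoKahlerEquiv Q planeKahler,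
      ∀ p q : ℝ, k.toLieEquiv (p • a + q • Q.J a) = (abelian 2).vec ![p, q] := by
  have : FiniteDimensional ℝ H := FiniteDimensional.of_finrank_pos (by omega)
  let ψ : (abelian 2).Alg →ₗ[ℝ] H :=
    { toFun := fun v => (abelian 2).vec.symm v 0 • a + (abelian 2).vec.symm v 1 • Q.J a
      map_add' := fun v w => by simp only [map_add, Pi.add_apply]; module
      map_smul' := fun t v => by
        simp only [map_smul, Pi.smul_apply, smul_eq_mul, RingHom.id_apply]; module }
  have hψ : ∀ v : Fin 2 → ℝ, ψ ((abelian 2).vec v) = v 0 • a + v 1 • Q.J a := fun v => rfl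
  obtain ⟨k, hk⟩ := PseudoKahlerEquiv.exists_of_linearMap Q planeKahler ψ
    (by rw [hH, ← (abelian 2).vec.finrank_eq]; simp)
    (fun x y => by
      have h0 : ⁅x, y⁆ = 0 := rfl
      rw [h0, map_zero, trivial_lie_zero])
    (fun x y => by
      obtain ⟨x, rfl⟩ := (abelian 2).vec.surjective x
      obtain ⟨y, rfl⟩ := (abelian 2).vec.surjective y
      have e : planeKahler.metric ((abelian 2).vec x) ((abelian 2).vec y) = x 0 * y 0 + x 1 * y 1 :=
        ((abelian 2).form_vec 1 x y).trans (by simp [dotProduct])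
      rw [e, hψ, hψ]
      simp only [map_add, map_smul, LinearMap.add_apply, LinearMap.smul_apply, smul_eq_mul,
        Q.compat, Q.metric_J_self, Q.metric_self_J, ha]
      ring)
    (fun x => by
      obtain ⟨x, rfl⟩ := (abelian 2).vec.surjective x
      have e : planeKahler.J ((abelian 2).vec x) = (abelian 2).vec ![-x 1, x 0] := by
        refine ((abelian 2).lin_vec !![0, -1; 1, 0] x).trans (congrArg _ ?_)
        ext i
        fin_cases i <;> simp [Matrix.mulVec, dotProduct]
      rw [e, hψ, hψ]
      simp only [map_add, map_smul, Q.J_sq, Matrix.cons_val_zero, Matrix.cons_val_one]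
      module)
  refine ⟨k, fun p q => ?_⟩
  have h := hk ((abelian 2).vec ![p, q])
  rw [hψ] at h
  exact h

end

section

variable {G G' H : Type*} [LieRing G] [LieAlgebra ℝ G] [FiniteDimensional ℝ G]
  [LieRing G'] [LieAlgebra ℝ G'] [FiniteDimensional ℝ G'] [LieRing H] [LieAlgebra ℝ H]
  [IsLieAbelian H] {P : PseudoKahler G} {P' : PseudoKahler G'} {Q : PseudoKahler H}

theorem PKExtension.φ_vec (E' : PKExtension P' planeKahler) (p q : ℝ) (x : G') :
    E'.φ ((abelian 2).vec ![p, q]) x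
      = p • E'.φ ((abelian 2).vec ![1, 0]) x + q • E'.φ ((abelian 2).vec ![0, 1]) x := by
  have : ![p, q] = p • ![1, 0] + q • ![0, 1] := by ext i; fin_cases i <;> simp
  rw [this, map_add, map_smul, map_smul, map_add, map_smul, map_smul, LieDerivation.add_apply,
    LieDerivation.smul_apply, LieDerivation.smul_apply]

/-- The map goes from the model to 𝔤, so that it is given by a frame of 𝔤. `D₁`, `D₂` are the model
operators transported to 𝔤; as both AW conditions are linear in each argument from 𝔥, they need
checking only on a and Ja. -/
theorem awRelated_of_linearMap (E : PKExtension P Q) (E' : PKExtension P' planeKahler)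
    (hH : Module.finrank ℝ H = 2) (hfin : Module.finrank ℝ G' = Module.finrank ℝ G)
    (ψ : G' →ₗ[ℝ] G) (hlie : ∀ x y, ψ ⁅x, y⁆ = ⁅ψ x, ψ y⁆)
    (hmet : ∀ x y, P.metric (ψ x) (ψ y) = P'.metric x y)
    (hJ : ∀ x, ψ (P'.J x) = P.J (ψ x)) {a : H} (ha : Q.metric a a = 1) (D₁ D₂ : G →ₗ[ℝ] G)
    (hD₁ : ∀ x, ψ (E'.φ ((abelian 2).vec ![1, 0]) x) = D₁ (ψ x))
    (hD₂ : ∀ x, ψ (E'.φ ((abelian 2).vec ![0, 1]) x) = D₂ (ψ x))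
    (hs₁ : ∀ x y, P.metric (E.φ a x - D₁ x) y + P.metric x (E.φ a y - D₁ y) = 0)
    (hs₂ : ∀ x y, P.metric (E.φ (Q.J a) x - D₂ x) y + P.metric x (E.φ (Q.J a) y - D₂ y) = 0)
    (hc₁₁ : ∀ x, E.φ a (D₁ x) = D₁ (E.φ a x)) (hc₁₂ : ∀ x, E.φ a (D₂ x) = D₂ (E.φ a x))
    (hc₂₁ : ∀ x, E.φ (Q.J a) (D₁ x) = D₁ (E.φ (Q.J a) x))
    (hc₂₂ : ∀ x, E.φ (Q.J a) (D₂ x) = D₂ (E.φ (Q.J a) x)) : AWRelated E E' := by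
  obtain ⟨f, hf⟩ := PseudoKahlerEquiv.exists_of_linearMap P P' ψ hfin hlie hmet hJ
  obtain ⟨k, hk⟩ := exists_planeKahler_equiv Q hH ha
  have hfi : ∀ x y, f.toLieEquiv x = f.toLieEquiv y → x = y := fun x y h =>
    f.toLieEquiv.injective h
  have hfs : ∀ y, ∃ x, f.toLieEquiv x = y := f.toLieEquiv.surjective
  have hki : ∀ x y, k.toLieEquiv x = k.toLieEquiv y → x = y := fun x y h =>
    k.toLieEquiv.injective h
  have hψf : ∀ x, ψ (f.toLieEquiv x) = x := fun x => hfi _ _ (by rw [hf])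
  have hconj : ∀ (A : H) (x : G), f.toLinearEquiv.conj (E.φ A).toLinearMap (f.toLieEquiv x)
      = f.toLieEquiv (E.φ A x) := fun A x => by
    change f.toLieEquiv (E.φ A (f.toLinearEquiv.symm (f.toLinearEquiv x))) = _
    rw [LinearEquiv.symm_apply_apply]
  have hE' : ∀ (p q : ℝ) (x : G), E'.φ ((abelian 2).vec ![p, q]) (f.toLieEquiv x)
      = f.toLieEquiv (p • D₁ x + q • D₂ x) := fun p q x => by
    have h1 := hD₁ (f.toLieEquiv x)
    have h2 := hD₂ (f.toLieEquiv x)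
    rw [hψf] at h1 h2
    rw [E'.φ_vec, ← h1, ← h2, ← map_smul ψ, ← map_smul ψ, ← map_add ψ, hf]
  have hA : ∀ A : H, ∃ p q : ℝ, A = p • a + q • Q.J a := fun A => by
    obtain ⟨v, hv⟩ := (abelian 2).vec.surjective (k.toLieEquiv A)
    refine ⟨v 0, v 1, hki _ _ ?_⟩
    rw [hk, ← hv]
    congr 1
    ext i
    fin_cases i <;> rfl
  have hE : ∀ (p q : ℝ) (x : G), E.φ (p • a + q • Q.J a) x = p • E.φ a x + q • E.φ (Q.J a) x :=
    fun p q x => by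
      rw [map_add, map_smul, map_smul, LieDerivation.add_apply, LieDerivation.smul_apply,
        LieDerivation.smul_apply]
  refine ⟨f, k, fun A => ?_, fun A A' => ?_⟩
  · obtain ⟨p, q, rfl⟩ := hA A
    rw [PseudoHermitian.symPart_eq_zero_iff]
    intro x y
    obtain ⟨x, rfl⟩ := hfs x
    obtain ⟨y, rfl⟩ := hfs y
    have h1 := hs₁ x y
    have h2 := hs₂ x y
    have e : ∀ z, (f.toLinearEquiv.conj (E.φ (p • a + q • Q.J a)).toLinearMap
        - (E'.φ (k.toLieEquiv (p • a + q • Q.J a))).toLinearMap) (f.toLieEquiv z)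
        = f.toLieEquiv (p • (E.φ a z - D₁ z) + q • (E.φ (Q.J a) z - D₂ z)) := fun z => by
      rw [LinearMap.sub_apply, hconj, hk]
      change _ - E'.φ _ _ = _
      rw [hE', ← map_sub, hE]
      congr 1
      module
    rw [e, e, f.map_metric, f.map_metric]
    simp only [map_add, map_smul, LinearMap.add_apply, LinearMap.smul_apply, smul_eq_mul]
    linear_combination p * h1 + q * h2
  · obtain ⟨p, q, rfl⟩ := hA A
    obtain ⟨v, rfl⟩ := (abelian 2).vec.surjective A'
    have hv : v = ![v 0, v 1] := by ext i; fin_cases i <;> rfl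
    rw [hv]
    refine LinearMap.ext fun x => ?_
    obtain ⟨x, rfl⟩ := hfs x
    change f.toLinearEquiv.conj (E.φ (p • a + q • Q.J a)).toLinearMap (E'.φ _ (f.toLieEquiv x))
      = E'.φ _ (f.toLinearEquiv.conj (E.φ (p • a + q • Q.J a)).toLinearMap (f.toLieEquiv x))
    rw [hE', hconj, hconj, hE']
    congr 1
    rw [hE, hE]
    simp only [map_add, map_smul, hc₁₁, hc₁₂, hc₂₁, hc₂₂]
    module

end

/-! ### Extensions given by matrices -/

section

variable {G : Type*} [LieRing G] [LieAlgebra ℝ G]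

/-- The linear map from a coordinate Lie algebra sending the standard basis to four given
vectors. -/
def LieModel.frame (m : LieModel 4) (e₁ e₂ e₃ e₄ : G) : m.Alg →ₗ[ℝ] G where
  toFun x := m.vec.symm x 0 • e₁ + m.vec.symm x 1 • e₂ + m.vec.symm x 2 • e₃ + m.vec.symm x 3 • e₄
  map_add' x y := by simp only [map_add, Pi.add_apply]; module
  map_smul' t x := by simp only [map_smul, Pi.smul_apply, smul_eq_mul, RingHom.id_apply]; module

theorem LieModel.frame_vec (m : LieModel 4) (e₁ e₂ e₃ e₄ : G) (x₁ x₂ x₃ x₄ : ℝ) :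
    m.frame e₁ e₂ e₃ e₄ (m.vec ![x₁, x₂, x₃, x₄]) = x₁ • e₁ + x₂ • e₂ + x₃ • e₃ + x₄ • e₄ := rfl

variable [FiniteDimensional ℝ G] {H : Type*} [LieRing H] [LieAlgebra ℝ H]
  [IsLieAbelian H] {P : PseudoKahler G} {Q : PseudoKahler H}

theorem LieModel.finrank_alg {n : ℕ} (m : LieModel n) : Module.finrank ℝ m.Alg = n := by
  rw [← m.vec.finrank_eq]; simp

theorem LieModel.extension_φ_apply {m : LieModel 4} {P : PseudoKahler m.Alg}
    {g J M₁ M₂ : Matrix (Fin 4) (Fin 4) ℝ} {hg hJ hd₁ hd₂ hc hs h₁ h₂} (x : Fin 4 → ℝ) :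
    (m.extension P g J M₁ M₂ hg hJ hd₁ hd₂ hc hs h₁ h₂).φ ((abelian 2).vec ![1, 0]) (m.vec x)
      = m.vec (M₁.mulVec x) := by
  rw [LieModel.extension, pairExtension, pairHom_vec]
  simp only [Matrix.cons_val_zero, Matrix.cons_val_one, one_smul, zero_smul, add_zero]
  rfl

/-- Criterion for an extension to be AW-related to one in coordinates, in terms of the images of the
standard basis. -/
theorem awRelated_extension (E : PKExtension P Q) (hG : Module.finrank ℝ G = 4)
    (hH : Module.finrank ℝ H = 2) {m : LieModel 4} {P' : PseudoKahler m.Alg}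
    {g J M₁ M₂ : Matrix (Fin 4) (Fin 4) ℝ} {hg hJ hd₁ hd₂ hc hs h₁ h₂} (e₁ e₂ e₃ e₄ : G)
    (hlie : ∀ x y, m.frame e₁ e₂ e₃ e₄ (m.vec (m.br x y))
      = ⁅m.frame e₁ e₂ e₃ e₄ (m.vec x), m.frame e₁ e₂ e₃ e₄ (m.vec y)⁆)
    (hmet : ∀ x y, P.metric (m.frame e₁ e₂ e₃ e₄ (m.vec x)) (m.frame e₁ e₂ e₃ e₄ (m.vec y))
      = x ⬝ᵥ g.mulVec y)
    (hJe : ∀ x, m.frame e₁ e₂ e₃ e₄ (m.vec (J.mulVec x)) = P.J (m.frame e₁ e₂ e₃ e₄ (m.vec x)))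
    {a : H} (ha : Q.metric a a = 1) (D₁ D₂ : G →ₗ[ℝ] G)
    (hD₁ : ∀ x, m.frame e₁ e₂ e₃ e₄ (m.vec (M₁.mulVec x)) = D₁ (m.frame e₁ e₂ e₃ e₄ (m.vec x)))
    (hD₂ : ∀ x, m.frame e₁ e₂ e₃ e₄ (m.vec (M₂.mulVec x)) = D₂ (m.frame e₁ e₂ e₃ e₄ (m.vec x)))
    (hs₁ : ∀ x y, P.metric (E.φ a x - D₁ x) y + P.metric x (E.φ a y - D₁ y) = 0)
    (hs₂ : ∀ x y, P.metric (E.φ (Q.J a) x - D₂ x) y + P.metric x (E.φ (Q.J a) y - D₂ y) = 0)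
    (hc₁₁ : ∀ x, E.φ a (D₁ x) = D₁ (E.φ a x)) (hc₁₂ : ∀ x, E.φ a (D₂ x) = D₂ (E.φ a x))
    (hc₂₁ : ∀ x, E.φ (Q.J a) (D₁ x) = D₁ (E.φ (Q.J a) x))
    (hc₂₂ : ∀ x, E.φ (Q.J a) (D₂ x) = D₂ (E.φ (Q.J a) x)) :
    AWRelated E (m.extension P' g J M₁ M₂ hg hJ hd₁ hd₂ hc hs h₁ h₂) := by
  refine awRelated_of_linearMap E _ hH (by rw [hG, m.finrank_alg]) (m.frame e₁ e₂ e₃ e₄)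
    (fun x y => ?_) (fun x y => ?_) (fun x => ?_) ha D₁ D₂ (fun x => ?_) (fun x => ?_)
    hs₁ hs₂ hc₁₁ hc₁₂ hc₂₁ hc₂₂
  · obtain ⟨x, rfl⟩ := m.vec.surjective x
    obtain ⟨y, rfl⟩ := m.vec.surjective y
    rw [m.lie_vec, hlie]
  · obtain ⟨x, rfl⟩ := m.vec.surjective x
    obtain ⟨y, rfl⟩ := m.vec.surjective y
    rw [hmet, hg, m.form_vec]
  · obtain ⟨x, rfl⟩ := m.vec.surjective x
    rw [hJ, m.lin_vec, hJe]
  · obtain ⟨x, rfl⟩ := m.vec.surjective x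
    rw [← hD₁, LieModel.extension_φ_apply]
  · obtain ⟨x, rfl⟩ := m.vec.surjective x
    rw [← hD₂, LieModel.extension, pairExtension, pairHom_vec]
    simp only [Matrix.cons_val_zero, Matrix.cons_val_one, one_smul, zero_smul, zero_add]
    rfl

/-- Criterion for an extension to be isomorphic to one in coordinates. -/
theorem awRelated_extension_of_eq (E : PKExtension P Q) (hG : Module.finrank ℝ G = 4)
    (hH : Module.finrank ℝ H = 2) {m : LieModel 4} {P' : PseudoKahler m.Alg}
    {g J M₁ M₂ : Matrix (Fin 4) (Fin 4) ℝ} {hg hJ hd₁ hd₂ hc hs h₁ h₂} (e₁ e₂ e₃ e₄ : G)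
    (hlie : ∀ x y, m.frame e₁ e₂ e₃ e₄ (m.vec (m.br x y))
      = ⁅m.frame e₁ e₂ e₃ e₄ (m.vec x), m.frame e₁ e₂ e₃ e₄ (m.vec y)⁆)
    (hmet : ∀ x y, P.metric (m.frame e₁ e₂ e₃ e₄ (m.vec x)) (m.frame e₁ e₂ e₃ e₄ (m.vec y))
      = x ⬝ᵥ g.mulVec y)
    (hJe : ∀ x, m.frame e₁ e₂ e₃ e₄ (m.vec (J.mulVec x)) = P.J (m.frame e₁ e₂ e₃ e₄ (m.vec x)))
    {a : H} (ha : Q.metric a a = 1)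
    (hD₁ : ∀ x, m.frame e₁ e₂ e₃ e₄ (m.vec (M₁.mulVec x))
      = E.φ a (m.frame e₁ e₂ e₃ e₄ (m.vec x)))
    (hD₂ : ∀ x, m.frame e₁ e₂ e₃ e₄ (m.vec (M₂.mulVec x))
      = E.φ (Q.J a) (m.frame e₁ e₂ e₃ e₄ (m.vec x))) :
    AWRelated E (m.extension P' g J M₁ M₂ hg hJ hd₁ hd₂ hc hs h₁ h₂) :=
  awRelated_extension E hG hH e₁ e₂ e₃ e₄ hlie hmet hJe ha (E.φ a).toLinearMap
    (E.φ (Q.J a)).toLinearMap hD₁ hD₂ (fun x y => by simp) (fun x y => by simp)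
    (E.φ_commute a a) (E.φ_commute a _) (E.φ_commute _ a) (E.φ_commute _ _)

/-- If the symmetric part of `φ(a)` and the antisymmetric parts have compositions zero, the
extension is AW-related to the one given by the symmetric parts. -/
theorem awRelated_extension_sym (E : PKExtension P Q) (hG : Module.finrank ℝ G = 4)
    (hH : Module.finrank ℝ H = 2) {m : LieModel 4} {P' : PseudoKahler m.Alg}
    {g J M₁ M₂ : Matrix (Fin 4) (Fin 4) ℝ} {hg hJ hd₁ hd₂ hc hs h₁ h₂} (e₁ e₂ e₃ e₄ : G)
    (hlie : ∀ x y, m.frame e₁ e₂ e₃ e₄ (m.vec (m.br x y))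
      = ⁅m.frame e₁ e₂ e₃ e₄ (m.vec x), m.frame e₁ e₂ e₃ e₄ (m.vec y)⁆)
    (hmet : ∀ x y, P.metric (m.frame e₁ e₂ e₃ e₄ (m.vec x)) (m.frame e₁ e₂ e₃ e₄ (m.vec y))
      = x ⬝ᵥ g.mulVec y)
    (hJe : ∀ x, m.frame e₁ e₂ e₃ e₄ (m.vec (J.mulVec x)) = P.J (m.frame e₁ e₂ e₃ e₄ (m.vec x)))
    {a : H} (ha : Q.metric a a = 1)
    (hD₁ : ∀ x, m.frame e₁ e₂ e₃ e₄ (m.vec (M₁.mulVec x))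
      = E.sym a (m.frame e₁ e₂ e₃ e₄ (m.vec x)))
    (hD₂ : ∀ x, m.frame e₁ e₂ e₃ e₄ (m.vec (M₂.mulVec x))
      = E.sym (Q.J a) (m.frame e₁ e₂ e₃ e₄ (m.vec x)))
    (hSS : ∀ x, E.sym a (E.sym a x) = 0)
    (hSA : ∀ x, E.sym a (E.anti a x) = 0) (hSB : ∀ x, E.sym a (E.anti (Q.J a) x) = 0)
    (hAS : ∀ x, E.anti a (E.sym a x) = 0) (hBS : ∀ x, E.anti (Q.J a) (E.sym a x) = 0) :
    AWRelated E (m.extension P' g J M₁ M₂ hg hJ hd₁ hd₂ hc hs h₁ h₂) := by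
  refine awRelated_extension E hG hH e₁ e₂ e₃ e₄ hlie hmet hJe ha (E.sym a) (E.sym (Q.J a))
    hD₁ hD₂ (fun x y => ?_) (fun x y => ?_) (fun x => ?_) (fun x => ?_) (fun x => ?_) (fun x => ?_)
  · rw [E.φ_apply, E.φ_apply, add_sub_cancel_left, add_sub_cancel_left, E.anti_skew]
    ring
  · rw [E.φ_apply, E.φ_apply, add_sub_cancel_left, add_sub_cancel_left, E.anti_skew]
    ring
  all_goals
    simp only [E.φ_apply, map_add, E.sym_J, E.sym_J_right, E.anti_J, hSS, hSA, hSB, hAS, hBS,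
      map_zero, neg_zero, add_zero]

end

/-! ## The cases where the Lie algebra is forced to be abelian -/

section

variable {G : Type*} [LieRing G] [LieAlgebra ℝ G]

/-- Applying D² to a bracket gives [Dx, Dy] = -(c/2)[x, y]. Iterating, c²[x, y] = (c²/4)[x, y]. In
terms of eigenvalues: no sum of two square roots of c is again a square root of c. -/
theorem lie_eq_zero_of_derivation_sq (D : LieDerivation ℝ G G) {c : ℝ} (hc : c ≠ 0)
    (hD : ∀ x, D (D x) = c • x) (x y : G) : ⁅x, y⁆ = 0 := by
  have key : ∀ x y : G, ⁅D x, D y⁆ = (-c / 2) • ⁅x, y⁆ := fun x y => by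
    have h := hD ⁅x, y⁆
    simp only [LieDerivation.apply_lie_eq_add, map_add, hD, smul_lie, lie_smul] at h
    linear_combination (norm := module) (1 / 2 : ℝ) • h
  have h := key (D x) (D y)
  rw [hD, hD, key, smul_lie, lie_smul] at h
  have h2 : (c ^ 2 * (3 / 4)) • ⁅x, y⁆ = 0 := by linear_combination (norm := module) h
  exact (smul_eq_zero.1 h2).resolve_left (by positivity)

/-- Applying XY to a bracket gives [Xx, Yy] + [Yx, Xy] = -c[x, y]. Used at (Xx, Yy) and (Yx, Xy), it
yields [X²x, X²y] = -(c²/2)[x, y]; since X⁴ = c², iterating gives c⁴ = c⁴/4 on brackets. -/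
theorem lie_eq_zero_of_derivation_mul (X Y : LieDerivation ℝ G G) {c : ℝ} (hc : c ≠ 0)
    (hXX : ∀ x, X (X x) = Y (Y x)) (hXY : ∀ x, X (Y x) = c • x) (hYX : ∀ x, Y (X x) = c • x)
    (x y : G) : ⁅x, y⁆ = 0 := by
  have k1 : ∀ x y : G, ⁅X x, Y y⁆ + ⁅Y x, X y⁆ = -c • ⁅x, y⁆ := fun x y => by
    have h := hXY ⁅x, y⁆
    simp only [LieDerivation.apply_lie_eq_add, map_add, hXY, smul_lie, lie_smul] at h
    linear_combination (norm := module) h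
  have k2 : ∀ x y : G, ⁅X (X x), X (X y)⁆ = (-c ^ 2 / 2) • ⁅x, y⁆ := fun x y => by
    have h1 := k1 (X x) (Y y)
    have h2 := k1 (Y x) (X y)
    have h3 := k1 x y
    rw [hYX, hXY, ← hXX, smul_lie, lie_smul] at h1
    rw [hYX, hXY, ← hXX, smul_lie, lie_smul] at h2
    linear_combination (norm := module) (1 / 2 : ℝ) • h1 + (1 / 2 : ℝ) • h2 - (c / 2) • h3
  have h4 : ∀ x, X (X (X (X x))) = c ^ 2 • x := fun x => by
    rw [hXX x, hXY, map_smul, hXY, smul_smul, sq]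
  have h := k2 (X (X x)) (X (X y))
  rw [h4, h4, k2, smul_lie, lie_smul] at h
  have h2 : (c ^ 4 * (3 / 4)) • ⁅x, y⁆ = 0 := by linear_combination (norm := module) h
  exact (smul_eq_zero.1 h2).resolve_left (by positivity)

end

/-! ### The action of φ on the frame, and the cases κ ≠ 0 and α ≠ 0. -/

section

variable {G H : Type*} [LieRing G] [LieAlgebra ℝ G] [FiniteDimensional ℝ G] [LieRing H]
  [LieAlgebra ℝ H] {P : PseudoKahler G} {Q : PseudoKahler H}
  {E : PKExtension P Q} {a : H} {v w : G} {κ α₁ α₂ β β' : ℝ}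

namespace IsExtensionNormalForm

theorem φ_v (h : IsExtensionNormalForm E a v w κ α₁ α₂ β β') :
    E.φ a v = α₁ • v + α₂ • P.J v + (κ + κ * β') • P.J w := by
  rw [E.φ_apply, h.S_v, h.A_v]; module

theorem φ_Jv (h : IsExtensionNormalForm E a v w κ α₁ α₂ β β') :
    E.φ a (P.J v) = -α₂ • v + α₁ • P.J v + (κ - κ * β') • w := by
  rw [E.φ_apply, E.sym_J_right, E.anti_J, h.S_v, h.A_v]
  simp only [map_add, map_smul, P.J_sq]
  module

theorem φ_w (h : IsExtensionNormalForm E a v w κ α₁ α₂ β β') :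
    E.φ a w = v + β • P.J v - α₁ • w + α₂ • P.J w := by
  rw [E.φ_apply, h.S_w, h.A_w]; module

theorem φ_Jw (h : IsExtensionNormalForm E a v w κ α₁ α₂ β β') :
    E.φ a (P.J w) = -β • v - P.J v - α₂ • w - α₁ • P.J w := by
  rw [E.φ_apply, E.sym_J_right, E.anti_J, h.S_w, h.A_w]
  simp only [map_add, map_sub, map_smul, P.J_sq]
  module

theorem φJ_v (h : IsExtensionNormalForm E a v w κ α₁ α₂ β β') :
    E.φ (Q.J a) v = -α₂ • v + α₁ • P.J v - κ • w - (κ * β) • P.J w := by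
  rw [E.φ_J_apply, h.S_v, h.B_v]
  simp only [map_smul, P.J_sq]
  module

theorem φJ_Jv (h : IsExtensionNormalForm E a v w κ α₁ α₂ β β') :
    E.φ (Q.J a) (P.J v) = -α₁ • v - α₂ • P.J v + (κ * β) • w + κ • P.J w := by
  rw [E.φ_J_apply, E.sym_J_right, E.anti_J, h.S_v, h.B_v]
  simp only [map_add, map_sub, map_neg, map_smul, P.J_sq]
  module

theorem φJ_w (h : IsExtensionNormalForm E a v w κ α₁ α₂ β β') :
    E.φ (Q.J a) w = (1 + β') • P.J v + α₂ • w + α₁ • P.J w := by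
  rw [E.φ_J_apply, h.S_w, h.B_w]
  module

theorem φJ_Jw (h : IsExtensionNormalForm E a v w κ α₁ α₂ β β') :
    E.φ (Q.J a) (P.J w) = (1 - β') • v - α₁ • w + α₂ • P.J w := by
  rw [E.φ_J_apply, E.sym_J_right, E.anti_J, h.S_w, h.B_w]
  simp only [map_add, map_neg, map_smul, P.J_sq]
  module

variable [IsLieAbelian H]

theorem awRelated_r4Semisimple (h : IsExtensionNormalForm E a v w κ α₁ α₂ β β') (hκ : κ ≠ 0)
    (hG : Module.finrank ℝ G = 4) (hH : Module.finrank ℝ H = 2) :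
    ∃ t : ℝ, 0 < t ∧ AWRelated E (r4Semisimple t) := by
  obtain rfl : α₁ = 0 := (mul_eq_zero.1 h.κ_α₁).resolve_left hκ
  obtain rfl : α₂ = 0 := (mul_eq_zero.1 h.κ_α₂).resolve_left hκ
  have hβ : β ^ 2 + β' ^ 2 = 2 := mul_left_cancel₀ hκ (by rw [h.κ_β]; ring)
  -- The number β + iβ' has modulus √2; this phase turns it into 1 - i.
  obtain ⟨v, w, h⟩ := h.rotate (c := (β - β') / 2) (s := (β + β') / 2)
    (by linear_combination (1 / 2 : ℝ) * hβ)
  generalize ((β - β') / 2) • a + ((β + β') / 2) • Q.J a = a at h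
  have e1 : (β - β') / 2 * β + (β + β') / 2 * β' = 1 := by linear_combination (1 / 2 : ℝ) * hβ
  have e2 : (β - β') / 2 * β' - (β + β') / 2 * β = -1 := by linear_combination -(1 / 2 : ℝ) * hβ
  rw [e1, e2] at h
  simp only [mul_zero, sub_zero, add_zero] at h
  set ρ : ℝ := √2 / 2
  have hρ : ρ ^ 2 = 1 / 2 := by
    rw [div_pow, Real.sq_sqrt two_pos.le]; norm_num
  have hρ0 : 0 < ρ := by positivity
  have hκ0 : 0 < κ := lt_of_le_of_ne h.κ_nonneg hκ.symm
  -- In the model with parameter t the matrices of φ(a₁) and φ(a₂) have product 2t², whereas here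
  -- the product is κ. The lengths x, y rescale w and v: xy = 2 makes the frame orthonormal up to
  -- sign, and ρx = ty, ρκy = tx give the entries of the model.
  set t := √(κ / 2)
  have ht0 : 0 < t := Real.sqrt_pos.2 (by positivity)
  have ht : t ^ 2 = κ / 2 := Real.sq_sqrt (by positivity)
  set y := √(2 * ρ / t)
  have hy : y ^ 2 = 2 * ρ / t := Real.sq_sqrt (by positivity)
  obtain ⟨x, hx⟩ : ∃ x, ρ * x = t * y := ⟨t * y / ρ, by field_simp⟩
  have hxy : x * y = 2 := by
    have h1 : ρ * (x * y) = ρ * 2 := by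
      rw [← mul_assoc, hx, mul_assoc, ← sq, hy]
      field_simp
    exact mul_left_cancel₀ hρ0.ne' h1
  have hy' : ρ * κ * y = t * x := by
    have h1 : ρ * (ρ * κ * y) = ρ * (t * x) := by
      linear_combination κ * y * hρ - t * hx - y * ht
    exact mul_left_cancel₀ hρ0.ne' h1
  -- A further turn by -π/4. The derivations X = φ(b) and Y = φ(Jb) satisfy X² = Y² and XY = YX = κ.
  set b := ρ • a + (-ρ) • Q.J a with hb
  have hb1 : Q.metric b b = 1 := by
    simp only [hb, map_add, map_smul, LinearMap.add_apply, LinearMap.smul_apply, smul_eq_mul,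
      Q.compat, Q.metric_J_self, Q.metric_self_J, h.unit]
    linear_combination 2 * hρ
  have hX : ∀ z, E.φ b z = ρ • (E.φ a z - E.φ (Q.J a) z) := fun z => by
    rw [hb, map_add, map_smul, map_smul, LieDerivation.add_apply, LieDerivation.smul_apply,
      LieDerivation.smul_apply]
    module
  have hY : ∀ z, E.φ (Q.J b) z = ρ • (E.φ a z + E.φ (Q.J a) z) := fun z => by
    rw [hb, map_add, map_smul, map_smul, Q.J_sq, map_add, map_smul, map_smul, map_neg,
      LieDerivation.add_apply, LieDerivation.smul_apply, LieDerivation.smul_apply,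
      LieDerivation.neg_apply]
    module
  clear_value b
  have Xv : E.φ b v = (ρ * κ) • (w + P.J w) := by rw [hX, h.φ_v, h.φJ_v]; module
  have XJv : E.φ b (P.J v) = (ρ * κ) • (w - P.J w) := by rw [hX, h.φ_Jv, h.φJ_Jv]; module
  have Xw : E.φ b w = ρ • (v + P.J v) := by rw [hX, h.φ_w, h.φJ_w]; module
  have XJw : E.φ b (P.J w) = -ρ • ((3 : ℝ) • v + P.J v) := by rw [hX, h.φ_Jw, h.φJ_Jw]; module
  have Yv : E.φ (Q.J b) v = -(ρ * κ) • (w + P.J w) := by rw [hY, h.φ_v, h.φJ_v]; module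
  have YJv : E.φ (Q.J b) (P.J v) = (ρ * κ) • ((3 : ℝ) • w + P.J w) := by
    rw [hY, h.φ_Jv, h.φJ_Jv]; module
  have Yw : E.φ (Q.J b) w = ρ • (v + P.J v) := by rw [hY, h.φ_w, h.φJ_w]; module
  have YJw : E.φ (Q.J b) (P.J w) = ρ • (v - P.J v) := by rw [hY, h.φ_Jw, h.φJ_Jw]; module
  have hab : ∀ z z' : G, ⁅z, z'⁆ = 0 := by
    refine lie_eq_zero_of_derivation_mul (E.φ b) (E.φ (Q.J b)) hκ (fun z => ?_) (fun z => ?_)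
      (fun z => ?_) <;>
    obtain ⟨p, q, r, s, rfl⟩ := h.exists_eq_comb hG z <;>
    simp only [map_add, map_sub, map_smul, Xv, XJv, Xw, XJw, Yv, YJv, Yw, YJw]
    · module
    · linear_combination (norm := module) (2 * κ * hρ) • (p • v + q • P.J v + r • w + s • P.J w)
    · linear_combination (norm := module) (2 * κ * hρ) • (p • v + q • P.J v + r • w + s • P.J w)
  obtain ⟨e₁, he₁⟩ : ∃ e₁, e₁ = (y / 2) • v + (x / 2) • w := ⟨_, rfl⟩
  obtain ⟨e₂, he₂⟩ : ∃ e₂, e₂ = (y / 2) • P.J v - (x / 2) • P.J w := ⟨_, rfl⟩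
  obtain ⟨e₃, he₃⟩ : ∃ e₃, e₃ = (y / 2) • P.J v + (x / 2) • P.J w := ⟨_, rfl⟩
  obtain ⟨e₄, he₄⟩ : ∃ e₄, e₄ = -(y / 2) • v + (x / 2) • w := ⟨_, rfl⟩
  have X₁ : E.φ b e₁ = t • e₁ + t • e₃ := by
    simp only [he₁, he₃, map_add, map_smul, Xv, Xw]
    linear_combination (norm := module) (hx / 2) • (v + P.J v) + (hy' / 2) • (w + P.J w)
  have X₂ : E.φ b e₂ = (2 * t) • e₁ + t • e₂ - t • e₄ := by
    simp only [he₁, he₂, he₄, map_sub, map_smul, XJv, XJw]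
    linear_combination (norm := module) (hx / 2) • ((3 : ℝ) • v + P.J v)
      + (hy' / 2) • (w - P.J w)
  have X₃ : E.φ b e₃ = -t • e₁ - t • e₃ + (2 * t) • e₄ := by
    simp only [he₁, he₃, he₄, map_add, map_smul, XJv, XJw]
    linear_combination (norm := module) -(hx / 2) • ((3 : ℝ) • v + P.J v)
      + (hy' / 2) • (w - P.J w)
  have X₄ : E.φ b e₄ = t • e₂ - t • e₄ := by
    simp only [he₂, he₄, map_add, map_smul, Xv, Xw]
    linear_combination (norm := module) (hx / 2) • (v + P.J v) - (hy' / 2) • (w + P.J w)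
  have Y₁ : E.φ (Q.J b) e₁ = t • e₂ - t • e₄ := by
    simp only [he₁, he₂, he₄, map_add, map_smul, Yv, Yw]
    linear_combination (norm := module) (hx / 2) • (v + P.J v) - (hy' / 2) • (w + P.J w)
  have Y₂ : E.φ (Q.J b) e₂ = t • e₁ + t • e₃ + (2 * t) • e₄ := by
    simp only [he₁, he₂, he₃, he₄, map_sub, map_smul, YJv, YJw]
    linear_combination (norm := module) -(hx / 2) • (v - P.J v)
      + (hy' / 2) • ((3 : ℝ) • w + P.J w)
  have Y₃ : E.φ (Q.J b) e₃ = (2 * t) • e₁ - t • e₂ + t • e₄ := by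
    simp only [he₁, he₂, he₃, he₄, map_add, map_smul, YJv, YJw]
    linear_combination (norm := module) (hx / 2) • (v - P.J v)
      + (hy' / 2) • ((3 : ℝ) • w + P.J w)
  have Y₄ : E.φ (Q.J b) e₄ = t • e₁ + t • e₃ := by
    simp only [he₁, he₃, he₄, map_add, map_smul, Yv, Yw]
    linear_combination (norm := module) (hx / 2) • (v + P.J v) + (hy' / 2) • (w + P.J w)
  refine ⟨t, ht0, awRelated_extension_of_eq E hG hH e₁ e₂ e₃ e₄ (fun _ _ => ?_)
    (forall_four fun x₁ x₂ x₃ x₄ => forall_four fun y₁ y₂ y₃ y₄ => ?_)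
    (forall_four fun _ _ _ _ => ?_) hb1 (forall_four fun _ _ _ _ => ?_)
    (forall_four fun _ _ _ _ => ?_)⟩
  · rw [hab]
    exact map_zero _
  · simp only [LieModel.frame_vec, mulVec_four, dotProduct_four, he₁, he₂, he₃, he₄]
    simp only [map_add, map_sub, map_smul, LinearMap.add_apply, LinearMap.sub_apply,
      LinearMap.smul_apply, smul_eq_mul, P.compat,
      P.metric_J_self, P.metric_self_J, h.vv, h.ww, h.vw, h.v_Jw, h.wv, h.Jv_w, h.Jw_v, h.w_Jv]
    linear_combination (x₁ * y₁ - x₂ * y₂ + x₃ * y₃ - x₄ * y₄) / 2 * hxy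
  · simp only [LieModel.frame_vec, mulVec_four, he₁, he₂, he₃, he₄, map_add, map_sub, map_smul,
      P.J_sq]
    module
  · simp only [LieModel.frame_vec, mulVec_four, map_add, map_smul, X₁, X₂, X₃, X₄]
    module
  · simp only [LieModel.frame_vec, mulVec_four, map_add, map_smul, Y₁, Y₂, Y₃, Y₄]
    module

theorem awRelated_r4NonSemisimple (h : IsExtensionNormalForm E a v w 0 α₁ α₂ β β')
    (hα : α₁ ^ 2 + α₂ ^ 2 ≠ 0)
    (hG : Module.finrank ℝ G = 4) (hH : Module.finrank ℝ H = 2) :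
    ∃ b c : ℝ, c ≠ 0 ∧ AWRelated E (r4NonSemisimple 1 b c) := by
  set c := √(α₁ ^ 2 + α₂ ^ 2)
  have hc : c ^ 2 = α₁ ^ 2 + α₂ ^ 2 := Real.sq_sqrt (by positivity)
  have hc0 : c ≠ 0 := fun h0 => hα (by rw [← hc, h0]; ring)
  -- The phase ᾱ/|α| turns α into c = |α|. The constraint Im(αb) = 0 then gives β' = 0, and φ(a)² =
  -- c².
  obtain ⟨v, w, h⟩ := h.rotate (c := α₁ / c) (s := -α₂ / c)
    (by field_simp; linear_combination -hc)
  generalize (α₁ / c) • a + (-α₂ / c) • Q.J a = a at h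
  have e1 : α₁ / c * α₁ - -α₂ / c * α₂ = c := by field_simp; linear_combination -hc
  have e2 : α₁ / c * α₂ + -α₂ / c * α₁ = 0 := by ring
  rw [e1, e2] at h
  generalize α₁ / c * β + -α₂ / c * β' = b at h
  generalize α₁ / c * β' - -α₂ / c * β = b' at h
  obtain rfl : b' = 0 := by
    have := h.α_β
    rw [mul_zero, add_zero] at this
    exact (mul_eq_zero.1 this).resolve_right hc0
  have hab : ∀ z z' : G, ⁅z, z'⁆ = 0 := by
    refine lie_eq_zero_of_derivation_sq (E.φ a) (pow_ne_zero 2 hc0) (fun z => ?_)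
    obtain ⟨p, q, r, s, rfl⟩ := h.exists_eq_comb hG z
    simp only [map_add, map_sub, map_smul, h.φ_v, h.φ_Jv, h.φ_w, h.φ_Jw]
    module
  -- The vectors v/2 ± w have square length ±1. This scaling realises the parameter value 1 of the
  -- family.
  obtain ⟨e₁, he₁⟩ : ∃ e₁, e₁ = (1 / 2 : ℝ) • v + w := ⟨_, rfl⟩
  obtain ⟨e₂, he₂⟩ : ∃ e₂, e₂ = (1 / 2 : ℝ) • v - w := ⟨_, rfl⟩
  refine ⟨b, c, hc0, awRelated_extension_of_eq E hG hH e₁ e₂ (P.J e₁) (P.J e₂) (fun _ _ => ?_)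
    (forall_four fun _ _ _ _ => forall_four fun _ _ _ _ => ?_)
    (forall_four fun _ _ _ _ => ?_) h.unit (forall_four fun _ _ _ _ => ?_)
    (forall_four fun _ _ _ _ => ?_)⟩
  · rw [hab]
    exact map_zero _
  · simp only [LieModel.frame_vec, mulVec_four, dotProduct_four, he₁, he₂]
    simp only [map_add, map_sub, map_smul, LinearMap.add_apply, LinearMap.sub_apply,
      LinearMap.smul_apply, smul_eq_mul, P.compat,
      P.metric_J_self, P.metric_self_J, h.vv, h.ww, h.vw, h.v_Jw, h.wv, h.Jv_w, h.Jw_v, h.w_Jv]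
    ring
  · simp only [LieModel.frame_vec, mulVec_four, map_add, map_smul, P.J_sq]
    module
  · simp only [LieModel.frame_vec, mulVec_four, he₁, he₂, map_add, map_sub, map_smul, h.φ_v,
      h.φ_Jv, h.φ_w, h.φ_Jw]
    module
  · simp only [LieModel.frame_vec, mulVec_four, he₁, he₂, map_add, map_sub, map_smul, h.φJ_v,
      h.φJ_Jv, h.φJ_w, h.φJ_Jw]
    module

end IsExtensionNormalForm

end

/-! ## The nilpotent case -/

/-- The relations `y`, `n`, `c` (derivation φ(Ja), integrability, closedness) are linear and leave
four free parameters m₁, m₂, η₁, η₂. The Jacobi relations then force (η₁² + η₂²)² = 0, so [w, Jw]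
has no component along w, Jw. -/
theorem nilpotent_structure_constants {p₁ p₂ p₃ p₄ q₁ q₂ q₃ q₄ η₁ η₂ : ℝ}
    (y₁ : η₂ = p₁ - q₃) (y₂ : η₁ = p₂ - q₄)
    (n₁ : q₃ - p₁ + (q₂ + p₄) = 0) (n₂ : q₄ - p₂ - (q₁ + p₃) = 0)
    (c₁ : -η₂ - q₂ - p₁ = 0) (c₂ : η₁ - q₄ - p₃ = 0)
    (j₁ : η₁ * p₁ + η₂ * q₁ = q₂ * p₃ - p₂ * q₃)
    (j₂ : η₁ * p₂ + η₂ * q₂ = q₁ * p₂ + q₂ * p₄ - p₁ * q₂ - p₂ * q₄)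
    (j₃ : η₁ * p₃ + η₂ * q₃ = q₃ * p₁ + q₄ * p₃ - p₃ * q₁ - p₄ * q₃)
    (j₄ : η₁ * p₄ + η₂ * q₄ = q₃ * p₂ - p₃ * q₂) :
    η₁ = 0 ∧ η₂ = 0 ∧ p₃ = -p₂ ∧ p₄ = p₁ ∧ q₁ = p₂ ∧ q₂ = -p₁ ∧ q₃ = p₁ ∧ q₄ = p₂ := by
  obtain ⟨m₁, hm₁⟩ : ∃ m₁, m₁ = p₁ + η₂ := ⟨_, rfl⟩
  obtain ⟨m₂, hm₂⟩ : ∃ m₂, m₂ = p₂ - η₁ := ⟨_, rfl⟩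
  obtain rfl : p₁ = m₁ - η₂ := by linarith
  obtain rfl : p₂ = m₂ + η₁ := by linarith
  obtain rfl : p₃ = η₁ - m₂ := by linarith
  obtain rfl : p₄ = m₁ + η₂ := by linarith
  obtain rfl : q₁ = m₂ - 2 * η₁ := by linarith
  obtain rfl : q₂ = -m₁ := by linarith
  obtain rfl : q₃ = m₁ - 2 * η₂ := by linarith
  obtain rfl : m₂ = q₄ := by linarith
  -- Jacobi reduces to one scalar relation `hL` and a linear system `hA₁`, `hA₂` of determinant
  -- -(η₁² + η₂²) in 3η₂ - 2m₁ and 2m₂ + η₁. Solving the system and inserting it in `hL` leaves only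
  -- |η|⁴.
  have hL : η₁ * m₂ - η₂ * m₁ + η₂ ^ 2 + 2 * (η₁ ^ 2 + η₂ ^ 2) = 0 := by
    linear_combination (j₂ - j₃) / 2
  have hA₁ : η₁ * (3 * η₂ - 2 * m₁) + η₂ * (2 * m₂ + η₁) = 0 := by
    linear_combination -(j₁ - j₄) / 2
  have hA₂ : η₂ * (3 * η₂ - 2 * m₁) - η₁ * (2 * m₂ + η₁) = 0 := by
    linear_combination -(j₂ + j₃) / 2
  have hN : (η₁ ^ 2 + η₂ ^ 2) ^ 2 = 0 := by
    have k₁ : (η₁ ^ 2 + η₂ ^ 2) * (3 * η₂ - 2 * m₁) = 0 := by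
      linear_combination η₁ * hA₁ + η₂ * hA₂
    have k₂ : (η₁ ^ 2 + η₂ ^ 2) * (2 * m₂ + η₁) = 0 := by
      linear_combination η₂ * hA₁ - η₁ * hA₂
    linear_combination (2 / 3) * (η₁ ^ 2 + η₂ ^ 2) * hL - (1 / 3) * η₁ * k₂ - (1 / 3) * η₂ * k₁
  have hN' : η₁ ^ 2 + η₂ ^ 2 = 0 := pow_eq_zero_iff two_ne_zero |>.1 hN
  have h₁ : η₁ = 0 := by nlinarith [sq_nonneg η₁, sq_nonneg η₂]
  have h₂ : η₂ = 0 := by nlinarith [sq_nonneg η₁, sq_nonneg η₂]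
  subst h₁ h₂
  refine ⟨rfl, rfl, ?_, ?_, ?_, ?_, ?_, ?_⟩ <;> ring

section

variable {G H : Type*} [LieRing G] [LieAlgebra ℝ G] [FiniteDimensional ℝ G] [LieRing H]
  [LieAlgebra ℝ H] {P : PseudoKahler G} {Q : PseudoKahler H}
  {E : PKExtension P Q} {a : H} {v w : G} {β β' : ℝ}

namespace IsExtensionNormalForm

/-- As β' = 0, the derivation Y = φ(Ja) has Y² = 0 and kernel ⟨v, Jv⟩, which confines every bracket
with v or Jv to that plane. There w acts as m = m₁ + im₂ and Jw as -im; the derivation φ(a) adds βm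
= 0. -/
theorem exists_lie_eq (h : IsExtensionNormalForm E a v w 0 0 0 β 0)
    (hG : Module.finrank ℝ G = 4) : ∃ m₁ m₂ ζ₁ ζ₂ : ℝ, ⁅v, P.J v⁆ = 0 ∧
      ⁅w, v⁆ = m₁ • v + m₂ • P.J v ∧ ⁅w, P.J v⁆ = -m₂ • v + m₁ • P.J v ∧
      ⁅P.J w, v⁆ = m₂ • v - m₁ • P.J v ∧ ⁅P.J w, P.J v⁆ = m₁ • v + m₂ • P.J v ∧
      ⁅w, P.J w⁆ = ζ₁ • v + ζ₂ • P.J v ∧ β * m₁ = 0 ∧ β * m₂ = 0 := by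
  have hp := h.toIsHyperbolicPair
  have Xv : E.φ a v = 0 := by rw [h.φ_v]; module
  have XJv : E.φ a (P.J v) = 0 := by rw [h.φ_Jv]; module
  have Xw : E.φ a w = v + β • P.J v := by rw [h.φ_w]; module
  have XJw : E.φ a (P.J w) = -β • v - P.J v := by rw [h.φ_Jw]; module
  have Yv : E.φ (Q.J a) v = 0 := by rw [h.φJ_v]; module
  have YJv : E.φ (Q.J a) (P.J v) = 0 := by rw [h.φJ_Jv]; module
  have Yw : E.φ (Q.J a) w = P.J v := by rw [h.φJ_w]; module
  have YJw : E.φ (Q.J a) (P.J w) = v := by rw [h.φJ_Jw]; module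
  have Ycomb : ∀ p q r s : ℝ, E.φ (Q.J a) (p • v + q • P.J v + r • w + s • P.J w)
      = s • v + r • P.J v := fun p q r s => by
    simp only [map_add, map_smul, Yv, YJv, Yw, YJw]
    module
  have hYY : ∀ x, E.φ (Q.J a) (E.φ (Q.J a) x) = 0 := fun x => by
    obtain ⟨p, q, r, s, rfl⟩ := hp.exists_eq_comb hG x
    rw [Ycomb]
    simp only [map_add, map_smul, Yv, YJv, smul_zero, add_zero]
  have hker : ∀ x, E.φ (Q.J a) x = 0 → ∃ p q : ℝ, x = p • v + q • P.J v := fun x hx => by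
    obtain ⟨p, q, r, s, rfl⟩ := hp.exists_eq_comb hG x
    rw [Ycomb] at hx
    obtain ⟨rfl, rfl, -, -⟩ := hp.comb_eq_zero (p := s) (q := r) (r := 0) (s := 0)
      (by rw [← hx]; module)
    exact ⟨p, q, by module⟩
  -- By the Leibniz rule 0 = Y²[Jw, w] = 2[YJw, Yw] = 2[v, Jv].
  have hvv : ⁅v, P.J v⁆ = 0 := by
    have h1 := hYY ⁅P.J w, w⁆
    simp only [LieDerivation.apply_lie_eq_add, map_add, YJw, Yw, Yv, YJv, lie_zero, zero_lie] at h1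
    have h2 : (2 : ℝ) • ⁅v, P.J v⁆ = 0 := by linear_combination (norm := module) h1
    exact (smul_eq_zero.1 h2).resolve_left two_ne_zero
  have hvv' : ⁅P.J v, v⁆ = 0 := by rw [← lie_skew, hvv, neg_zero]
  obtain ⟨p₁, p₂, hwv⟩ := hker ⁅w, v⁆ (by
    rw [LieDerivation.apply_lie_eq_add, Yv, Yw, hvv', lie_zero, zero_add])
  obtain ⟨p₃, p₄, hwJv⟩ := hker ⁅w, P.J v⁆ (by
    rw [LieDerivation.apply_lie_eq_add, YJv, Yw, lie_self, lie_zero, zero_add])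
  obtain ⟨q₁, q₂, hJwv⟩ := hker ⁅P.J w, v⁆ (by
    rw [LieDerivation.apply_lie_eq_add, Yv, YJw, lie_self, lie_zero, zero_add])
  obtain ⟨q₃, q₄, hJwJv⟩ := hker ⁅P.J w, P.J v⁆ (by
    rw [LieDerivation.apply_lie_eq_add, YJv, YJw, hvv, lie_zero, zero_add])
  obtain ⟨ζ₁, ζ₂, η₁, η₂, hww⟩ := hp.exists_eq_comb hG ⁅w, P.J w⁆
  have sJwv : ⁅v, P.J w⁆ = -(q₁ • v + q₂ • P.J v) := by rw [← hJwv, lie_skew]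
  have sJwJv : ⁅P.J v, P.J w⁆ = -(q₃ • v + q₄ • P.J v) := by rw [← hJwJv, lie_skew]
  have swv : ⁅v, w⁆ = -(p₁ • v + p₂ • P.J v) := by rw [← hwv, lie_skew]
  have swJv : ⁅P.J v, w⁆ = -(p₃ • v + p₄ • P.J v) := by rw [← hwJv, lie_skew]
  have dY := (E.φ (Q.J a)).apply_lie_eq_add w (P.J w)
  rw [hww, Ycomb, Yw, YJw, hwv, sJwJv] at dY
  obtain ⟨y₁, y₂, -, -⟩ := hp.comb_eq_zero (p := η₂ - (p₁ - q₃)) (q := η₁ - (p₂ - q₄)) (r := 0)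
    (s := 0) (by linear_combination (norm := module) dY)
  have dX := (E.φ a).apply_lie_eq_add w (P.J w)
  rw [hww] at dX
  simp only [Xw, XJw, map_add, map_smul, Xv, XJv, lie_sub, lie_smul, add_lie, smul_lie, hwv, hwJv,
    sJwv, sJwJv] at dX
  obtain ⟨x₁, x₂, -, -⟩ := hp.comb_eq_zero
    (p := η₁ - η₂ * β + q₁ + β * q₃ + β * p₁ + p₃)
    (q := η₁ * β - η₂ + q₂ + β * q₄ + β * p₂ + p₄) (r := 0)
    (s := 0) (by linear_combination (norm := module) dX)
  have dN := P.integrable w v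
  rw [hJwJv, hwv, hJwv, hwJv] at dN
  simp only [map_add, map_smul, P.J_sq] at dN
  obtain ⟨n₁, n₂, -, -⟩ := hp.comb_eq_zero (p := q₃ - p₁ + (q₂ + p₄)) (q := q₄ - p₂ - (q₁ + p₃))
    (r := 0) (s := 0) (by linear_combination (norm := module) dN)
  have c₁ := P.closed w (P.J w) v
  have c₂ := P.closed w (P.J w) (P.J v)
  rw [hww, hJwv, swv] at c₁
  rw [hww, hJwJv, swJv] at c₂
  simp only [PseudoHermitian.omega, map_add, map_neg, map_smul, LinearMap.add_apply,
    LinearMap.neg_apply, LinearMap.smul_apply, smul_eq_mul, P.J_sq, P.compat, P.metric_J_self,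
    P.metric_self_J, hp.vv, hp.vw, hp.v_Jw, hp.wv, hp.Jv_w, hp.Jw_v, hp.w_Jv] at c₁ c₂
  have d₁ := lie_lie w (P.J w) v
  have d₂ := lie_lie w (P.J w) (P.J v)
  rw [hww] at d₁ d₂
  simp only [add_lie, smul_lie, lie_add, lie_smul, hwv, hwJv, hJwv, hJwJv, hvv, hvv', lie_self]
    at d₁ d₂
  obtain ⟨j₁, j₂, -, -⟩ := hp.comb_eq_zero
    (p := η₁ * p₁ + η₂ * q₁ - (q₂ * p₃ - p₂ * q₃))
    (q := η₁ * p₂ + η₂ * q₂ - (q₁ * p₂ + q₂ * p₄ - p₁ * q₂ - p₂ * q₄)) (r := 0)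
    (s := 0) (by linear_combination (norm := module) d₁)
  obtain ⟨j₃, j₄, -, -⟩ := hp.comb_eq_zero
    (p := η₁ * p₃ + η₂ * q₃ - (q₃ * p₁ + q₄ * p₃ - p₃ * q₁ - p₄ * q₃))
    (q := η₁ * p₄ + η₂ * q₄ - (q₃ * p₂ - p₃ * q₂)) (r := 0)
    (s := 0) (by linear_combination (norm := module) d₂)
  obtain ⟨rfl, rfl, rfl, rfl, rfl, rfl, rfl, rfl⟩ := nilpotent_structure_constants
    (sub_eq_zero.1 y₁) (sub_eq_zero.1 y₂) n₁ n₂ (by linarith) (by linarith) (sub_eq_zero.1 j₁)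
    (sub_eq_zero.1 j₂) (sub_eq_zero.1 j₃) (sub_eq_zero.1 j₄)
  refine ⟨_, _, ζ₁, ζ₂, hvv, hwv, hwJv, hJwv.trans (by module), hJwJv, hww.trans (by module),
    by linarith, by linarith⟩

/-- Each of S, A, B kills ⟨v, Jv⟩ and has image in it. Hence the skew parts commute with the
symmetric ones and can be dropped up to AW-relation, whatever β and β' are. -/
theorem sym_anti_comp (h : IsExtensionNormalForm E a v w 0 0 0 β β')
    (hG : Module.finrank ℝ G = 4) (x : G) : E.sym a (E.sym a x) = 0 ∧
      E.sym a (E.anti a x) = 0 ∧ E.sym a (E.anti (Q.J a) x) = 0 ∧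
      E.anti a (E.sym a x) = 0 ∧ E.anti (Q.J a) (E.sym a x) = 0 := by
  obtain ⟨p, q, r, s, rfl⟩ := h.exists_eq_comb hG x
  refine ⟨?_, ?_, ?_, ?_, ?_⟩ <;>
  simp only [map_add, map_sub, map_neg, map_smul, E.sym_J_right, E.anti_J, h.S_v, h.S_w, h.A_v,
    h.A_w, h.B_v, h.B_w, P.J_sq] <;> module

variable [IsLieAbelian H]

theorem awRelated_r4NonSemisimple_zero (h : IsExtensionNormalForm E a v w 0 0 0 β β')
    (hab : ∀ z z' : G, ⁅z, z'⁆ = 0)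
    (hG : Module.finrank ℝ G = 4) (hH : Module.finrank ℝ H = 2) :
    AWRelated E (r4NonSemisimple 1 0 0) := by
  obtain ⟨e₁, he₁⟩ : ∃ e₁, e₁ = (1 / 2 : ℝ) • v + w := ⟨_, rfl⟩
  obtain ⟨e₂, he₂⟩ : ∃ e₂, e₂ = (1 / 2 : ℝ) • v - w := ⟨_, rfl⟩
  refine awRelated_extension_sym E hG hH e₁ e₂ (P.J e₁) (P.J e₂) (fun _ _ => ?_)
    (forall_four fun _ _ _ _ => forall_four fun _ _ _ _ => ?_)
    (forall_four fun _ _ _ _ => ?_) h.unit (forall_four fun _ _ _ _ => ?_)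
    (forall_four fun _ _ _ _ => ?_) (fun x => (h.sym_anti_comp hG x).1)
    (fun x => (h.sym_anti_comp hG x).2.1) (fun x => (h.sym_anti_comp hG x).2.2.1)
    (fun x => (h.sym_anti_comp hG x).2.2.2.1) (fun x => (h.sym_anti_comp hG x).2.2.2.2)
  · rw [hab]
    exact map_zero _
  · simp only [LieModel.frame_vec, mulVec_four, dotProduct_four, he₁, he₂]
    simp only [map_add, map_sub, map_smul, LinearMap.add_apply, LinearMap.sub_apply,
      LinearMap.smul_apply, smul_eq_mul, P.compat,
      P.metric_J_self, P.metric_self_J, h.vv, h.ww, h.vw, h.v_Jw, h.wv, h.Jv_w, h.Jw_v, h.w_Jv]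
    ring
  · simp only [LieModel.frame_vec, mulVec_four, map_add, map_smul, P.J_sq]
    module
  · simp only [LieModel.frame_vec, mulVec_four, he₁, he₂, map_add, map_sub, map_smul,
      E.sym_J_right, h.S_v, h.S_w]
    module
  · simp only [LieModel.frame_vec, mulVec_four, he₁, he₂, map_add, map_sub, map_smul, map_neg,
      E.sym_J, E.sym_J_right, h.S_v, h.S_w, P.J_sq]
    module

theorem awRelated_rh3 (h : IsExtensionNormalForm E a v w 0 0 0 β β') {ζ₁ ζ₂ : ℝ}
    (hζ : ζ₁ ^ 2 + ζ₂ ^ 2 ≠ 0) (hvv : ⁅v, P.J v⁆ = 0) (hwv : ⁅w, v⁆ = 0) (hwJv : ⁅w, P.J v⁆ = 0)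
    (hJwv : ⁅P.J w, v⁆ = 0) (hJwJv : ⁅P.J w, P.J v⁆ = 0)
    (hww : ⁅w, P.J w⁆ = ζ₁ • v + ζ₂ • P.J v)
    (hG : Module.finrank ℝ G = 4) (hH : Module.finrank ℝ H = 2) :
    ∃ t : ℝ, 0 < t ∧ AWRelated E (rh3Extension t) := by
  obtain ⟨d, hd⟩ : ∃ d, d = ζ₁ ^ 2 + ζ₂ ^ 2 := ⟨_, rfl⟩
  have hd0 : 0 < d := lt_of_le_of_ne (by rw [hd]; positivity) (by rw [hd]; exact hζ.symm)
  -- In complex notation e₁ = tζw, and e₃ = [e₁, Je₁] = t²|ζ|²ζv. Their pairing is t³|ζ|⁴ = t³d²,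
  -- which must be 1.
  obtain ⟨t, ht0, ht⟩ : ∃ t : ℝ, 0 < t ∧ t ^ 3 * d ^ 2 = 1 := by
    refine ⟨((d ^ 2)⁻¹) ^ ((3 : ℕ) : ℝ)⁻¹, by positivity, ?_⟩
    rw [Real.rpow_inv_natCast_pow (by positivity) (by norm_num), inv_mul_cancel₀ (by positivity)]
  -- The phase ζ²/|ζ|² is chosen so that the rotated S maps ζw to (ζ²/|ζ|²)ζ̄v = ζv, hence e₁ to a
  -- positive multiple of e₃. `k₁` and `k₂` are the components of this identity.
  have hcs : ((ζ₁ ^ 2 - ζ₂ ^ 2) / d) ^ 2 + (2 * ζ₁ * ζ₂ / d) ^ 2 = 1 := by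
    field_simp
    rw [hd]
    ring
  obtain ⟨v', w', h'⟩ := h.rotate hcs
  obtain ⟨c, hc⟩ : ∃ c, c = (ζ₁ ^ 2 - ζ₂ ^ 2) / d := ⟨_, rfl⟩
  obtain ⟨s, hs⟩ : ∃ s, s = 2 * ζ₁ * ζ₂ / d := ⟨_, rfl⟩
  rw [← hc, ← hs] at h'
  have k₁ : ζ₁ * c + ζ₂ * s = ζ₁ := by
    rw [hc, hs]; field_simp; rw [hd]; ring
  have k₂ : ζ₁ * s - ζ₂ * c = ζ₂ := by
    rw [hc, hs]; field_simp; rw [hd]; ring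
  obtain ⟨b, hb⟩ : ∃ b, b = c • a + s • Q.J a := ⟨_, rfl⟩
  have hS : ∀ z, E.sym b z = c • E.sym a z + s • P.J (E.sym a z) := fun z => by
    rw [hb, E.sym_add, E.sym_smul, E.sym_smul, E.sym_J]
  rw [← hb] at h'
  simp only [mul_zero, sub_zero, add_zero] at h'
  have Sv : E.sym b v = 0 := by rw [hS, h.S_v]; simp
  have Sw : E.sym b w = c • v + s • P.J v := by rw [hS, h.S_w]
  obtain ⟨T, hT⟩ : ∃ T, T = 1 / (t * d) := ⟨_, rfl⟩
  have hT0 : 0 < T := by rw [hT]; positivity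
  have hTt : T * (t ^ 2 * d) = t := by rw [hT]; field_simp
  obtain ⟨e₁, he₁⟩ : ∃ e₁, e₁ = (t * ζ₁) • w + (t * ζ₂) • P.J w := ⟨_, rfl⟩
  obtain ⟨e₃, he₃⟩ : ∃ e₃, e₃ = (t ^ 2 * d * ζ₁) • v + (t ^ 2 * d * ζ₂) • P.J v := ⟨_, rfl⟩
  have S₁ : E.sym b e₁ = T • e₃ := by
    simp only [he₁, he₃, map_add, map_smul, E.sym_J_right, Sw, P.J_sq]
    linear_combination (norm := module) (t * k₁ - ζ₁ * hTt) • v + (t * k₂ - ζ₂ * hTt) • P.J v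
  have S₃ : E.sym b e₃ = 0 := by
    simp only [he₃, map_add, map_smul, E.sym_J_right, Sv, map_zero, smul_zero, neg_zero, add_zero]
  have hwJw : ⁅P.J w, w⁆ = -(ζ₁ • v + ζ₂ • P.J v) := by rw [← hww, lie_skew]
  have l₁₂ : ⁅e₁, P.J e₁⁆ = e₃ := by
    simp only [he₁, he₃, map_add, map_smul, P.J_sq, add_lie, lie_add, smul_lie, lie_smul, lie_neg,
      lie_self, hww, hwJw]
    rw [hd]
    module
  have l₁ : ∀ p q : ℝ, ⁅e₁, p • v + q • P.J v⁆ = 0 := fun p q => by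
    simp only [he₁, add_lie, lie_add, smul_lie, lie_smul, hwv, hwJv, hJwv, hJwJv, smul_zero,
      add_zero]
  have l₂ : ∀ p q : ℝ, ⁅P.J e₁, p • v + q • P.J v⁆ = 0 := fun p q => by
    simp only [he₁, map_add, map_smul, P.J_sq, add_lie, lie_add, smul_lie, lie_smul, neg_lie, hwv,
      hwJv, hJwv, hJwJv, smul_zero, add_zero, neg_zero]
  have hJe₃ : P.J e₃ = (-(t ^ 2 * d * ζ₂)) • v + (t ^ 2 * d * ζ₁) • P.J v := by
    simp only [he₃, map_add, map_smul, P.J_sq]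
    module
  have l₁₃ : ⁅e₁, e₃⁆ = 0 := by rw [he₃, l₁]
  have l₁₄ : ⁅e₁, P.J e₃⁆ = 0 := by rw [hJe₃, l₁]
  have l₂₃ : ⁅P.J e₁, e₃⁆ = 0 := by rw [he₃, l₂]
  have l₂₄ : ⁅P.J e₁, P.J e₃⁆ = 0 := by rw [hJe₃, l₂]
  have hvv' : ⁅P.J v, v⁆ = 0 := by rw [← lie_skew, hvv, neg_zero]
  have l₃₄ : ⁅e₃, P.J e₃⁆ = 0 := by
    rw [hJe₃, he₃]
    simp only [add_lie, lie_add, smul_lie, lie_smul, lie_self, hvv, hvv', smul_zero, add_zero]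
  have skew : ∀ {x y z : G}, ⁅x, y⁆ = z → ⁅y, x⁆ = -z := fun h => by rw [← h, lie_skew]
  refine ⟨T, hT0, awRelated_extension_sym E hG hH e₁ (P.J e₁) e₃ (P.J e₃)
    (forall_four fun _ _ _ _ => forall_four fun _ _ _ _ => ?_)
    (forall_four fun x₁ x₂ x₃ x₄ => forall_four fun y₁ y₂ y₃ y₄ => ?_)
    (forall_four fun _ _ _ _ => ?_) h'.unit (forall_four fun _ _ _ _ => ?_)
    (forall_four fun _ _ _ _ => ?_) (fun x => (h'.sym_anti_comp hG x).1)
    (fun x => (h'.sym_anti_comp hG x).2.1) (fun x => (h'.sym_anti_comp hG x).2.2.1)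
    (fun x => (h'.sym_anti_comp hG x).2.2.2.1) (fun x => (h'.sym_anti_comp hG x).2.2.2.2)⟩
  · simp only [rh3_br, LieModel.frame_vec, add_lie, lie_add, smul_lie, lie_smul, lie_self, l₁₂, l₁₃,
      l₁₄, l₂₃, l₂₄, l₃₄, skew l₁₂, skew l₁₃, skew l₁₄, skew l₂₃, skew l₂₄, skew l₃₄]
    module
  · simp only [LieModel.frame_vec, mulVec_four, dotProduct_four, he₁, he₃]
    simp only [map_add, map_neg, map_smul, LinearMap.add_apply, LinearMap.neg_apply,
      LinearMap.smul_apply, smul_eq_mul, P.compat, P.J_sq,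
      P.metric_J_self, P.metric_self_J, h.vv, h.ww, h.vw, h.v_Jw, h.wv, h.Jv_w, h.Jw_v, h.w_Jv]
    linear_combination (x₁ * y₃ + x₂ * y₄ + x₃ * y₁ + x₄ * y₂) * (ht - t ^ 3 * d * hd)
  · simp only [LieModel.frame_vec, mulVec_four, map_add, map_smul, P.J_sq]
    module
  · simp only [LieModel.frame_vec, mulVec_four, map_add, map_smul, E.sym_J_right, S₁, S₃, map_zero]
    module
  · simp only [LieModel.frame_vec, mulVec_four, map_add, map_smul, map_neg, E.sym_J, E.sym_J_right,
      S₁, S₃, map_zero, P.J_sq]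
    module

theorem awRelated_rp2 (h : IsExtensionNormalForm E a v w 0 0 0 0 0) {m₁ m₂ ζ₁ ζ₂ : ℝ}
    (hm : m₁ ^ 2 + m₂ ^ 2 ≠ 0) (hvv : ⁅v, P.J v⁆ = 0) (hwv : ⁅w, v⁆ = m₁ • v + m₂ • P.J v)
    (hwJv : ⁅w, P.J v⁆ = -m₂ • v + m₁ • P.J v) (hJwv : ⁅P.J w, v⁆ = m₂ • v - m₁ • P.J v)
    (hJwJv : ⁅P.J w, P.J v⁆ = m₁ • v + m₂ • P.J v)
    (hww : ⁅w, P.J w⁆ = ζ₁ • v + ζ₂ • P.J v)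
    (hG : Module.finrank ℝ G = 4) (hH : Module.finrank ℝ H = 2) :
    ∃ (p q r : ℝ) (h : q ^ 2 + r ^ 2 ≠ 0), AWRelated E (rp2Extension p q r h 1) := by
  obtain ⟨n, hn⟩ : ∃ n, n = m₁ ^ 2 + m₂ ^ 2 := ⟨_, rfl⟩
  have hn0 : n ≠ 0 := hn ▸ hm
  -- On ⟨v, Jv⟩ the vector μ₁w + μ₂Jw acts as μ̄m, so μ = m/|m|² makes e₁ act as the identity and e₂
  -- = -Je₁ as J. The rest of the frame is e₃ = φ(a)e₁ and e₄ = Je₃.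
  obtain ⟨μ₁, hμ₁⟩ : ∃ μ₁, μ₁ = m₁ / n := ⟨_, rfl⟩
  obtain ⟨μ₂, hμ₂⟩ : ∃ μ₂, μ₂ = m₂ / n := ⟨_, rfl⟩
  have k₁ : μ₁ * m₁ + μ₂ * m₂ = 1 := by rw [hμ₁, hμ₂]; field_simp; rw [hn]
  have k₂ : μ₁ * m₂ - μ₂ * m₁ = 0 := by rw [hμ₁, hμ₂]; ring
  have hμ : μ₁ ^ 2 + μ₂ ^ 2 ≠ 0 := fun h0 => by
    have h1 : μ₁ = 0 := by nlinarith [sq_nonneg μ₁, sq_nonneg μ₂]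
    have h2 : μ₂ = 0 := by nlinarith [sq_nonneg μ₁, sq_nonneg μ₂]
    rw [h1, h2] at k₁
    norm_num at k₁
  -- The correction τv does not affect the action on ⟨v, Jv⟩. It solves 2(τ₂v - τ₁Jv) = |μ|²(ζ₁v +
  -- ζ₂Jv), which makes [e₁, e₂] vanish.
  obtain ⟨τ₁, hτ₁⟩ : ∃ τ₁, τ₁ = -((μ₁ ^ 2 + μ₂ ^ 2) * ζ₂ / 2) := ⟨_, rfl⟩
  obtain ⟨τ₂, hτ₂⟩ : ∃ τ₂, τ₂ = (μ₁ ^ 2 + μ₂ ^ 2) * ζ₁ / 2 := ⟨_, rfl⟩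
  obtain ⟨e₁, he₁⟩ : ∃ e₁, e₁ = μ₁ • w + μ₂ • P.J w + τ₁ • v + τ₂ • P.J v := ⟨_, rfl⟩
  obtain ⟨e₂, he₂⟩ : ∃ e₂, e₂ = μ₂ • w - μ₁ • P.J w + τ₂ • v - τ₁ • P.J v := ⟨_, rfl⟩
  obtain ⟨e₃, he₃⟩ : ∃ e₃, e₃ = μ₁ • v - μ₂ • P.J v := ⟨_, rfl⟩
  obtain ⟨e₄, he₄⟩ : ∃ e₄, e₄ = μ₂ • v + μ₁ • P.J v := ⟨_, rfl⟩
  have skew : ∀ {x y z : G}, ⁅x, y⁆ = z → ⁅y, x⁆ = -z := fun h => by rw [← h, lie_skew]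
  have l₁v : ⁅e₁, v⁆ = v := by
    simp only [he₁, add_lie, smul_lie, hwv, hJwv, lie_self, skew hvv]
    linear_combination (norm := module) k₁ • v + k₂ • P.J v
  have l₁Jv : ⁅e₁, P.J v⁆ = P.J v := by
    simp only [he₁, add_lie, smul_lie, hwJv, hJwJv, lie_self, hvv]
    linear_combination (norm := module) -k₂ • v + k₁ • P.J v
  have l₂v : ⁅e₂, v⁆ = P.J v := by
    simp only [he₂, add_lie, sub_lie, smul_lie, hwv, hJwv, lie_self, skew hvv]
    linear_combination (norm := module) -k₂ • v + k₁ • P.J v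
  have l₂Jv : ⁅e₂, P.J v⁆ = -v := by
    simp only [he₂, add_lie, sub_lie, smul_lie, hwJv, hJwJv, lie_self, hvv]
    linear_combination (norm := module) -k₁ • v - k₂ • P.J v
  have l₁₂ : ⁅e₁, e₂⁆ = 0 := by
    have hw : ⁅μ₁ • w + μ₂ • P.J w, e₂⁆
        = (-(μ₁ ^ 2 + μ₂ ^ 2)) • (ζ₁ • v + ζ₂ • P.J v) + τ₂ • v - τ₁ • P.J v := by
      have a₁ : ⁅μ₁ • w + μ₂ • P.J w, v⁆ = v := by
        simp only [add_lie, smul_lie, hwv, hJwv]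
        linear_combination (norm := module) k₁ • v + k₂ • P.J v
      have a₂ : ⁅μ₁ • w + μ₂ • P.J w, P.J v⁆ = P.J v := by
        simp only [add_lie, smul_lie, hwJv, hJwJv]
        linear_combination (norm := module) -k₂ • v + k₁ • P.J v
      rw [he₂]
      simp only [lie_add, lie_sub, lie_smul, a₁, a₂]
      simp only [add_lie, smul_lie, lie_self, hww, skew hww]
      module
    have hv : ⁅τ₁ • v + τ₂ • P.J v, e₂⁆ = -τ₁ • P.J v + τ₂ • v := by
      simp only [add_lie, smul_lie, skew l₂v, skew l₂Jv]
      module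
    have : e₁ = (μ₁ • w + μ₂ • P.J w) + (τ₁ • v + τ₂ • P.J v) := by rw [he₁]; module
    rw [this, add_lie, hw, hv]
    rw [hτ₁, hτ₂]
    module
  have l₁₃ : ⁅e₁, e₃⁆ = e₃ := by rw [he₃, lie_sub, lie_smul, lie_smul, l₁v, l₁Jv]
  have l₁₄ : ⁅e₁, e₄⁆ = e₄ := by rw [he₄, lie_add, lie_smul, lie_smul, l₁v, l₁Jv]
  have l₂₃ : ⁅e₂, e₃⁆ = e₄ := by
    rw [he₃, he₄, lie_sub, lie_smul, lie_smul, l₂v, l₂Jv]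
    module
  have l₂₄ : ⁅e₂, e₄⁆ = -e₃ := by
    rw [he₃, he₄, lie_add, lie_smul, lie_smul, l₂v, l₂Jv]
    module
  have l₃₄ : ⁅e₃, e₄⁆ = 0 := by
    simp only [he₃, he₄, sub_lie, lie_add, smul_lie, lie_smul, lie_self, hvv, skew hvv]
    module
  have hqr : (2 * μ₁ * μ₂) ^ 2 + (-(μ₁ ^ 2 - μ₂ ^ 2)) ^ 2 ≠ 0 := by
    have : (2 * μ₁ * μ₂) ^ 2 + (-(μ₁ ^ 2 - μ₂ ^ 2)) ^ 2 = (μ₁ ^ 2 + μ₂ ^ 2) ^ 2 := by ring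
    rw [this]
    exact pow_ne_zero 2 hμ
  -- These are p = g(e₁, e₁), q = g(e₁, e₄) and r = -g(e₁, e₃).
  refine ⟨2 * (μ₁ * τ₁ + μ₂ * τ₂), 2 * μ₁ * μ₂, -(μ₁ ^ 2 - μ₂ ^ 2), hqr,
    awRelated_extension_of_eq E hG hH e₁ e₂ e₃ e₄
    (forall_four fun _ _ _ _ => forall_four fun _ _ _ _ => ?_)
    (forall_four fun _ _ _ _ => forall_four fun _ _ _ _ => ?_)
    (forall_four fun _ _ _ _ => ?_) h.unit (forall_four fun _ _ _ _ => ?_)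
    (forall_four fun _ _ _ _ => ?_)⟩
  · simp only [rp2_br, LieModel.frame_vec, add_lie, lie_add, smul_lie, lie_smul, lie_self, l₁₂, l₁₃,
      l₁₄, l₂₃, l₂₄, l₃₄, skew l₁₂, skew l₁₃, skew l₁₄, skew l₂₃, skew l₂₄, skew l₃₄]
    module
  · simp only [LieModel.frame_vec, mulVec_four, dotProduct_four, he₁, he₂, he₃, he₄]
    simp only [map_add, map_sub, map_smul, LinearMap.add_apply, LinearMap.sub_apply,
      LinearMap.smul_apply, smul_eq_mul, P.compat,
      P.metric_J_self, P.metric_self_J, h.vv, h.ww, h.vw, h.v_Jw, h.wv, h.Jv_w, h.Jw_v, h.w_Jv]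
    ring
  · simp only [LieModel.frame_vec, mulVec_four, he₁, he₂, he₃, he₄, map_add, map_sub, map_smul,
      P.J_sq]
    module
  · simp only [LieModel.frame_vec, mulVec_four, he₁, he₂, he₃, he₄, map_add, map_sub, map_smul,
      h.φ_v, h.φ_Jv, h.φ_w, h.φ_Jw]
    module
  · simp only [LieModel.frame_vec, mulVec_four, he₁, he₂, he₃, he₄, map_add, map_sub, map_smul,
      h.φJ_v, h.φJ_Jv, h.φJ_w, h.φJ_Jw]
    module

end IsExtensionNormalForm

end

/-! ## The classification -/

section

variable {G H : Type*} [LieRing G] [LieAlgebra ℝ G] [FiniteDimensional ℝ G] [LieRing H]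
  [LieAlgebra ℝ H] [IsLieAbelian H] {P : PseudoKahler G} {Q : PseudoKahler H}

theorem IsExtensionNormalForm.classification {E : PKExtension P Q} {a : H} {v w : G}
    {κ α₁ α₂ β β' : ℝ} (h : IsExtensionNormalForm E a v w κ α₁ α₂ β β')
    (hG : Module.finrank ℝ G = 4) (hH : Module.finrank ℝ H = 2) :
    (∃ a : ℝ, 0 < a ∧ AWRelated E (r4Semisimple a)) ∨
    (∃ a b c : ℝ, 0 < a ∧ ((b = 0 ∧ c = 0) ∨ c ≠ 0) ∧ AWRelated E (r4NonSemisimple a b c)) ∨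
    (∃ a : ℝ, 0 < a ∧ AWRelated E (rh3Extension a)) ∨
    (∃ (p q r : ℝ) (h : q ^ 2 + r ^ 2 ≠ 0) (a : ℝ),
      0 < a ∧ AWRelated E (rp2Extension p q r h a)) := by
  by_cases hκ : κ = 0
  swap
  · exact Or.inl (h.awRelated_r4Semisimple hκ hG hH)
  subst hκ
  refine Or.inr ?_
  by_cases hα : α₁ ^ 2 + α₂ ^ 2 = 0
  swap
  · obtain ⟨b, c, hc, hE⟩ := h.awRelated_r4NonSemisimple hα hG hH
    exact Or.inl ⟨1, b, c, one_pos, Or.inr hc, hE⟩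
  obtain rfl : α₁ = 0 := by nlinarith [sq_nonneg α₁, sq_nonneg α₂]
  obtain rfl : α₂ = 0 := by nlinarith [sq_nonneg α₂]
  -- With κ = α = 0 no constraint on β + iβ' remains, and a rotation by its phase makes it real.
  obtain ⟨a, v, w, β, h⟩ : ∃ (a : H) (v w : G) (β : ℝ), IsExtensionNormalForm E a v w 0 0 0 β 0 := by
    by_cases hβ : β ^ 2 + β' ^ 2 = 0
    · obtain rfl : β = 0 := by nlinarith [sq_nonneg β, sq_nonneg β']
      obtain rfl : β' = 0 := by nlinarith [sq_nonneg β']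
      exact ⟨_, _, _, _, h⟩
    · have hn : √(β ^ 2 + β' ^ 2) ^ 2 = β ^ 2 + β' ^ 2 := Real.sq_sqrt (by positivity)
      have hn0 : √(β ^ 2 + β' ^ 2) ≠ 0 := fun h0 => hβ (by rw [← hn, h0]; ring)
      obtain ⟨v', w', h'⟩ := h.rotate (c := β / √(β ^ 2 + β' ^ 2)) (s := β' / √(β ^ 2 + β' ^ 2))
        (by rw [div_pow, div_pow, hn, ← add_div, div_self hβ])
      simp only [mul_zero, sub_zero, add_zero] at h'
      have e : β / √(β ^ 2 + β' ^ 2) * β' - β' / √(β ^ 2 + β' ^ 2) * β = 0 := by ring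
      rw [e] at h'
      exact ⟨_, _, _, _, h'⟩
  obtain ⟨m₁, m₂, ζ₁, ζ₂, hvv, hwv, hwJv, hJwv, hJwJv, hww, hβ₁, hβ₂⟩ := h.exists_lie_eq hG
  by_cases hm : m₁ ^ 2 + m₂ ^ 2 = 0
  · obtain rfl : m₁ = 0 := by nlinarith [sq_nonneg m₁, sq_nonneg m₂]
    obtain rfl : m₂ = 0 := by nlinarith [sq_nonneg m₂]
    simp only [neg_zero, zero_smul, add_zero, sub_zero] at hwv hwJv hJwv hJwJv
    by_cases hζ : ζ₁ ^ 2 + ζ₂ ^ 2 = 0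
    · obtain rfl : ζ₁ = 0 := by nlinarith [sq_nonneg ζ₁, sq_nonneg ζ₂]
      obtain rfl : ζ₂ = 0 := by nlinarith [sq_nonneg ζ₂]
      simp only [zero_smul, add_zero] at hww
      refine Or.inl ⟨1, 0, 0, one_pos, Or.inl ⟨rfl, rfl⟩,
        h.awRelated_r4NonSemisimple_zero (fun x y => ?_) hG hH⟩
      have skew : ∀ {x y : G}, ⁅x, y⁆ = 0 → ⁅y, x⁆ = 0 := fun h => by
        rw [← lie_skew, h, neg_zero]
      obtain ⟨p, q, r, s, rfl⟩ := h.exists_eq_comb hG x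
      obtain ⟨p', q', r', s', rfl⟩ := h.exists_eq_comb hG y
      simp only [add_lie, lie_add, smul_lie, lie_smul, lie_self, hvv, hwv, hwJv, hJwv, hJwJv, hww,
        skew hvv, skew hwv, skew hwJv, skew hJwv, skew hJwJv, skew hww, smul_zero, add_zero]
    · exact Or.inr (Or.inl (h.awRelated_rh3 hζ hvv hwv hwJv hJwv hJwJv hww hG hH))
  -- Since βm = 0, a non-zero m leaves no skew part at all, and the extension is isomorphic to the
  -- model, not only AW-related.
  · obtain rfl : β = 0 := by
      by_contra hβ
      have h1 := (mul_eq_zero.1 hβ₁).resolve_left hβ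
      have h2 := (mul_eq_zero.1 hβ₂).resolve_left hβ
      exact hm (by rw [h1, h2]; ring)
    obtain ⟨p, q, r, hqr, hE⟩ := h.awRelated_rp2 hm hvv hwv hwJv hJwv hJwJv hww hG hH
    exact Or.inr (Or.inr ⟨p, q, r, hqr, 1, one_pos, hE⟩)

theorem classification_of_not_isTrivial (E : PKExtension P Q)
    (hG : Module.finrank ℝ G = 4) (hH : Module.finrank ℝ H = 2)
    (hQ : ∀ A : H, A ≠ 0 → 0 < Q.metric A A) (hE : ¬ E.IsTrivial) :
    (∃ a : ℝ, 0 < a ∧ AWRelated E (r4Semisimple a)) ∨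
    (∃ a b c : ℝ, 0 < a ∧ ((b = 0 ∧ c = 0) ∨ c ≠ 0) ∧ AWRelated E (r4NonSemisimple a b c)) ∨
    (∃ a : ℝ, 0 < a ∧ AWRelated E (rh3Extension a)) ∨
    (∃ (p q r : ℝ) (h : q ^ 2 + r ^ 2 ≠ 0) (a : ℝ),
      0 < a ∧ AWRelated E (rp2Extension p q r h a)) := by
  rw [E.isTrivial_iff] at hE
  push Not at hE
  obtain ⟨A, hA⟩ := hE
  obtain ⟨x, hx⟩ : ∃ x, E.sym A x ≠ 0 := by
    by_contra! h
    exact hA (LinearMap.ext h)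
  have hA0 : A ≠ 0 := by
    rintro rfl
    have := E.sym_smul 0 0 x
    rw [zero_smul, zero_smul] at this
    exact hx this
  have hp := hQ A hA0
  set n := √(Q.metric A A)
  have hn : n ^ 2 = Q.metric A A := Real.sq_sqrt hp.le
  have hn0 : n ≠ 0 := (Real.sqrt_pos.2 hp).ne'
  -- Positivity of the metric on 𝔥 lets the vector with non-zero symmetric part be scaled to unit
  -- length.
  obtain ⟨v, w, κ, α₁, α₂, β, β', h⟩ := exists_isExtensionNormalForm E hG (a := n⁻¹ • A)
    (by
      rw [map_smul, map_smul, LinearMap.smul_apply, ← hn, smul_eq_mul, smul_eq_mul]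
      field_simp)
    ⟨x, by rw [E.sym_smul]; exact smul_ne_zero (inv_ne_zero hn0) hx⟩
  exact h.classification hG hH

end

/-! ## Non-triviality -/

section

/-- Triviality would make the matrix of φ(a₁) skew for g, which one or two entries refute for each
family. -/
theorem LieModel.extension_symm_of_isTrivial {m : LieModel 4} {P : PseudoKahler m.Alg}
    {g J M₁ M₂ : Matrix (Fin 4) (Fin 4) ℝ} {hg hJ hd₁ hd₂ hc hs h₁ h₂}
    (h : (m.extension P g J M₁ M₂ hg hJ hd₁ hd₂ hc hs h₁ h₂).IsTrivial) (x y : Fin 4 → ℝ) :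
    M₁.mulVec x ⬝ᵥ g.mulVec y + x ⬝ᵥ g.mulVec (M₁.mulVec y) = 0 := by
  rw [PKExtension.isTrivial_iff] at h
  have h1 := (PseudoHermitian.symPart_eq_zero_iff _ _).1 (h ((abelian 2).vec ![1, 0]))
    (m.vec x) (m.vec y)
  rw [LieDerivation.coeFn_coe, LieModel.extension_φ_apply, LieModel.extension_φ_apply, hg,
    m.form_vec, m.form_vec] at h1
  exact h1

theorem not_isTrivial_r4Semisimple {a : ℝ} (ha : 0 < a) : ¬ (r4Semisimple a).IsTrivial := by
  intro h
  have h1 := LieModel.extension_symm_of_isTrivial h ![1, 0, 0, 0] ![1, 0, 0, 0]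
  simp only [mulVec_four, dotProduct_four] at h1
  linarith

theorem not_isTrivial_r4NonSemisimple {a : ℝ} (b c : ℝ) (ha : 0 < a) :
    ¬ (r4NonSemisimple a b c).IsTrivial := by
  intro h
  have h1 := LieModel.extension_symm_of_isTrivial h ![1, 0, 0, 0] ![1, 0, 0, 0]
  simp only [mulVec_four, dotProduct_four] at h1
  linarith

theorem not_isTrivial_rh3Extension {a : ℝ} (ha : 0 < a) : ¬ (rh3Extension a).IsTrivial := by
  intro h
  have h1 := LieModel.extension_symm_of_isTrivial h ![1, 0, 0, 0] ![1, 0, 0, 0]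
  simp only [mulVec_four, dotProduct_four] at h1
  linarith

theorem not_isTrivial_rp2Extension {p q r : ℝ} (hqr : q ^ 2 + r ^ 2 ≠ 0) {a : ℝ} (ha : 0 < a) :
    ¬ (rp2Extension p q r hqr a).IsTrivial := by
  intro h
  have h1 := LieModel.extension_symm_of_isTrivial h ![1, 0, 0, 0] ![1, 0, 0, 0]
  have h2 := LieModel.extension_symm_of_isTrivial h ![1, 0, 0, 0] ![0, 1, 0, 0]
  simp only [mulVec_four, dotProduct_four] at h1 h2
  have hr : a * r = 0 := by linarith
  have hq : a * q = 0 := by linarith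
  have hr' := (mul_eq_zero.1 hr).resolve_left ha.ne'
  have hq' := (mul_eq_zero.1 hq).resolve_left ha.ne'
  exact hqr (by rw [hr', hq']; ring)

variable {G G' H : Type*} [LieRing G] [LieAlgebra ℝ G] [LieRing G'] [LieAlgebra ℝ G'] [LieRing H]
  [LieAlgebra ℝ H] {P : PseudoKahler G} {P' : PseudoKahler G'} {Q : PseudoKahler H}

/-- The derivation `f⁻¹ D f`. -/
def derivationComap (f : G ≃ₗ⁅ℝ⁆ G') (D : LieDerivation ℝ G' G') : LieDerivation ℝ G G where
  toLinearMap := (f.symm : G' →ₗ[ℝ] G) ∘ₗ D.toLinearMap ∘ₗ (f : G →ₗ[ℝ] G')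
  leibniz' x y := by
    change f.symm (D (f ⁅x, y⁆)) = ⁅x, f.symm (D (f y))⁆ - ⁅y, f.symm (D (f x))⁆
    rw [LieEquiv.map_lie, D.apply_lie_eq_sub, map_sub, LieEquiv.map_lie, LieEquiv.map_lie,
      LieEquiv.symm_apply_apply, LieEquiv.symm_apply_apply]

theorem derivationComap_apply (f : G ≃ₗ⁅ℝ⁆ G') (D : LieDerivation ℝ G' G') (x : G) :
    derivationComap f D x = f.symm (D (f x)) := rfl

variable [FiniteDimensional ℝ G] [FiniteDimensional ℝ G']

/-- A pseudo-Kähler Lie algebra equivalent to one with a non-trivial extension has a non-trivial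
extension. -/
theorem exists_not_isTrivial_of_equiv (f : PseudoKahlerEquiv P P') (E' : PKExtension P' Q)
    (hE' : ¬ E'.IsTrivial) : ∃ E : PKExtension P Q, ¬ E.IsTrivial := by
  let k := f.toLieEquiv
  have hkk : ∀ x, k (k.symm x) = x := k.apply_symm_apply
  have hki : ∀ x y, k x = k y → x = y := fun x y h => k.injective h
  have hks : ∀ y, ∃ x, k x = y := k.surjective
  have hJ : ∀ x, k (P.J x) = P'.J (k x) := f.map_J
  have hg : ∀ x y, P.metric x y = P'.metric (k x) (k y) := fun x y => (f.map_metric x y).symm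
  let φ : H →ₗ⁅ℝ⁆ LieDerivation ℝ G G :=
    { toFun := fun A => derivationComap k (E'.φ A)
      map_add' := fun A B => by
        ext x
        simp only [derivationComap_apply, map_add, LieDerivation.add_apply]
      map_smul' := fun t A => by
        ext x
        simp only [derivationComap_apply, map_smul, LieDerivation.smul_apply, RingHom.id_apply]
      map_lie' := fun {A B} => by
        ext x
        simp only [LieDerivation.lie_apply, derivationComap_apply, LieHom.map_lie, map_sub,
          LieEquiv.apply_symm_apply] }
  have hφ : ∀ A x, k (φ A x) = E'.φ A (k x) := fun A x => hkk _
  have hext : IsExtension P Q φ := by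
    -- Integrability and closedness involve only J, the metric and φ, so unlike metric adjoints they
    -- transport along f at once.
    have h := (isExtension_iff P' Q E'.φ).1 E'.isExtension
    rw [semidirect_integrable_iff, semidirect_omegaClosed_iff] at h
    rw [isExtension_iff, semidirect_integrable_iff, semidirect_omegaClosed_iff]
    refine ⟨fun A x => hki _ _ ?_, fun A x y => ?_⟩
    · simp only [map_add, map_neg, map_zero, hφ, hJ]
      exact h.1 A (k x)
    · simp only [hg, hJ, hφ]
      exact h.2 A (k x) (k y)
  refine ⟨⟨φ, hext⟩, fun h => hE' ?_⟩
  rw [PKExtension.isTrivial_iff] at h ⊢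
  intro A
  have h1 := h A
  rw [PseudoHermitian.symPart_eq_zero_iff] at h1 ⊢
  intro x y
  obtain ⟨x, rfl⟩ := hks x
  obtain ⟨y, rfl⟩ := hks y
  have h2 := h1 x y
  simp only [LieDerivation.coeFn_coe, hg, hφ] at h2
  exact h2

end

theorem planeKahler_metric_pos (A : (abelian 2).Alg) (hA : A ≠ 0) : 0 < planeKahler.metric A A := by
  obtain ⟨v, rfl⟩ := (abelian 2).vec.surjective A
  have e : planeKahler.metric ((abelian 2).vec v) ((abelian 2).vec v) = v ⬝ᵥ v :=
    ((abelian 2).form_vec 1 v v).trans (by rw [Matrix.one_mulVec])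
  have hv : v ≠ 0 := fun h => hA (by rw [h, map_zero])
  have h0 : v ⬝ᵥ v ≠ 0 := fun h => hv (dotProduct_self_eq_zero.1 h)
  rw [e]
  exact lt_of_le_of_ne (Finset.sum_nonneg fun i _ => mul_self_nonneg (v i)) h0.symm

instance isLieAbelian_abelian (n : ℕ) : IsLieAbelian (abelian n).Alg := ⟨fun _ _ => rfl⟩

/-- An AW-relation contains an isomorphism of the underlying pseudo-Kähler algebras, so the
classification gives one direction; pulling back one listed extension for each algebra gives the
other. -/
theorem exists_not_isTrivial_iff {G : Type*} [LieRing G] [LieAlgebra ℝ G] [FiniteDimensional ℝ G]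
    (P : PseudoKahler G) (hG : Module.finrank ℝ G = 4) :
    (∃ E : PKExtension P planeKahler, ¬ E.IsTrivial) ↔
      (Nonempty (PseudoKahlerEquiv P r4Kahler) ∨ Nonempty (PseudoKahlerEquiv P rh3Kahler) ∨
        ∃ (p q r : ℝ) (h : q ^ 2 + r ^ 2 ≠ 0),
          Nonempty (PseudoKahlerEquiv P (rp2Kahler p q r h))) := by
  constructor
  · rintro ⟨E, hE⟩
    rcases classification_of_not_isTrivial E hG (abelian 2).finrank_alg planeKahler_metric_pos hE
      with ⟨a, -, f, -⟩ | ⟨a, b, c, -, -, f, -⟩ | ⟨a, -, f, -⟩ | ⟨p, q, r, h, a, -, f, -⟩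
    · exact Or.inl ⟨f⟩
    · exact Or.inl ⟨f⟩
    · exact Or.inr (Or.inl ⟨f⟩)
    · exact Or.inr (Or.inr ⟨p, q, r, h, ⟨f⟩⟩)
  · rintro (⟨⟨f⟩⟩ | ⟨⟨f⟩⟩ | ⟨p, q, r, h, ⟨f⟩⟩)
    · exact exists_not_isTrivial_of_equiv f _ (not_isTrivial_r4Semisimple one_pos)
    · exact exists_not_isTrivial_of_equiv f _ (not_isTrivial_rh3Extension one_pos)
    · exact exists_not_isTrivial_of_equiv f _ (not_isTrivial_rp2Extension h one_pos)

end PK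

end

theorem mainTheorem2 :
    -- every non-trivial extension is AW-related to one in the list
    (∀ (G : Type*) [LieRing G] [LieAlgebra ℝ G] [FiniteDimensional ℝ G]
      (H : Type*) [LieRing H] [LieAlgebra ℝ H] [IsLieAbelian H]
      (P : PseudoKahler G) (Q : PseudoKahler H) (E : PKExtension P Q),
      Module.finrank ℝ G = 4 → Module.finrank ℝ H = 2 →
      (∀ A : H, A ≠ 0 → 0 < Q.metric A A) → ¬ E.IsTrivial →
      (∃ a : ℝ, 0 < a ∧ AWRelated E (r4Semisimple a)) ∨
      (∃ a b c : ℝ, 0 < a ∧ ((b = 0 ∧ c = 0) ∨ c ≠ 0) ∧ AWRelated E (r4NonSemisimple a b c)) ∨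
      (∃ a : ℝ, 0 < a ∧ AWRelated E (rh3Extension a)) ∨
      (∃ (p q r : ℝ) (h : q ^ 2 + r ^ 2 ≠ 0) (a : ℝ),
        0 < a ∧ AWRelated E (rp2Extension p q r h a))) ∧
    -- the extensions in the list are non-trivial
    (∀ a : ℝ, 0 < a → ¬ (r4Semisimple a).IsTrivial) ∧
    (∀ a b c : ℝ, 0 < a → ¬ (r4NonSemisimple a b c).IsTrivial) ∧
    (∀ a : ℝ, 0 < a → ¬ (rh3Extension a).IsTrivial) ∧
    (∀ (p q r : ℝ) (h : q ^ 2 + r ^ 2 ≠ 0) (a : ℝ),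
      0 < a → ¬ (rp2Extension p q r h a).IsTrivial) ∧
    -- the pseudo-Kähler Lie algebras that admit non-trivial extensions
    (∀ (G : Type*) [LieRing G] [LieAlgebra ℝ G] [FiniteDimensional ℝ G] (P : PseudoKahler G),
      Module.finrank ℝ G = 4 →
      ((∃ E : PKExtension P planeKahler, ¬ E.IsTrivial) ↔
        (Nonempty (PseudoKahlerEquiv P r4Kahler) ∨ Nonempty (PseudoKahlerEquiv P rh3Kahler) ∨
          ∃ (p q r : ℝ) (h : q ^ 2 + r ^ 2 ≠ 0),
            Nonempty (PseudoKahlerEquiv P (rp2Kahler p q r h))))) := by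
  exact ⟨fun G _ _ _ H _ _ _ P Q E hG hH hQ hE => classification_of_not_isTrivial E hG hH hQ hE,
    fun _ ha => not_isTrivial_r4Semisimple ha, fun _ b c ha => not_isTrivial_r4NonSemisimple b c ha,
    fun _ ha => not_isTrivial_rh3Extension ha,
    fun _ _ _ h _ ha => not_isTrivial_rp2Extension h ha,
    fun G _ _ _ P hG => exists_not_isTrivial_iff P hG⟩
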